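/- **Setting.** Let $\mathcal O=\mathcal O_{\mathbb C^n,0}=\mathbb C\{x_1,\dots,x_n\}$. Let $(D,0)=(V(f),0)\subset(\mathbb C^n,0)$ be a germ of a free divisor, i.e. $f\in\mathcal O$ is a nonzero non-unit, $\mathcal O/(f)$ is reduced, and the module of logarithmic vector fields $\mathrm{Der}(-\log D)=\{\delta=\sum_i a_i\,\partial/\partial x_i \mid a_i\in\mathcal O,\ \delta(f)\in (f)\}$ is a free $\mathcal O$-module. The germ $(D,0)$ is called linear if $\mathrm{Der}(-\log D)$ has a basis of vector fields all of whose coefficients are linear forms in $x_1,\dots,x_n$. Let $\mathbf{Art}$ be the category of local Artin $\mathbb C$-algebras with residue field $k=\mathbb C$. For $A\in\mathbf{Art}$ with maximal ideal $\mathfrak m_A$ and $S=\operatorname{Spec}A$, put $\mathcal O_A=A\otimes_{\mathbb C}\mathcal O$, the local ring of $\mathbb C^n\times S$. An *admissible deformation* of $(D,0)$ over $S$ is a germ $X\subset\mathbb C^n\times S$, given by an ideal $I\subset\mathcal O_A$, such that $\mathcal O_A/I$ is flat over $A$, the special fibre of $X$ is $D$ (the image of $I$ in $\mathcal O$ is $(f)$),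 and restriction to the special fibre induces an isomorphism $$\mathrm{Der}(-\log X/S)/\mathfrak m_A\,\mathrm{Der}(-\log X/S)\;\cong\;\mathrm{Der}(-\log D),$$ where $\mathrm{Der}(-\log X/S)$ is the $\mathcal O_A$-module of relative vector fields $\delta=\sum_i a_i\,\partial/\partial x_i$, $a_i\in\mathcal O_A$, with $\delta(I)\subset I$. If $D$ is linear, the deformation is *linearly admissible* if moreover $\mathrm{Der}(-\log X/S)$ has an $\mathcal O_A$-basis of vector fields whose coefficients are linear forms in $x_1,\dots,x_n$ with coefficients in $A$. Two (linearly) admissible deformations $X,Y$ over $S$ are isomorphic if there is an isomorphism of $A$-algebras $\mathcal O_X\cong\mathcal O_Y$ that is compatible with the restrictions to $\mathcal O_D=\mathcal O/(f)$. Let $\mathbf{FD}_D(A)$, respectively $\mathbf{LFD}_D(A)$ if $D$ is linear, be the set of isomorphism classes of admissible, respectively linearly admissible, deformations of $(D,0)$ over $\operatorname{Spec}A$, pointed by the class of the trivial deformation $D\times S$. By base change these are functors from $\mathbf{Art}$ to pointed sets. A surjection $A''\to A$ in $\mathbf{Art}$ is a *small extension* if its kernel is a nonzero principal ideal $(t)$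 with $\mathfrak m_{A''}t=0$. For a functor $F$ on $\mathbf{Art}$ and morphisms $A'\to A$, $A''\to A$, let $$\tau\colon F(A'\times_AA'')\to F(A')\times_{F(A)}F(A'')$$ be the natural map. *Schlessinger's conditions* are: * (H1) $\tau$ is surjective whenever $A''\to A$ is a small extension; * (H2) $\tau$ is bijective when $A=k$ and $A''=k[\varepsilon]$, $\varepsilon^2=0$. **Theorem.** Let $(D,0)\subset(\mathbb C^n,0)$ be a germ of a free divisor. Then the functor $\mathbf{FD}_D$ satisfies (H1) and (H2). If moreover $(D,0)$ is linear, then the functor $\mathbf{LFD}_D$ also satisfies (H1) and (H2). -/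

import Mathlib

open scoped TensorProduct
open CategoryTheory

noncomputable section

/-- A formal power series over `ℂ` in `n` variables is convergent if it converges absolutely on
some polydisc of positive radius around the origin. -/
def IsConvergent {n : ℕ} (p : MvPowerSeries (Fin n) ℂ) : Prop :=
  ∃ r : ℝ, 0 < r ∧ Summable fun d : Fin n →₀ ℕ => ‖MvPowerSeries.coeff d p‖ * r ^ d.degree

theorem IsConvergent.exists_radius_le {n : ℕ} {p : MvPowerSeries (Fin n) ℂ} {r s : ℝ}
    (hs : 0 ≤ s) (hsr : s ≤ r)
    (h : Summable fun d : Fin n →₀ ℕ => ‖MvPowerSeries.coeff d p‖ * r ^ d.degree) :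
    Summable fun d : Fin n →₀ ℕ => ‖MvPowerSeries.coeff d p‖ * s ^ d.degree :=
  h.of_nonneg_of_le (fun d => by positivity) fun d => by gcongr

theorem isConvergent_algebraMap {n : ℕ} (c : ℂ) :
    IsConvergent (algebraMap ℂ (MvPowerSeries (Fin n) ℂ) c) := by
  classical
  refine ⟨1, one_pos, summable_of_hasFiniteSupport ((Set.finite_singleton 0).subset ?_)⟩
  intro d hd
  by_contra hne
  apply hd
  have : MvPowerSeries.coeff d (algebraMap ℂ (MvPowerSeries (Fin n) ℂ) c) = 0 := by
    rw [MvPowerSeries.algebraMap_apply, MvPowerSeries.coeff_C, if_neg (by simpa using hne)]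
  simp [this]

theorem IsConvergent.add {n : ℕ} {p q : MvPowerSeries (Fin n) ℂ}
    (hp : IsConvergent p) (hq : IsConvergent q) : IsConvergent (p + q) := by
  obtain ⟨r, hr, hpr⟩ := hp
  obtain ⟨s, hs, hqs⟩ := hq
  have h1 := IsConvergent.exists_radius_le (lt_min hr hs).le (min_le_left r s) hpr
  have h2 := IsConvergent.exists_radius_le (lt_min hr hs).le (min_le_right r s) hqs
  have ht : 0 < min r s := lt_min hr hs
  refine ⟨min r s, ht, (h1.add h2).of_nonneg_of_le (fun d => by positivity) fun d => ?_⟩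
  rw [← add_mul, map_add]
  gcongr
  exact norm_add_le _ _

theorem IsConvergent.mul {n : ℕ} {p q : MvPowerSeries (Fin n) ℂ}
    (hp : IsConvergent p) (hq : IsConvergent q) : IsConvergent (p * q) := by
  classical
  obtain ⟨r, hr, hpr⟩ := hp
  obtain ⟨s, hs, hqs⟩ := hq
  have h1 := IsConvergent.exists_radius_le (lt_min hr hs).le (min_le_left r s) hpr
  have h2 := IsConvergent.exists_radius_le (lt_min hr hs).le (min_le_right r s) hqs
  have ht : 0 < min r s := lt_min hr hs
  set t := min r s
  let F : (Fin n →₀ ℕ) → ℝ := fun d => ‖MvPowerSeries.coeff d p‖ * t ^ d.degree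
  let G : (Fin n →₀ ℕ) → ℝ := fun d => ‖MvPowerSeries.coeff d q‖ * t ^ d.degree
  have hF : 0 ≤ F := fun d => by positivity
  have hG : 0 ≤ G := fun d => by positivity
  have hFG : Summable fun x : (Fin n →₀ ℕ) × (Fin n →₀ ℕ) => F x.1 * G x.2 :=
    Summable.mul_of_nonneg (f := F) (g := G) h1 h2 hF hG
  have h3 := summable_sum_mul_antidiagonal_of_summable_mul (f := F) (g := G) hFG
  refine ⟨t, ht, h3.of_nonneg_of_le (fun d => by positivity) fun d => ?_⟩
  rw [MvPowerSeries.coeff_mul]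
  refine (mul_le_mul_of_nonneg_right (norm_sum_le _ _) (by positivity)).trans ?_
  rw [Finset.sum_mul]
  refine Finset.sum_le_sum fun x hx => ?_
  rw [← Finset.HasAntidiagonal.mem_antidiagonal.mp hx, norm_mul, map_add, pow_add]
  exact le_of_eq (by simp only [F, G]; ring)

theorem IsConvergent.pderiv {n : ℕ} {p : MvPowerSeries (Fin n) ℂ} (i : Fin n)
    (hp : IsConvergent p) : IsConvergent (MvPowerSeries.pderiv ℂ i p) := by
  classical
  obtain ⟨r, hr, hpr⟩ := hp
  have hinj : Function.Injective fun d : Fin n →₀ ℕ => d + Finsupp.single i 1 :=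
    add_left_injective _
  refine ⟨r / 2, by positivity, ((hpr.comp_injective hinj).mul_right r⁻¹).of_nonneg_of_le
    (fun d => by positivity) fun d => ?_⟩
  have h1 : ((d i : ℝ) + 1) ≤ 2 ^ d.degree := by
    have h2 : d i + 1 ≤ 2 ^ d.degree :=
      (Nat.lt_two_pow_self (n := d i)).trans_le
        (Nat.pow_le_pow_right (by norm_num) (Finsupp.le_degree i d))
    exact_mod_cast h2
  have h3 : ‖((d i : ℂ) + 1)‖ = (d i : ℝ) + 1 := by
    have : ((d i : ℂ) + 1) = ((d i + 1 : ℕ) : ℂ) := by push_cast; rfl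
    rw [this, Complex.norm_natCast]; push_cast; rfl
  simp only [Function.comp]
  rw [MvPowerSeries.coeff_pderiv, norm_mul, h3, map_add, Finsupp.degree_single, pow_succ, div_pow]
  have h4 : ((d i : ℝ) + 1) / 2 ^ d.degree ≤ 1 := by
    rw [div_le_one (by positivity)]; exact h1
  calc ‖MvPowerSeries.coeff (d + Finsupp.single i 1) p‖ * ((d i : ℝ) + 1)
        * (r ^ d.degree / 2 ^ d.degree)
      = ‖MvPowerSeries.coeff (d + Finsupp.single i 1) p‖ * r ^ d.degree
        * (((d i : ℝ) + 1) / 2 ^ d.degree) := by ring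
    _ ≤ ‖MvPowerSeries.coeff (d + Finsupp.single i 1) p‖ * r ^ d.degree * 1 := by gcongr
    _ = _ := by field_simp

/-- The ring `ℂ{x₁, …, xₙ}` of convergent power series, as a subalgebra of the formal ones. -/
def convergentSubalgebra (n : ℕ) : Subalgebra ℂ (MvPowerSeries (Fin n) ℂ) where
  carrier := {p | IsConvergent p}
  mul_mem' := IsConvergent.mul
  add_mem' := IsConvergent.add
  algebraMap_mem' := isConvergent_algebraMap

/-- The local ring `𝒪_{ℂⁿ,0} = ℂ{x₁, …, xₙ}` of germs of holomorphic functions. -/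
def HolGerm (n : ℕ) : Type := convergentSubalgebra n

instance (n : ℕ) : CommRing (HolGerm n) := inferInstanceAs (CommRing (convergentSubalgebra n))

instance (n : ℕ) : Algebra ℂ (HolGerm n) := inferInstanceAs (Algebra ℂ (convergentSubalgebra n))

/-- The partial derivative `∂/∂xᵢ` on germs of holomorphic functions. -/
def partialD {n : ℕ} (i : Fin n) : Derivation ℂ (HolGerm n) (HolGerm n) :=
  Derivation.mk'
    { toFun := fun g => ⟨MvPowerSeries.pderiv ℂ i g.1, IsConvergent.pderiv i g.2⟩
      map_add' := fun a b => Subtype.ext (map_add (MvPowerSeries.pderiv ℂ i) a.1 b.1)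
      map_smul' := fun c a => Subtype.ext ((MvPowerSeries.pderiv ℂ i).map_smul c a.1) }
    (fun a b => Subtype.ext ((MvPowerSeries.pderiv ℂ i).leibniz a.1 b.1))

theorem IsConvergent.X {n : ℕ} (k : Fin n) :
    IsConvergent (MvPowerSeries.X k : MvPowerSeries (Fin n) ℂ) := by
  classical
  refine ⟨1, one_pos, summable_of_hasFiniteSupport
    ((Set.finite_singleton (Finsupp.single k 1)).subset ?_)⟩
  intro d hd
  by_contra hne
  apply hd
  have : MvPowerSeries.coeff d (MvPowerSeries.X k : MvPowerSeries (Fin n) ℂ) = 0 := by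
    rw [MvPowerSeries.coeff_X, if_neg (by simpa using hne)]
  simp [this]

/-- The coordinate function `xₖ`. -/
def coord {n : ℕ} (k : Fin n) : HolGerm n := ⟨MvPowerSeries.X k, IsConvergent.X k⟩

/-- `Der(-log D)` for `D = V(f)`. A germ of a vector field `∑ᵢ aᵢ ∂/∂xᵢ` is given by its vector of
coefficients `a`. -/
def logDer {n : ℕ} (f : HolGerm n) : Submodule (HolGerm n) (Fin n → HolGerm n) where
  carrier := {a | ∑ i, a i * partialD i f ∈ Ideal.span {f}}
  zero_mem' := by simp
  add_mem' := fun {a b} ha hb => by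
    simpa [add_mul, Finset.sum_add_distrib] using Ideal.add_mem _ ha hb
  smul_mem' := fun c a ha => by
    have := Ideal.mul_mem_left (Ideal.span {f}) c ha
    simpa only [Set.mem_ofPred_eq, Pi.smul_apply, smul_eq_mul, mul_assoc, Finset.mul_sum] using this

/-- `V(f)` is a germ at the origin of a (nonempty, reduced) divisor that is free. -/
structure IsFreeDivisor {n : ℕ} (f : HolGerm n) : Prop where
  ne_zero : f ≠ 0
  not_isUnit : ¬ IsUnit f
  reduced : IsReduced (HolGerm n ⧸ Ideal.span {f})
  free : Module.Free (HolGerm n) (logDer f)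

/-- The germ of a free divisor `V(f)` is linear: `Der(-log D)` has a basis of vector fields whose
coefficients are linear forms in `x₁, …, xₙ`. -/
def IsLinearDivisor {n : ℕ} (f : HolGerm n) : Prop :=
  ∃ b : Module.Basis (Fin n) (HolGerm n) (logDer f),
    ∀ j i, (b j : Fin n → HolGerm n) i ∈ Submodule.span ℂ (Set.range (coord (n := n)))

/-- A local Artin `ℂ`-algebra with residue field `ℂ`. -/
structure ArtAlg where
  carrier : Type
  [commRing : CommRing carrier]
  [algebra : Algebra ℂ carrier]
  [isLocalRing : IsLocalRing carrier]
  [isArtinianRing : IsArtinianRing carrier]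
  residue_bijective : Function.Bijective (algebraMap ℂ (IsLocalRing.ResidueField carrier))

namespace ArtAlg

instance : CoeSort ArtAlg Type := ⟨carrier⟩

attribute [instance] commRing algebra isLocalRing isArtinianRing

/-- The category `Art`; morphisms are the (automatically local) `ℂ`-algebra homomorphisms. -/
instance : Category ArtAlg where
  Hom A B := A →ₐ[ℂ] B
  id A := AlgHom.id ℂ A
  comp φ ψ := ψ.comp φ

/-- The residue map `A → A/𝔪_A = ℂ`. -/
def aug (A : ArtAlg) : A →ₐ[ℂ] ℂ :=
  ((AlgEquiv.ofBijective (Algebra.ofId ℂ (IsLocalRing.ResidueField A))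
    A.residue_bijective).symm : IsLocalRing.ResidueField A →ₐ[ℂ] ℂ).comp
    (IsScalarTower.toAlgHom ℂ A (IsLocalRing.ResidueField A))

theorem aug_eq_zero_iff (A : ArtAlg) (a : A) : A.aug a = 0 ↔ a ∈ IsLocalRing.maximalIdeal A := by
  rw [← IsLocalRing.residue_eq_zero_iff]
  simp only [aug, AlgHom.comp_apply]
  exact map_eq_zero_iff _ (AlgEquiv.injective _)

theorem aug_comp {A B : ArtAlg} (φ : A →ₐ[ℂ] B) : B.aug.comp φ = A.aug := by
  ext a
  by_contra hne
  have hu : IsUnit (a - algebraMap ℂ A (B.aug (φ a))) := by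
    by_contra hn
    have := (A.aug_eq_zero_iff _).mpr ((IsLocalRing.mem_maximalIdeal _).mpr hn)
    rw [map_sub, AlgHom.commutes, sub_eq_zero] at this
    exact hne this.symm
  have h2 := (hu.map φ).map B.aug
  rw [map_sub, map_sub, AlgHom.commutes, AlgHom.commutes] at h2
  simp at h2

/-- A local `ℂ`-algebra that is finite-dimensional is an object of `Art`. -/
theorem residue_bijective_of_finite (A : Type) [CommRing A] [Algebra ℂ A] [IsLocalRing A]
    [Module.Finite ℂ A] : Function.Bijective (algebraMap ℂ (IsLocalRing.ResidueField A)) := by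
  have : Module.Finite ℂ (IsLocalRing.ResidueField A) :=
    Module.Finite.of_surjective (IsScalarTower.toAlgHom ℂ A (IsLocalRing.ResidueField A)).toLinearMap
      IsLocalRing.residue_surjective
  exact IsAlgClosed.algebraMap_bijective_of_isIntegral

theorem finite_of_isFiniteLength (A : ArtAlg) {M : Type} [AddCommGroup M] [Module A M]
    (h : IsFiniteLength A M) : ∀ [Module ℂ M] [IsScalarTower ℂ A M], Module.Finite ℂ M := by
  induction h with
  | of_subsingleton => intro _ _; infer_instance
  | @of_simple_quotient M _ _ N hs _ ih =>
    intro _ _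
    obtain ⟨I, hI, ⟨e⟩⟩ := isSimpleModule_iff_quot_maximal.mp hs
    obtain rfl := IsLocalRing.eq_maximalIdeal hI
    have h1 : Module.Finite ℂ (IsLocalRing.ResidueField A) :=
      Module.Finite.of_surjective (Algebra.linearMap ℂ (IsLocalRing.ResidueField A))
        A.residue_bijective.2
    have h2 : Module.Finite ℂ (A ⧸ IsLocalRing.maximalIdeal A) := h1
    have h3 : Module.Finite ℂ (M ⧸ N) :=
      Module.Finite.of_surjective (e.symm.toLinearMap.restrictScalars ℂ) e.symm.surjective
    have h4 : Module.Finite ℂ N := ih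
    have h5 : Module.Finite ℂ (N.restrictScalars ℂ) := h4
    have h6 : Module.Finite ℂ (M ⧸ N.restrictScalars ℂ) := h3
    exact Module.Finite.of_submodule_quotient (N.restrictScalars ℂ)

instance finite (A : ArtAlg) : Module.Finite ℂ A :=
  A.finite_of_isFiniteLength
    (isFiniteLength_iff_isNoetherian_isArtinian.mpr ⟨inferInstance, inferInstance⟩)

/-- A finite-dimensional local `ℂ`-algebra, as an object of `Art`. -/
def ofFinite (A : Type) [CommRing A] [Algebra ℂ A] [IsLocalRing A] [Module.Finite ℂ A] : ArtAlg :=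
  haveI : IsArtinianRing A := IsArtinianRing.of_finite ℂ A
  { carrier := A, residue_bijective := residue_bijective_of_finite A }

/-- The residue field `k = ℂ`. -/
def base : ArtAlg := ofFinite ℂ

instance : Module.Finite ℂ (DualNumber ℂ) :=
  inferInstanceAs (Module.Finite ℂ (ℂ × ℂ))

/-- The dual numbers `k[ε]`. -/
def dual : ArtAlg := ofFinite (DualNumber ℂ)

instance pullback_isLocalRing {A' A'' A : ArtAlg} (φ : A' →ₐ[ℂ] A) (ψ : A'' →ₐ[ℂ] A) :
    IsLocalRing (AlgHom.pullback φ ψ) := by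
  have h : IsLocalHom (AlgHom.pullbackFst φ ψ) := by
    refine ⟨fun x hx => ?_⟩
    obtain ⟨⟨a, b⟩, hab⟩ := x
    have hab' : φ a = ψ b := hab
    rw [AlgHom.isUnit_pullback_mk_iff]
    refine ⟨hx, ?_⟩
    by_contra hb
    have h1 := (A''.aug_eq_zero_iff b).mpr ((IsLocalRing.mem_maximalIdeal _).mpr hb)
    rw [← aug_comp ψ, AlgHom.comp_apply, ← hab', ← AlgHom.comp_apply, aug_comp] at h1
    have h2 : IsUnit a := hx
    exact (IsLocalRing.mem_maximalIdeal _).mp ((A'.aug_eq_zero_iff a).mp h1) h2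
  have h' : IsLocalHom (AlgHom.pullbackFst φ ψ).toRingHom := ⟨h.1⟩
  exact (AlgHom.pullbackFst φ ψ).toRingHom.domain_isLocalRing

/-- The fibre product `A' ×_A A''` in `Art`. -/
def pullback {A' A'' A : ArtAlg} (φ : A' ⟶ A) (ψ : A'' ⟶ A) : ArtAlg :=
  haveI : Module.Finite ℂ (AlgHom.pullback (A := A') (B := A'') (C := A) φ ψ) :=
    Module.Finite.of_injective (AlgHom.pullback (A := A') (B := A'') (C := A) φ ψ).val.toLinearMap
      Subtype.val_injective
  ofFinite (AlgHom.pullback (A := A') (B := A'') (C := A) φ ψ)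

def pullbackFst {A' A'' A : ArtAlg} (φ : A' ⟶ A) (ψ : A'' ⟶ A) : pullback φ ψ ⟶ A' :=
  AlgHom.pullbackFst (A := A') (B := A'') (C := A) φ ψ

def pullbackSnd {A' A'' A : ArtAlg} (φ : A' ⟶ A) (ψ : A'' ⟶ A) : pullback φ ψ ⟶ A'' :=
  AlgHom.pullbackSnd (A := A') (B := A'') (C := A) φ ψ

theorem pullback_condition {A' A'' A : ArtAlg} (φ : A' ⟶ A) (ψ : A'' ⟶ A) :
    pullbackFst φ ψ ≫ φ = pullbackSnd φ ψ ≫ ψ :=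
  AlgHom.pullback_comm_sq (A := A') (B := A'') (C := A) φ ψ

/-- A small extension: a surjection whose kernel is a nonzero principal ideal `(t)` with
`𝔪 t = 0`. -/
def IsSmallExtension {B A : ArtAlg} (p : B →ₐ[ℂ] A) : Prop :=
  Function.Surjective p ∧
    ∃ t : B, t ≠ 0 ∧ RingHom.ker p = Ideal.span {t} ∧ ∀ m ∈ IsLocalRing.maximalIdeal B, m * t = 0

end ArtAlg

/-- The natural map `F(A' ×_A A'') → F(A') ×_{F(A)} F(A'')`. -/
def fibreMap (F : ArtAlg ⥤ Pointed.{0}) {A' A'' A : ArtAlg} (φ : A' ⟶ A) (ψ : A'' ⟶ A)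
    (x : (F.obj (ArtAlg.pullback φ ψ)).X) :
    Function.Pullback (F.map φ).toFun (F.map ψ).toFun :=
  ⟨((F.map (ArtAlg.pullbackFst φ ψ)).toFun x, (F.map (ArtAlg.pullbackSnd φ ψ)).toFun x), by
    simp only [← Function.comp_apply (f := (F.map φ).toFun), ← Function.comp_apply (f := (F.map ψ).toFun),
      ← Pointed.Hom.comp_toFun', ← F.map_comp, ArtAlg.pullback_condition]⟩

/-- Schlessinger's condition (H1): `F(A' ×_A A'') → F(A') ×_{F(A)} F(A'')` is surjective whenever
`A'' → A` is a small extension. -/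
def SchlessingerH1 (F : ArtAlg ⥤ Pointed.{0}) : Prop :=
  ∀ (A' A'' A : ArtAlg) (φ : A' ⟶ A) (ψ : A'' ⟶ A), ArtAlg.IsSmallExtension ψ →
    Function.Surjective (fibreMap F φ ψ)

/-- Schlessinger's condition (H2): `F(A' ×_A A'') → F(A') ×_{F(A)} F(A'')` is bijective for
`A = k` and `A'' = k[ε]`. -/
def SchlessingerH2 (F : ArtAlg ⥤ Pointed.{0}) : Prop :=
  ∀ (A' : ArtAlg) (φ : A' ⟶ ArtAlg.base) (ψ : ArtAlg.dual ⟶ ArtAlg.base),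
    Function.Bijective (fibreMap F φ ψ)

/-- The local ring `𝒪_{ℂⁿ×S,(0,s)} = A ⊗ 𝒪_{ℂⁿ,0}` for `S = Spec A`. -/
abbrev RelGerm (A : ArtAlg) (n : ℕ) : Type := A ⊗[ℂ] HolGerm n

/-- The relative partial derivative `∂/∂xᵢ`, the `A`-linear extension of `∂/∂xᵢ`. -/
def relPartialD (A : ArtAlg) {n : ℕ} (i : Fin n) : RelGerm A n →ₗ[A] RelGerm A n :=
  (partialD i).toLinearMap.baseChange A

/-- Restriction of functions on `ℂⁿ × S` along a morphism `Spec B → Spec A`. -/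
def relMap {A B : ArtAlg} (n : ℕ) (φ : A →ₐ[ℂ] B) : RelGerm A n →ₐ[ℂ] RelGerm B n :=
  Algebra.TensorProduct.map φ (AlgHom.id ℂ (HolGerm n))

/-- Restriction of functions on `ℂⁿ × S` to the special fibre `ℂⁿ × {s} = ℂⁿ`. -/
def special (A : ArtAlg) (n : ℕ) : RelGerm A n →ₐ[ℂ] HolGerm n :=
  Algebra.TensorProduct.lift ((Algebra.ofId ℂ (HolGerm n)).comp A.aug) (AlgHom.id ℂ (HolGerm n))
    fun _ _ => Commute.all _ _

theorem special_tmul (A : ArtAlg) {n : ℕ} (a : A) (g : HolGerm n) :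
    special A n (a ⊗ₜ g) = A.aug a • g := by
  simp [special, Algebra.ofId_apply, Algebra.smul_def]

theorem special_surjective (A : ArtAlg) (n : ℕ) : Function.Surjective (special A n) := fun g =>
  ⟨1 ⊗ₜ g, by simp [special_tmul]⟩

theorem special_relMap {A B : ArtAlg} {n : ℕ} (φ : A →ₐ[ℂ] B) (y : RelGerm A n) :
    special B n (relMap n φ y) = special A n y := by
  induction y using TensorProduct.induction_on with
  | zero => simp
  | add x y hx hy => rw [map_add, map_add, hx, hy, map_add]
  | tmul a g =>
    rw [relMap, Algebra.TensorProduct.map_tmul, special_tmul, special_tmul, ← ArtAlg.aug_comp φ]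
    rfl

theorem relMap_relPartialD {A B : ArtAlg} {n : ℕ} (φ : A →ₐ[ℂ] B) (i : Fin n) (y : RelGerm A n) :
    relMap n φ (relPartialD A i y) = relPartialD B i (relMap n φ y) := by
  induction y using TensorProduct.induction_on with
  | zero => simp
  | add x y hx hy => simp only [map_add, hx, hy]
  | tmul a g => simp [relMap, relPartialD]

theorem special_relPartialD (A : ArtAlg) {n : ℕ} (i : Fin n) (y : RelGerm A n) :
    special A n (relPartialD A i y) = partialD i (special A n y) := by
  induction y using TensorProduct.induction_on with
  | zero => simp
  | add x y hx hy => rw [map_add, map_add, map_add, map_add, hx, hy]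
  | tmul a g => simp [special_tmul, relPartialD]

/-- `Der(-log X/S)` for the germ `X ⊂ ℂⁿ × S` with ideal `I`: the relative vector fields
`∑ᵢ aᵢ ∂/∂xᵢ` that map `I` into itself. -/
def relLogDer {A : ArtAlg} {n : ℕ} (I : Ideal (RelGerm A n)) :
    Submodule (RelGerm A n) (Fin n → RelGerm A n) where
  carrier := {a | ∀ g ∈ I, ∑ i, a i * relPartialD A i g ∈ I}
  zero_mem' := by simp
  add_mem' := fun {a b} ha hb g hg => by
    simpa [add_mul, Finset.sum_add_distrib] using Ideal.add_mem _ (ha g hg) (hb g hg)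
  smul_mem' := fun c a ha g hg => by
    have := Ideal.mul_mem_left I c (ha g hg)
    simpa only [Pi.smul_apply, smul_eq_mul, mul_assoc, Finset.mul_sum] using this

/-- Restriction of a relative vector field to the special fibre. -/
def specialField (A : ArtAlg) {n : ℕ} (a : Fin n → RelGerm A n) : Fin n → HolGerm n :=
  fun i => special A n (a i)

/-- The ideal `𝔪_S 𝒪_{ℂⁿ×S}`. -/
def baseMaximal (A : ArtAlg) (n : ℕ) : Ideal (RelGerm A n) :=
  (IsLocalRing.maximalIdeal A).map (algebraMap A (RelGerm A n))

/-- The germ `X ⊂ ℂⁿ × S` with ideal `I` is an admissible deformation of `D = V(f)` over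
`S = Spec A`: it is flat over `S` and its special fibre in `ℂⁿ × {s} = ℂⁿ` is `D`. The last two fields say that restriction to the special fibre induces
`Der(-log X/S) / 𝔪_S Der(-log X/S) = Der(-log D)`. -/
structure IsAdmissible {n : ℕ} (f : HolGerm n) (A : ArtAlg) (I : Ideal (RelGerm A n)) : Prop where
  flat : Module.Flat A (RelGerm A n ⧸ I)
  fibre : I.map (special A n) = Ideal.span {f}
  image : specialField A '' (relLogDer I : Set (Fin n → RelGerm A n)) = logDer f
  kernel : ∀ a ∈ relLogDer I, specialField A a = 0 → a ∈ baseMaximal A n • relLogDer I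

/-- Linearly admissible deformations: `Der(-log X/S)` moreover has a basis of vector fields whose
coefficients are linear forms in `x₁, …, xₙ` (with coefficients in `𝒪_S = A`). -/
structure IsLinearlyAdmissible {n : ℕ} (f : HolGerm n) (A : ArtAlg) (I : Ideal (RelGerm A n)) :
    Prop extends IsAdmissible f A I where
  linear : ∃ b : Module.Basis (Fin n) (RelGerm A n) (relLogDer I),
    ∀ j i, (b j : Fin n → RelGerm A n) i ∈
      Submodule.span A (Set.range fun k : Fin n => (1 : A) ⊗ₜ[ℂ] coord k)

/-! ### Lifting logarithmic fields -/

/-- A linear functional on `A`, applied to the coefficients. -/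
def slice {A : ArtAlg} {n : ℕ} (l : A →ₗ[ℂ] ℂ) : RelGerm A n →ₗ[ℂ] HolGerm n :=
  (TensorProduct.lid ℂ (HolGerm n)).toLinearMap ∘ₗ l.rTensor (HolGerm n)

theorem slice_tmul {A : ArtAlg} {n : ℕ} (l : A →ₗ[ℂ] ℂ) (a : A) (g : HolGerm n) :
    slice l (a ⊗ₜ g : RelGerm A n) = l a • g := by
  simp [slice]

theorem mem_map_iff_smul_top {A : ArtAlg} {n : ℕ} (J : Ideal A) (y : RelGerm A n) :
    y ∈ J.map (algebraMap A (RelGerm A n)) ↔ y ∈ J • (⊤ : Submodule A (RelGerm A n)) := by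
  rw [Ideal.smul_top_eq_map]; rfl

theorem sub_special_mem (A : ArtAlg) {n : ℕ} (y : RelGerm A n) :
    y - 1 ⊗ₜ special A n y ∈ baseMaximal A n := by
  induction y using TensorProduct.induction_on with
  | zero => simp
  | add x y hx hy =>
    have := Ideal.add_mem _ hx hy
    convert this using 1
    rw [map_add, TensorProduct.tmul_add]
    ring
  | tmul a g =>
    have h1 : a - algebraMap ℂ A (A.aug a) ∈ IsLocalRing.maximalIdeal A := by
      rw [← ArtAlg.aug_eq_zero_iff, map_sub, AlgHom.commutes]; exact sub_self _
    have h4 := Ideal.mul_mem_right ((1 : A) ⊗ₜ[ℂ] g) _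
      (Ideal.mem_map_of_mem (algebraMap A (RelGerm A n)) h1)
    have h5 : (a ⊗ₜ g - 1 ⊗ₜ special A n (a ⊗ₜ g) : RelGerm A n) =
        algebraMap A (RelGerm A n) (a - algebraMap ℂ A (A.aug a)) * 1 ⊗ₜ g := by
      rw [Algebra.TensorProduct.algebraMap_apply, Algebra.algebraMap_self, RingHom.id_apply,
        Algebra.TensorProduct.tmul_mul_tmul, mul_one, one_mul, TensorProduct.sub_tmul, special_tmul,
        TensorProduct.tmul_smul, TensorProduct.smul_tmul', Algebra.smul_def, mul_one]
    rw [h5]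
    exact h4

/-- Restriction `𝒪_X → 𝒪_D` of functions to the special fibre. -/
def specialQuot {A : ArtAlg} {n : ℕ} {f : HolGerm n} {I : Ideal (RelGerm A n)}
    (hI : I.map (special A n) ≤ Ideal.span {f}) :
    (RelGerm A n ⧸ I) →ₐ[ℂ] (HolGerm n ⧸ Ideal.span {f}) :=
  Ideal.quotientMapₐ _ (special A n) (Ideal.map_le_iff_le_comap.mp hI)

theorem specialQuot_mk {A : ArtAlg} {n : ℕ} {f : HolGerm n} {I : Ideal (RelGerm A n)}
    (hI : I.map (special A n) ≤ Ideal.span {f}) (y : RelGerm A n) :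
    specialQuot hI (Ideal.Quotient.mk I y) = Ideal.Quotient.mk _ (special A n y) := rfl

theorem specialQuot_smul {A : ArtAlg} {n : ℕ} {f : HolGerm n} {I : Ideal (RelGerm A n)}
    (hI : I.map (special A n) ≤ Ideal.span {f}) (a : A) (x : RelGerm A n ⧸ I) :
    specialQuot hI (a • x) = A.aug a • specialQuot hI x := by
  obtain ⟨y, rfl⟩ := Ideal.Quotient.mk_surjective x
  have h1 : a • (Ideal.Quotient.mk I y) =
      Ideal.Quotient.mk I (algebraMap A (RelGerm A n) a * y) := by
    rw [← Algebra.smul_def]; rfl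
  rw [h1, specialQuot_mk, specialQuot_mk, map_mul, Algebra.TensorProduct.algebraMap_apply,
    special_tmul, Algebra.algebraMap_self, RingHom.id_apply, smul_mul_assoc, one_mul]
  rfl

/-- One step in the descent along ideals of `A`. -/
structure SmallStep {A : ArtAlg} (J : Ideal A) where
  l : A →ₗ[ℂ] ℂ
  e : A
  e_mem : e ∈ J
  l_e : l e = 1
  l_mul : ∀ a, ∀ j ∈ J, l (a * j) = A.aug a * l j

theorem SmallStep.exists {A : ArtAlg} {J : Ideal A} (hJ : J ≠ ⊥) : Nonempty (SmallStep J) := by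
  set m := IsLocalRing.maximalIdeal A
  have hlt : ¬ J ≤ m * J := fun h => hJ <|
    Submodule.eq_bot_of_le_smul_of_le_jacobson_bot m J (IsNoetherian.noetherian J) h
      (IsLocalRing.maximalIdeal_le_jacobson _)
  obtain ⟨e, he, hne⟩ := Set.not_subset.mp hlt
  obtain ⟨l, hl, hl2⟩ := Submodule.exists_le_ker_of_notMem
    (p := (m * J).restrictScalars ℂ) (v := e) hne
  have hk : ∀ a ∈ m, ∀ j ∈ J, l (a * j) = 0 := fun a ha j hj => hl2 (Ideal.mul_mem_mul ha hj)
  refine ⟨⟨(l e)⁻¹ • l, e, he, by simp [hl], fun a j hj => ?_⟩⟩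
  have h1 : a - algebraMap ℂ A (A.aug a) ∈ m := by
    rw [← ArtAlg.aug_eq_zero_iff]; simp
  have h2 := hk _ h1 j hj
  rw [sub_mul, map_sub, sub_eq_zero, ← Algebra.smul_def, map_smul] at h2
  change (l e)⁻¹ * l (a * j) = A.aug a * ((l e)⁻¹ * l j)
  rw [h2, smul_eq_mul]
  ring

namespace SmallStep

variable {A : ArtAlg} {J : Ideal A} (s : SmallStep J)

/-- The smaller ideal. -/
def next : Ideal A where
  carrier := {j | j ∈ J ∧ s.l j = 0}
  zero_mem' := by simp
  add_mem' := fun ha hb => ⟨J.add_mem ha.1 hb.1, by simp [ha.2, hb.2]⟩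
  smul_mem' := fun c j hj => ⟨J.mul_mem_left c hj.1, by
    rw [smul_eq_mul, s.l_mul c j hj.1, hj.2, mul_zero]⟩

theorem next_lt : s.next < J :=
  lt_of_le_of_ne (fun _ h => h.1) fun h => by
    have h1 : s.e ∈ s.next := h.symm ▸ s.e_mem
    have h2 := h1.2
    rw [s.l_e] at h2
    exact one_ne_zero h2

theorem slice_mul {n : ℕ} {y : RelGerm A n} (hy : y ∈ J.map (algebraMap A (RelGerm A n)))
    (h : RelGerm A n) : slice s.l (h * y) = special A n h * slice s.l y := by
  induction hy using Submodule.span_induction generalizing h with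
  | mem x hx =>
    obtain ⟨j, hj, rfl⟩ := hx
    induction h using TensorProduct.induction_on with
    | zero => simp
    | add x y hx hy => simp only [add_mul, map_add, hx, hy]
    | tmul a g =>
      rw [Algebra.TensorProduct.algebraMap_apply, Algebra.TensorProduct.tmul_mul_tmul, slice_tmul,
        slice_tmul, special_tmul]
      simp [s.l_mul a j hj, mul_smul, smul_comm (A.aug a) (s.l j) g]
  | zero => simp
  | add x y _ _ hx hy => simp only [mul_add, map_add, hx, hy]
  | smul c x _ hx =>
    rw [smul_eq_mul, ← mul_assoc, hx, hx, map_mul, mul_assoc]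

theorem sub_mem_next {n : ℕ} {y : RelGerm A n} (hy : y ∈ J.map (algebraMap A (RelGerm A n)))
    (z : RelGerm A n) (hz : special A n z = slice s.l y) :
    y - algebraMap A (RelGerm A n) s.e * z ∈ s.next.map (algebraMap A (RelGerm A n)) := by
  have h1 : ∀ y ∈ J.map (algebraMap A (RelGerm A n)),
      y - algebraMap A (RelGerm A n) s.e * (1 ⊗ₜ slice s.l y) ∈
        s.next.map (algebraMap A (RelGerm A n)) := by
    intro y hy
    rw [mem_map_iff_smul_top] at hy
    refine Submodule.smul_induction_on hy ?_ ?_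
    · intro j hj y hy'
      clear hy'
      induction y using TensorProduct.induction_on with
      | zero => simp
      | add x y hx hy =>
        have := Ideal.add_mem _ hx hy
        convert this using 1
        rw [smul_add, map_add, TensorProduct.tmul_add]
        ring
      | tmul a g =>
        have h3 : a * j - s.e * algebraMap ℂ A (s.l (a * j)) ∈ s.next := by
          refine ⟨J.sub_mem (J.mul_mem_left a hj) (J.mul_mem_right _ s.e_mem), ?_⟩
          rw [map_sub, mul_comm s.e, s.l_mul _ _ s.e_mem, s.l_e]
          simp
        have h4 := Ideal.mul_mem_right ((1 : A) ⊗ₜ[ℂ] g) _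
          (Ideal.mem_map_of_mem (algebraMap A (RelGerm A n)) h3)
        convert h4 using 1
        simp only [Algebra.TensorProduct.algebraMap_apply, Algebra.algebraMap_self, RingHom.id_apply,
          TensorProduct.smul_tmul', slice_tmul, Algebra.TensorProduct.tmul_mul_tmul, mul_one, one_mul,
          smul_eq_mul, TensorProduct.sub_tmul]
        rw [mul_comm j a, TensorProduct.tmul_smul, TensorProduct.smul_tmul', Algebra.smul_def,
          mul_comm s.e, sub_mul, Algebra.TensorProduct.tmul_mul_tmul,
          Algebra.TensorProduct.tmul_mul_tmul]
        simp only [mul_one, one_mul]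
    · intro x y hx hy
      have := Ideal.add_mem _ hx hy
      convert this using 1
      rw [map_add, TensorProduct.tmul_add]
      ring
  have h2 := h1 y hy
  have h3 : algebraMap A (RelGerm A n) s.e * (z - 1 ⊗ₜ slice s.l y) ∈
      s.next.map (algebraMap A (RelGerm A n)) := by
    rw [← hz]
    have h4 := sub_special_mem A z
    rw [baseMaximal, mem_map_iff_smul_top] at h4
    generalize z - 1 ⊗ₜ[ℂ] special A n z = w at h4 ⊢
    refine Submodule.smul_induction_on h4 ?_ ?_
    · intro j hj y _
      rw [Algebra.smul_def, ← mul_assoc, ← map_mul]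
      refine Ideal.mul_mem_right _ _ (Ideal.mem_map_of_mem _ ⟨J.mul_mem_right _ s.e_mem, ?_⟩)
      rw [mul_comm, s.l_mul _ _ s.e_mem, (A.aug_eq_zero_iff j).mpr hj, zero_mul]
    · intro x y hx hy
      rw [mul_add]; exact Ideal.add_mem _ hx hy
  have h5 := Ideal.sub_mem _ h2 h3
  convert h5 using 1
  ring

theorem slice_mem {n : ℕ} {f : HolGerm n} {I : Ideal (RelGerm A n)}
    (hflat : Module.Flat A (RelGerm A n ⧸ I)) (hI : I.map (special A n) = Ideal.span {f})
    {x : RelGerm A n} (hx : x ∈ J.map (algebraMap A (RelGerm A n))) (hxI : x ∈ I) :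
    slice s.l x ∈ Ideal.span {f} := by
  let q := specialQuot hI.le
  let T : J →+ (RelGerm A n ⧸ I) →+ HolGerm n ⧸ Ideal.span {f} :=
    { toFun := fun j =>
        (DistribSMul.toAddMonoidHom (HolGerm n ⧸ Ideal.span {f}) (s.l j)).comp q.toRingHom.toAddMonoidHom
      map_zero' := by ext; simp
      map_add' := fun a b => by ext; simp [add_smul] }
  let Ψ : J ⊗[A] (RelGerm A n ⧸ I) →+ HolGerm n ⧸ Ideal.span {f} :=
    TensorProduct.liftAddHom T (by
      intro r j m
      change s.l (r * j) • q m = s.l j • q (r • m)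
      rw [s.l_mul r j j.2, specialQuot_smul, smul_smul, mul_comm])
  let Φ : J ⊗[A] (RelGerm A n ⧸ I) →ₗ[A] RelGerm A n ⧸ I :=
    (TensorProduct.lid A _).toLinearMap ∘ₗ (Submodule.subtype J).rTensor _
  have hΦ : Function.Injective Φ :=
    (TensorProduct.lid A _).injective.comp
      (Module.Flat.rTensor_preserves_injective_linearMap _ Subtype.val_injective)
  have key : ∃ t, Φ t = Ideal.Quotient.mk I x ∧ Ψ t = Ideal.Quotient.mk _ (slice s.l x) := by
    clear hxI
    rw [mem_map_iff_smul_top] at hx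
    refine Submodule.smul_induction_on hx ?_ ?_
    · intro j hj y _
      refine ⟨⟨j, hj⟩ ⊗ₜ Ideal.Quotient.mk I y, ?_, ?_⟩
      · simp only [Φ, LinearMap.comp_apply, LinearMap.rTensor_tmul, Submodule.subtype_apply]
        simp
        rfl
      · have h1 : slice s.l (j • y) = special A n y * (algebraMap ℂ (HolGerm n) (s.l j)) := by
          rw [Algebra.smul_def, mul_comm, s.slice_mul (Ideal.mem_map_of_mem _ hj),
            Algebra.TensorProduct.algebraMap_apply, slice_tmul, Algebra.smul_def, mul_one]
          rfl
        rw [h1, mul_comm, ← Algebra.smul_def]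
        rfl
    · intro x y hx hy
      obtain ⟨t, h1, h2⟩ := hx
      obtain ⟨u, h3, h4⟩ := hy
      exact ⟨t + u, by simp only [map_add, h1, h3], by simp only [map_add, h2, h4]⟩
  obtain ⟨t, h1, h2⟩ := key
  rw [Ideal.Quotient.eq_zero_iff_mem.mpr hxI] at h1
  have h3 : t = 0 := hΦ (by rw [h1, map_zero])
  rw [h3, map_zero] at h2
  exact Ideal.Quotient.eq_zero_iff_mem.mp h2.symm

end SmallStep

theorem sum_slice_mem {A : ArtAlg} {J : Ideal A} (s : SmallStep J) {n : ℕ} {f : HolGerm n}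
    {I : Ideal (RelGerm A n)} (hflat : Module.Flat A (RelGerm A n ⧸ I))
    (hI : I.map (special A n) = Ideal.span {f}) {a : Fin n → RelGerm A n} (ha : a ∈ relLogDer I)
    (haJ : ∀ i, a i ∈ J.map (algebraMap A (RelGerm A n))) :
    (fun i => slice s.l (a i)) ∈ logDer f := by
  obtain ⟨F, hF, hFf⟩ := (Ideal.mem_map_iff_of_surjective _ (special_surjective A n)).mp
    (hI ▸ Ideal.mem_span_singleton_self f : f ∈ I.map (special A n))
  have h1 := s.slice_mem hflat hI (Ideal.sum_mem _ fun i _ =>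
    Ideal.mul_mem_right (relPartialD A i F) _ (haJ i)) (ha F hF)
  rw [map_sum] at h1
  have h2 : ∀ i, slice s.l (a i * relPartialD A i F) = slice s.l (a i) * partialD i f := by
    intro i
    rw [mul_comm, s.slice_mul (haJ i), special_relPartialD, hFf, mul_comm]
  simp only [h2] at h1
  exact h1

theorem mem_smul_of_lift {A : ArtAlg} {n : ℕ} {f : HolGerm n} {I : Ideal (RelGerm A n)}
    (hflat : Module.Flat A (RelGerm A n ⧸ I)) (hI : I.map (special A n) = Ideal.span {f})
    {N : Submodule (RelGerm A n) (Fin n → RelGerm A n)} (hN : N ≤ relLogDer I)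
    (hlift : ∀ d ∈ logDer f, ∃ a ∈ N, specialField A a = d) (J : Ideal A) :
    ∀ a ∈ relLogDer I, (∀ i, a i ∈ J.map (algebraMap A (RelGerm A n))) →
      a ∈ J.map (algebraMap A (RelGerm A n)) • N := by
  induction J using WellFoundedLT.induction with
  | ind J ih =>
    intro a ha haJ
    by_cases hJ : J = ⊥
    · subst hJ
      have h0 : a = 0 := by
        ext1 i
        simpa [Ideal.map_bot] using haJ i
      rw [h0]
      exact Submodule.zero_mem _
    · obtain ⟨s⟩ := SmallStep.exists hJ
      obtain ⟨b, hb, hbs⟩ := hlift _ (sum_slice_mem s hflat hI ha haJ)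
      set E := algebraMap A (RelGerm A n) s.e
      have h1 : a - E • b ∈ s.next.map (algebraMap A (RelGerm A n)) • N :=
        ih _ s.next_lt _ (Submodule.sub_mem _ ha (Submodule.smul_mem _ _ (hN hb)))
          fun i => s.sub_mem_next (haJ i) (b i) (congrFun hbs i)
      have h2 : a - E • b ∈ J.map (algebraMap A (RelGerm A n)) • N :=
        Submodule.smul_mono_left (Ideal.map_mono s.next_lt.le) h1
      have h3 : E • b ∈ J.map (algebraMap A (RelGerm A n)) • N :=
        Submodule.smul_mem_smul (Ideal.mem_map_of_mem _ s.e_mem) hb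
      simpa using Submodule.add_mem _ h2 h3

theorem specialField_mem_logDer {A : ArtAlg} {n : ℕ} {f : HolGerm n} {I : Ideal (RelGerm A n)}
    (hI : I.map (special A n) = Ideal.span {f}) {a : Fin n → RelGerm A n} (ha : a ∈ relLogDer I) :
    specialField A a ∈ logDer f := by
  obtain ⟨F, hF, hFf⟩ := (Ideal.mem_map_iff_of_surjective _ (special_surjective A n)).mp
    (hI ▸ Ideal.mem_span_singleton_self f : f ∈ I.map (special A n))
  have h1 := Ideal.mem_map_of_mem (special A n) (ha F hF)
  rw [hI, map_sum] at h1
  simp only [map_mul, special_relPartialD, hFf] at h1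
  exact h1

theorem mem_baseMaximal_of_special {A : ArtAlg} {n : ℕ} {y : RelGerm A n}
    (hy : special A n y = 0) : y ∈ baseMaximal A n := by
  simpa [hy] using sub_special_mem A y

theorem special_eq_zero_of_mem {A : ArtAlg} {n : ℕ} {y : RelGerm A n}
    (hy : y ∈ baseMaximal A n) : special A n y = 0 := by
  have h : baseMaximal A n ≤ RingHom.ker (special A n) := by
    rw [baseMaximal, Ideal.map_le_iff_le_comap]
    intro a ha
    rw [Ideal.mem_comap, RingHom.mem_ker, Algebra.TensorProduct.algebraMap_apply, special_tmul]
    simp [(A.aug_eq_zero_iff a).mpr ha]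
  exact h hy

/-- Admissibility only needs that the logarithmic fields of `D` lift. -/
theorem IsAdmissible.of_lift {A : ArtAlg} {n : ℕ} {f : HolGerm n} {I : Ideal (RelGerm A n)}
    (hflat : Module.Flat A (RelGerm A n ⧸ I)) (hI : I.map (special A n) = Ideal.span {f})
    (hlift : ∀ d ∈ logDer f, ∃ a ∈ relLogDer I, specialField A a = d) : IsAdmissible f A I where
  flat := hflat
  fibre := hI
  image := Set.Subset.antisymm
    (by rintro _ ⟨a, ha, rfl⟩; exact specialField_mem_logDer hI ha)
    (fun d hd => hlift d hd)
  kernel a ha h0 := mem_smul_of_lift hflat hI le_rfl hlift _ a ha fun i =>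
    mem_baseMaximal_of_special (congrFun h0 i)

theorem specialField_sum {A : ArtAlg} {n : ℕ} (c : Fin n → RelGerm A n)
    (v : Fin n → Fin n → RelGerm A n) :
    specialField A (∑ j, c j • v j) = ∑ j, special A n (c j) • specialField A (v j) := by
  ext1 i
  simp [specialField, Finset.sum_apply]

/-- Lifts of a basis of `Der(-log D)` form a basis of `Der(-log X/S)`. -/
theorem exists_basis_of_lift {A : ArtAlg} {n : ℕ} {f : HolGerm n} {I : Ideal (RelGerm A n)}
    (hflat : Module.Flat A (RelGerm A n ⧸ I)) (hI : I.map (special A n) = Ideal.span {f})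
    (b : Module.Basis (Fin n) (HolGerm n) (logDer f)) (v : Fin n → relLogDer I)
    (hv : ∀ j, specialField A (v j : Fin n → RelGerm A n) = (b j : Fin n → HolGerm n)) :
    ∃ b' : Module.Basis (Fin n) (RelGerm A n) (relLogDer I), ∀ j, b' j = v j := by
  have hli : LinearIndependent (RelGerm A n) v := by
    rw [Fintype.linearIndependent_iff]
    intro c hc
    have hc' : ∑ j, c j • (v j : Fin n → RelGerm A n) = 0 := by
      simpa using congrArg Subtype.val hc
    have hb : ∀ d : Fin n → HolGerm n, ∑ j, d j • (b j : Fin n → HolGerm n) = 0 → d = 0 := by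
      intro d hd
      funext j
      refine Fintype.linearIndependent_iff.mp b.linearIndependent d (Subtype.ext ?_) j
      simpa using hd
    have main : ∀ J : Ideal A, (∀ j, c j ∈ J.map (algebraMap A (RelGerm A n))) → c = 0 := by
      intro J
      induction J using WellFoundedLT.induction with
      | ind J ih =>
        intro hcJ
        by_cases hJ : J = ⊥
        · subst hJ
          ext1 i
          simpa [Ideal.map_bot] using hcJ i
        · obtain ⟨s⟩ := SmallStep.exists hJ
          have h1 : (fun j => slice s.l (c j)) = 0 := by
            apply hb
            ext1 i
            have h2 := congrArg (slice s.l) (congrFun hc' i)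
            simp only [Finset.sum_apply, Pi.smul_apply, smul_eq_mul, Pi.zero_apply, map_sum,
              map_zero] at h2 ⊢
            rw [← h2]
            refine Finset.sum_congr rfl fun j _ => ?_
            rw [mul_comm (c j), s.slice_mul (hcJ j), mul_comm, ← hv j]
            rfl
          refine ih _ s.next_lt fun j => ?_
          have h3 := s.sub_mem_next (hcJ j) 0 (by rw [map_zero]; exact (congrFun h1 j).symm)
          simpa using h3
    exact congrFun (main ⊤ fun j => by rw [Ideal.map_top]; trivial)
  set N := Submodule.span (RelGerm A n) (Set.range fun j => (v j : Fin n → RelGerm A n))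
  have hN : N ≤ relLogDer I := by
    rw [Submodule.span_le]
    rintro _ ⟨j, rfl⟩
    exact (v j).2
  have hlift : ∀ d ∈ logDer f, ∃ a ∈ N, specialField A a = d := by
    intro d hd
    refine ⟨∑ j, (1 ⊗ₜ b.repr ⟨d, hd⟩ j : RelGerm A n) • (v j : Fin n → RelGerm A n),
      Submodule.sum_mem _ fun j _ => Submodule.smul_mem _ _ (Submodule.subset_span ⟨j, rfl⟩), ?_⟩
    rw [specialField_sum]
    have h1 := congrArg (logDer f).subtype (b.sum_repr ⟨d, hd⟩)
    simp only [map_sum, map_smul, Submodule.subtype_apply] at h1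
    simpa only [hv, special_tmul, map_one, one_smul] using h1
  have hsp : ⊤ ≤ Submodule.span (RelGerm A n) (Set.range v) := by
    rintro ⟨a, ha⟩ -
    have h1 : a ∈ N := by
      have := mem_smul_of_lift hflat hI hN hlift ⊤ a ha fun i => by rw [Ideal.map_top]; trivial
      exact Submodule.smul_le_right this
    have h2 : N = (Submodule.span (RelGerm A n) (Set.range v)).map (relLogDer I).subtype := by
      rw [Submodule.map_span, ← Set.range_comp]
      rfl
    rw [h2] at h1
    obtain ⟨x, hx, hxa⟩ := h1
    have h3 : x = ⟨a, ha⟩ := Subtype.ext hxa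
    exact h3 ▸ hx
  exact ⟨Module.Basis.mk hli hsp, fun j => by rw [Module.Basis.mk_apply]⟩

/-- A basis of `Der(-log X/S)` restricts to a basis of `Der(-log D)`. -/
theorem IsAdmissible.exists_special_basis {A : ArtAlg} {n : ℕ} {f : HolGerm n}
    {I : Ideal (RelGerm A n)} (h : IsAdmissible f A I)
    (b : Module.Basis (Fin n) (RelGerm A n) (relLogDer I)) :
    ∃ b' : Module.Basis (Fin n) (HolGerm n) (logDer f), ∀ j, specialField A (b j : Fin n → RelGerm A n) = (b' j : Fin n → HolGerm n) := by
  let w : Fin n → logDer f := fun j =>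
    ⟨specialField A (b j : Fin n → RelGerm A n), specialField_mem_logDer h.fibre (b j).2⟩
  have hli : LinearIndependent (HolGerm n) w := by
    rw [Fintype.linearIndependent_iff]
    intro c hc j
    have hc' : ∑ j, c j • specialField A (b j : Fin n → RelGerm A n) = 0 := by
      simpa [w] using congrArg Subtype.val hc
    set a : relLogDer I := ∑ j, (1 ⊗ₜ c j : RelGerm A n) • b j
    have ha : specialField A (a : Fin n → RelGerm A n) = 0 := by
      have : (a : Fin n → RelGerm A n) =
          ∑ j, (1 ⊗ₜ c j : RelGerm A n) • (b j : Fin n → RelGerm A n) := by simp [a]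
      rw [this, specialField_sum]
      simpa [special_tmul] using hc'
    have h1 := h.kernel a a.2 ha
    have h2 : a ∈ baseMaximal A n • (⊤ : Submodule (RelGerm A n) (relLogDer I)) := by
      have h3 : (baseMaximal A n • (⊤ : Submodule (RelGerm A n) (relLogDer I))).map
          (relLogDer I).subtype = baseMaximal A n • relLogDer I := by
        rw [Submodule.map_smul'', Submodule.map_top, Submodule.range_subtype]
      rw [← h3] at h1
      obtain ⟨x, hx, hxa⟩ := h1
      have h4 : x = a := Subtype.ext hxa
      exact h4 ▸ hx
    have h5 : b.repr a j ∈ baseMaximal A n := by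
      refine Submodule.smul_induction_on (p := fun x => b.repr x j ∈ baseMaximal A n) h2 ?_ ?_
      · intro r hr x _
        rw [map_smul, Finsupp.smul_apply, smul_eq_mul]
        exact Ideal.mul_mem_right _ _ hr
      · intro x y hx hy
        rw [map_add, Finsupp.add_apply]
        exact Ideal.add_mem _ hx hy
    have h7 : b.repr a j = 1 ⊗ₜ c j := by
      simp [a, map_sum, Finsupp.single_apply]
    rw [h7] at h5
    simpa [special_tmul] using special_eq_zero_of_mem h5
  have hsp : ⊤ ≤ Submodule.span (HolGerm n) (Set.range w) := by
    rintro ⟨d, hd⟩ -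
    obtain ⟨a, ha, had⟩ := h.image.symm ▸ (show d ∈ (logDer f : Set _) from hd)
    have h1 : (⟨d, hd⟩ : logDer f) = ∑ j, special A n (b.repr ⟨a, ha⟩ j) • w j := by
      apply Subtype.ext
      have h2 := congrArg (relLogDer I).subtype (b.sum_repr ⟨a, ha⟩)
      simp only [map_sum, map_smul, Submodule.subtype_apply] at h2
      have h3 : a = ∑ j, b.repr ⟨a, ha⟩ j • (b j : Fin n → RelGerm A n) := h2.symm
      have h4 := congrArg (specialField A) h3
      rw [specialField_sum, had] at h4
      simpa [w] using h4
    rw [h1]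
    exact Submodule.sum_mem _ fun j _ => Submodule.smul_mem _ _ (Submodule.subset_span ⟨j, rfl⟩)
  exact ⟨Module.Basis.mk hli hsp, fun j => by rw [Module.Basis.mk_apply]⟩

/-! ### Base change -/

theorem relPartialD_mul {A : ArtAlg} {n : ℕ} (i : Fin n) (x y : RelGerm A n) :
    relPartialD A i (x * y) = x * relPartialD A i y + y * relPartialD A i x := by
  induction x using TensorProduct.induction_on with
  | zero => simp
  | add x x' hx hx' => rw [add_mul, map_add, hx, hx', map_add]; ring
  | tmul a g =>
    induction y using TensorProduct.induction_on with
    | zero => simp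
    | add y y' hy hy' => rw [mul_add, map_add, hy, hy', map_add]; ring
    | tmul b h =>
      simp only [relPartialD, Algebra.TensorProduct.tmul_mul_tmul, LinearMap.baseChange_tmul,
        Derivation.coeFn_coe, Derivation.leibniz, smul_eq_mul, TensorProduct.tmul_add, mul_comm b a]

theorem mem_relLogDer_span {A : ArtAlg} {n : ℕ} {S : Set (RelGerm A n)} {a : Fin n → RelGerm A n}
    (h : ∀ g ∈ S, ∑ i, a i * relPartialD A i g ∈ Ideal.span S) :
    a ∈ relLogDer (Ideal.span S) := by
  intro g hg
  induction hg using Submodule.span_induction with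
  | mem x hx => exact h x hx
  | zero => simp
  | add x y _ _ hx hy =>
    simpa only [map_add, mul_add, Finset.sum_add_distrib] using Ideal.add_mem _ hx hy
  | smul c x hxs hx =>
    have h1 : ∑ i, a i * relPartialD A i (c • x) =
        c * (∑ i, a i * relPartialD A i x) + (∑ i, a i * relPartialD A i c) * x := by
      simp only [smul_eq_mul, relPartialD_mul, mul_add, Finset.sum_add_distrib, Finset.mul_sum,
        Finset.sum_mul]
      congr 1 <;> exact Finset.sum_congr rfl fun i _ => by ring
    rw [h1]
    exact Ideal.add_mem _ (Ideal.mul_mem_left _ _ hx) (Ideal.mul_mem_left _ _ hxs)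

section BaseChange

variable {A B : ArtAlg} [Algebra A B] [IsScalarTower ℂ A B] {n : ℕ}

/-- `relMap` as a homomorphism over `A`. -/
def relMapₐ (A B : ArtAlg) [Algebra A B] [IsScalarTower ℂ A B] (n : ℕ) :
    RelGerm A n →ₐ[A] RelGerm B n :=
  Algebra.TensorProduct.lift (Algebra.ofId A (RelGerm B n))
    (Algebra.TensorProduct.includeRight : HolGerm n →ₐ[ℂ] RelGerm B n) fun _ _ => Commute.all _ _

theorem relMapₐ_apply (y : RelGerm A n) :
    relMapₐ A B n y = relMap n (IsScalarTower.toAlgHom ℂ A B) y := by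
  induction y using TensorProduct.induction_on with
  | zero => simp
  | add x y hx hy => rw [map_add, map_add, hx, hy]
  | tmul a g =>
    simp [relMapₐ, relMap, Algebra.ofId_apply, Algebra.TensorProduct.algebraMap_apply]

/-- The map `𝒪_T ⊗ 𝒪_X → 𝒪_{X ×_S T}`. -/
def quotBaseChangeHom (I : Ideal (RelGerm A n)) :
    B ⊗[A] (RelGerm A n ⧸ I) →ₐ[B]
      RelGerm B n ⧸ I.map (relMap n (IsScalarTower.toAlgHom ℂ A B)) :=
  Algebra.TensorProduct.lift (Algebra.ofId B _)
    (Ideal.Quotient.liftₐ I ((Ideal.Quotient.mkₐ A _).comp (relMapₐ A B n)) fun y hy =>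
      Ideal.Quotient.eq_zero_iff_mem.mpr (relMapₐ_apply (B := B) y ▸ Ideal.mem_map_of_mem _ hy))
    fun _ _ => Commute.all _ _

theorem quotBaseChangeHom_tmul (I : Ideal (RelGerm A n)) (b : B) (y : RelGerm A n) :
    quotBaseChangeHom I (b ⊗ₜ[A] Ideal.Quotient.mk I y) =
      b • Ideal.Quotient.mk _ (relMap n (IsScalarTower.toAlgHom ℂ A B) y) := by
  rw [quotBaseChangeHom, Algebra.TensorProduct.lift_tmul, ← relMapₐ_apply]
  exact (Algebra.smul_def
    (A := RelGerm B n ⧸ I.map (relMap n (IsScalarTower.toAlgHom ℂ A B))) b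
    (Ideal.Quotient.mk _ (relMapₐ A B n y))).symm

/-- The composite `𝒪_{ℂⁿ×T} → 𝒪_{X ×_S T} → 𝒪_T ⊗ 𝒪_X`. -/
def quotBaseChangeInv₀ (B : ArtAlg) [Algebra A B] [IsScalarTower ℂ A B]
    (I : Ideal (RelGerm A n)) : RelGerm B n →ₐ[B] B ⊗[A] (RelGerm A n ⧸ I) :=
  Algebra.TensorProduct.lift (Algebra.TensorProduct.includeLeft)
    (((Algebra.TensorProduct.includeRight : _ →ₐ[A] B ⊗[A] (RelGerm A n ⧸ I)).restrictScalars
      ℂ).comp ((Ideal.Quotient.mkₐ ℂ I).comp Algebra.TensorProduct.includeRight))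
    fun _ _ => Commute.all (S := B ⊗[A] (RelGerm A n ⧸ I)) _ _

theorem quotBaseChangeInv₀_tmul (I : Ideal (RelGerm A n)) (b : B) (g : HolGerm n) :
    quotBaseChangeInv₀ B I (b ⊗ₜ g) = b ⊗ₜ Ideal.Quotient.mk I (1 ⊗ₜ g) := by
  rw [quotBaseChangeInv₀, Algebra.TensorProduct.lift_tmul]
  simp

theorem quotBaseChangeInv₀_relMap (I : Ideal (RelGerm A n)) (y : RelGerm A n) :
    quotBaseChangeInv₀ B I (relMap n (IsScalarTower.toAlgHom ℂ A B) y) =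
      1 ⊗ₜ Ideal.Quotient.mk I y := by
  induction y using TensorProduct.induction_on with
  | zero => simp
  | add x y hx hy => rw [map_add, map_add, hx, hy, map_add, TensorProduct.tmul_add]
  | tmul a g =>
    have h1 : (Ideal.Quotient.mk I (a ⊗ₜ g)) = a • Ideal.Quotient.mk I (1 ⊗ₜ g) := by
      change _ = Ideal.Quotient.mk I (a • ((1 : A) ⊗ₜ[ℂ] g))
      rw [TensorProduct.smul_tmul', smul_eq_mul, mul_one]
    rw [h1, ← TensorProduct.smul_tmul, relMap, Algebra.TensorProduct.map_tmul,
      quotBaseChangeInv₀_tmul]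
    simp [Algebra.smul_def]

/-- The map `𝒪_{X ×_S T} → 𝒪_T ⊗ 𝒪_X`. -/
def quotBaseChangeInv (I : Ideal (RelGerm A n)) :
    (RelGerm B n ⧸ I.map (relMap n (IsScalarTower.toAlgHom ℂ A B))) →ₐ[B]
      B ⊗[A] (RelGerm A n ⧸ I) :=
  Ideal.Quotient.liftₐ _ (quotBaseChangeInv₀ B I) fun y hy => by
    have h : I.map (relMap n (IsScalarTower.toAlgHom ℂ A B)) ≤
        RingHom.ker (quotBaseChangeInv₀ B I) := by
      rw [Ideal.map_le_iff_le_comap]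
      intro y hy
      rw [Ideal.mem_comap, RingHom.mem_ker, quotBaseChangeInv₀_relMap,
        Ideal.Quotient.eq_zero_iff_mem.mpr hy, TensorProduct.tmul_zero]
    exact h hy

theorem quotBaseChangeInv_mk (I : Ideal (RelGerm A n)) (y : RelGerm B n) :
    quotBaseChangeInv I (Ideal.Quotient.mk _ y) = quotBaseChangeInv₀ B I y := rfl

/-- `𝒪_{X ×_S T} = 𝒪_T ⊗ 𝒪_X` for `T = Spec B → S = Spec A`. -/
def quotBaseChange (I : Ideal (RelGerm A n)) :
    B ⊗[A] (RelGerm A n ⧸ I) ≃ₐ[B]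
      RelGerm B n ⧸ I.map (relMap n (IsScalarTower.toAlgHom ℂ A B)) :=
  AlgEquiv.ofAlgHom (quotBaseChangeHom I) (quotBaseChangeInv I)
    (by
      refine AlgHom.ext fun x => ?_
      obtain ⟨y, rfl⟩ := Ideal.Quotient.mk_surjective x
      rw [AlgHom.comp_apply, quotBaseChangeInv_mk, AlgHom.id_apply]
      induction y using TensorProduct.induction_on with
      | zero => simp
      | add x y hx hy => rw [map_add, map_add, hx, hy, map_add]
      | tmul b g =>
        rw [quotBaseChangeInv₀_tmul, quotBaseChangeHom_tmul, relMap,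
          Algebra.TensorProduct.map_tmul, map_one]
        change Ideal.Quotient.mk _ (b • ((1 : B) ⊗ₜ[ℂ] g)) = _
        rw [TensorProduct.smul_tmul', smul_eq_mul, mul_one])
    (by
      refine Algebra.TensorProduct.ext' fun b x => ?_
      obtain ⟨y, rfl⟩ := Ideal.Quotient.mk_surjective x
      rw [AlgHom.comp_apply, quotBaseChangeHom_tmul, map_smul, quotBaseChangeInv_mk,
        quotBaseChangeInv₀_relMap, AlgHom.id_apply, TensorProduct.smul_tmul', smul_eq_mul, mul_one])

theorem quotBaseChange_tmul (I : Ideal (RelGerm A n)) (b : B) (y : RelGerm A n) :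
    quotBaseChange I (b ⊗ₜ[A] Ideal.Quotient.mk I y) =
      b • Ideal.Quotient.mk _ (relMap n (IsScalarTower.toAlgHom ℂ A B) y) :=
  quotBaseChangeHom_tmul I b y

end BaseChange

theorem map_relMap_special {A B : ArtAlg} {n : ℕ} (φ : A →ₐ[ℂ] B) (I : Ideal (RelGerm A n)) :
    (I.map (relMap n φ)).map (special B n) = I.map (special A n) := by
  have h : ((special B n : RelGerm B n →+* HolGerm n)).comp (relMap n φ : RelGerm A n →+* RelGerm B n)
      = (special A n : RelGerm A n →+* HolGerm n) :=
    RingHom.ext fun y => special_relMap φ y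
  have h2 := Ideal.map_map (I := I) (relMap n φ : RelGerm A n →+* RelGerm B n)
    (special B n : RelGerm B n →+* HolGerm n)
  rw [h] at h2
  exact h2

theorem relMap_mem_relLogDer {A B : ArtAlg} {n : ℕ} (φ : A →ₐ[ℂ] B) {I : Ideal (RelGerm A n)}
    {a : Fin n → RelGerm A n} (ha : a ∈ relLogDer I) :
    (fun i => relMap n φ (a i)) ∈ relLogDer (I.map (relMap n φ)) := by
  refine mem_relLogDer_span ?_
  rintro _ ⟨g, hg, rfl⟩
  have h1 := Ideal.mem_map_of_mem (relMap n φ) (ha g hg)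
  simp only [map_sum, map_mul, relMap_relPartialD] at h1
  exact h1

theorem specialField_relMap {A B : ArtAlg} {n : ℕ} (φ : A →ₐ[ℂ] B) (a : Fin n → RelGerm A n) :
    specialField B (fun i => relMap n φ (a i)) = specialField A a :=
  funext fun i => special_relMap φ (a i)

/-- Admissible deformations are stable under base change. -/
theorem IsAdmissible.map {A B : ArtAlg} {n : ℕ} {f : HolGerm n} {I : Ideal (RelGerm A n)}
    (h : IsAdmissible f A I) (φ : A →ₐ[ℂ] B) : IsAdmissible f B (I.map (relMap n φ)) := by
  refine IsAdmissible.of_lift ?_ ((map_relMap_special φ I).trans h.fibre) fun d hd => ?_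
  · let _ := φ.toRingHom.toAlgebra
    have : IsScalarTower ℂ A B := IsScalarTower.of_algebraMap_eq fun c => (φ.commutes c).symm
    have := h.flat
    exact Module.Flat.of_linearEquiv (quotBaseChange (B := B) I).symm.toLinearEquiv
  · obtain ⟨a, ha, rfl⟩ := h.image.symm ▸ (show d ∈ (logDer f : Set (Fin n → HolGerm n)) from hd)
    exact ⟨_, relMap_mem_relLogDer φ ha, specialField_relMap φ a⟩

theorem relMap_mem_span_coord {A B : ArtAlg} {n : ℕ} (φ : A →ₐ[ℂ] B) {y : RelGerm A n}
    (hy : y ∈ Submodule.span A (Set.range fun k : Fin n => (1 : A) ⊗ₜ[ℂ] coord k)) :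
    relMap n φ y ∈ Submodule.span B (Set.range fun k : Fin n => (1 : B) ⊗ₜ[ℂ] coord k) := by
  induction hy using Submodule.span_induction with
  | mem x hx =>
    obtain ⟨k, rfl⟩ := hx
    exact Submodule.subset_span ⟨k, by simp [relMap]⟩
  | zero => rw [map_zero]; exact Submodule.zero_mem _
  | add x y _ _ hx hy => rw [map_add]; exact Submodule.add_mem _ hx hy
  | smul a x _ hx =>
    have h1 : relMap n φ (a • x) = φ a • relMap n φ x := by
      rw [Algebra.smul_def, map_mul, Algebra.smul_def]
      simp [relMap, Algebra.TensorProduct.algebraMap_apply]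
    rw [h1]
    exact Submodule.smul_mem _ _ hx

/-- Linearly admissible deformations are stable under base change. -/
theorem IsLinearlyAdmissible.map {A B : ArtAlg} {n : ℕ} {f : HolGerm n} {I : Ideal (RelGerm A n)}
    (h : IsLinearlyAdmissible f A I) (φ : A →ₐ[ℂ] B) :
    IsLinearlyAdmissible f B (I.map (relMap n φ)) := by
  have h' := h.toIsAdmissible.map φ
  obtain ⟨b, hb⟩ := h.linear
  obtain ⟨b₀, hb₀⟩ := h.toIsAdmissible.exists_special_basis b
  obtain ⟨b', hb'⟩ := exists_basis_of_lift h'.flat h'.fibre b₀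
    (fun j => ⟨_, relMap_mem_relLogDer φ (b j).2⟩)
    (fun j => (specialField_relMap φ _).trans (hb₀ j))
  exact { h' with linear := ⟨b', fun j i => by rw [hb' j]; exact relMap_mem_span_coord φ (hb j i)⟩ }

/-! ### The trivial deformation -/

/-- The ideal of the trivial deformation `D × S`. -/
def trivialIdeal {n : ℕ} (f : HolGerm n) (A : ArtAlg) : Ideal (RelGerm A n) :=
  Ideal.span {(1 : A) ⊗ₜ[ℂ] f}

theorem trivialIdeal_map {A B : ArtAlg} {n : ℕ} (f : HolGerm n) (φ : A →ₐ[ℂ] B) :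
    (trivialIdeal f A).map (relMap n φ) = trivialIdeal f B := by
  rw [trivialIdeal, Ideal.map_span, Set.image_singleton, trivialIdeal]
  simp [relMap]

theorem trivial_lift {n : ℕ} {f : HolGerm n} (A : ArtAlg) {d : Fin n → HolGerm n}
    (hd : d ∈ logDer f) :
    (fun i => (1 : A) ⊗ₜ[ℂ] d i) ∈ relLogDer (trivialIdeal f A) := by
  refine mem_relLogDer_span ?_
  rintro _ rfl
  have h0 : ∑ i, d i * partialD i f ∈ Ideal.span {f} := hd
  have h1 := Ideal.mem_map_of_mem
    (Algebra.TensorProduct.includeRight : HolGerm n →ₐ[ℂ] RelGerm A n) h0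
  rw [Ideal.map_span, Set.image_singleton, map_sum] at h1
  simpa [relPartialD] using h1

theorem specialField_trivial {n : ℕ} (A : ArtAlg) (d : Fin n → HolGerm n) :
    specialField A (fun i => (1 : A) ⊗ₜ[ℂ] d i) = d :=
  funext fun i => by simp [specialField, special_tmul]

theorem trivialIdeal_special {n : ℕ} (f : HolGerm n) (A : ArtAlg) :
    (trivialIdeal f A).map (special A n) = Ideal.span {f} := by
  rw [trivialIdeal, Ideal.map_span, Set.image_singleton]
  simp [special_tmul]

theorem trivial_isAdmissible {n : ℕ} (f : HolGerm n) (A : ArtAlg) :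
    IsAdmissible f A (trivialIdeal f A) := by
  have h0 : IsAdmissible f ArtAlg.base (trivialIdeal f ArtAlg.base) :=
    IsAdmissible.of_lift
      (inferInstanceAs (Module.Flat ℂ (RelGerm ArtAlg.base n ⧸ trivialIdeal f ArtAlg.base)))
      (trivialIdeal_special f _)
      fun d hd => ⟨_, trivial_lift _ hd, specialField_trivial _ d⟩
  exact trivialIdeal_map (A := ArtAlg.base) (B := A) f (Algebra.ofId ℂ A) ▸
    h0.map (B := A) (Algebra.ofId ℂ A)

theorem trivial_isLinearlyAdmissible {n : ℕ} {f : HolGerm n} (hf : IsLinearDivisor f) (A : ArtAlg) :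
    IsLinearlyAdmissible f A (trivialIdeal f A) := by
  have h' := trivial_isAdmissible f A
  obtain ⟨b, hb⟩ := hf
  obtain ⟨b', hb'⟩ := exists_basis_of_lift h'.flat h'.fibre b
    (fun j => ⟨_, trivial_lift A (b j).2⟩) (fun j => specialField_trivial A _)
  refine { h' with linear := ⟨b', fun j i => ?_⟩ }
  rw [hb' j]
  change (1 : A) ⊗ₜ[ℂ] (b j : Fin n → HolGerm n) i ∈ _
  have hji := hb j i
  generalize (b j : Fin n → HolGerm n) i = y at hji
  induction hji using Submodule.span_induction with
  | mem x hx =>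
    obtain ⟨k, rfl⟩ := hx
    exact Submodule.subset_span ⟨k, rfl⟩
  | zero => rw [TensorProduct.tmul_zero]; exact Submodule.zero_mem _
  | add x y _ _ hx hy => rw [TensorProduct.tmul_add]; exact Submodule.add_mem _ hx hy
  | smul c x _ hx =>
    rw [TensorProduct.tmul_smul]
    exact (Submodule.span A _).smul_of_tower_mem c hx

/-! ### The deformation functors -/

/-- Isomorphism of deformations `X = V(I)`, `Y = V(J)` of `D` over `S = Spec A`: an isomorphism
`𝒪_X ≅ 𝒪_Y` over `𝒪_S = A` compatible with the identifications of the special fibres with `D`. -/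
def DefIso {n : ℕ} {f : HolGerm n} {A : ArtAlg} {I J : Ideal (RelGerm A n)}
    (hI : IsAdmissible f A I) (hJ : IsAdmissible f A J) : Prop :=
  ∃ e : (RelGerm A n ⧸ I) ≃ₐ[A] (RelGerm A n ⧸ J),
    ∀ x, specialQuot hJ.fibre.le (e x) = specialQuot hI.fibre.le x

theorem DefIso.refl {n : ℕ} {f : HolGerm n} {A : ArtAlg} {I : Ideal (RelGerm A n)}
    (hI : IsAdmissible f A I) : DefIso hI hI :=
  ⟨AlgEquiv.refl, fun _ => rfl⟩

theorem DefIso.symm {n : ℕ} {f : HolGerm n} {A : ArtAlg} {I J : Ideal (RelGerm A n)}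
    {hI : IsAdmissible f A I} {hJ : IsAdmissible f A J} (h : DefIso hI hJ) : DefIso hJ hI := by
  obtain ⟨e, he⟩ := h
  exact ⟨e.symm, fun x => by rw [← he, AlgEquiv.apply_symm_apply]⟩

theorem DefIso.trans {n : ℕ} {f : HolGerm n} {A : ArtAlg} {I J K : Ideal (RelGerm A n)}
    {hI : IsAdmissible f A I} {hJ : IsAdmissible f A J} {hK : IsAdmissible f A K}
    (h : DefIso hI hJ) (h' : DefIso hJ hK) : DefIso hI hK := by
  obtain ⟨e, he⟩ := h
  obtain ⟨e', he'⟩ := h'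
  exact ⟨e.trans e', fun x => by rw [AlgEquiv.trans_apply, he', he]⟩

theorem specialQuot_quotBaseChange {A B : ArtAlg} [Algebra A B] [IsScalarTower ℂ A B] {n : ℕ}
    {f : HolGerm n} {I : Ideal (RelGerm A n)} (hI : I.map (special A n) ≤ Ideal.span {f})
    (hI' : (I.map (relMap n (IsScalarTower.toAlgHom ℂ A B))).map (special B n) ≤ Ideal.span {f})
    (b : B) (x : RelGerm A n ⧸ I) :
    specialQuot hI' (quotBaseChange I (b ⊗ₜ[A] x)) = B.aug b • specialQuot hI x := by
  obtain ⟨y, rfl⟩ := Ideal.Quotient.mk_surjective x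
  rw [quotBaseChange_tmul, specialQuot_smul, specialQuot_mk, specialQuot_mk, special_relMap]

theorem DefIso.map_algebra {A B : ArtAlg} [Algebra A B] [IsScalarTower ℂ A B] {n : ℕ}
    {f : HolGerm n} {I J : Ideal (RelGerm A n)} {hI : IsAdmissible f A I}
    {hJ : IsAdmissible f A J} (h : DefIso hI hJ) :
    DefIso (hI.map (IsScalarTower.toAlgHom ℂ A B)) (hJ.map (IsScalarTower.toAlgHom ℂ A B)) := by
  obtain ⟨e, he⟩ := h
  refine ⟨((quotBaseChange (B := B) I).symm.trans
    (Algebra.TensorProduct.congr (AlgEquiv.refl (R := B)) e)).trans (quotBaseChange (B := B) J),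
    fun x => ?_⟩
  obtain ⟨t, rfl⟩ := (quotBaseChange (B := B) I).surjective x
  rw [AlgEquiv.trans_apply, AlgEquiv.trans_apply, AlgEquiv.symm_apply_apply]
  induction t using TensorProduct.induction_on with
  | zero => simp only [map_zero]
  | add x y hx hy => simp only [map_add, hx, hy]
  | tmul b x =>
    rw [Algebra.TensorProduct.congr_apply, Algebra.TensorProduct.map_tmul]
    refine (specialQuot_quotBaseChange hJ.fibre.le (hJ.map _).fibre.le b (e x)).trans ?_
    rw [he]
    exact (specialQuot_quotBaseChange hI.fibre.le (hI.map _).fibre.le b x).symm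

theorem DefIso.map {A B : ArtAlg} {n : ℕ} {f : HolGerm n} {I J : Ideal (RelGerm A n)}
    {hI : IsAdmissible f A I} {hJ : IsAdmissible f A J} (h : DefIso hI hJ) (φ : A →ₐ[ℂ] B) :
    DefIso (hI.map φ) (hJ.map φ) := by
  let _ := φ.toRingHom.toAlgebra
  have : IsScalarTower ℂ A B := IsScalarTower.of_algebraMap_eq fun c => (φ.commutes c).symm
  exact DefIso.map_algebra h

theorem map_relMap_id {A : ArtAlg} {n : ℕ} (I : Ideal (RelGerm A n)) :
    I.map (relMap n (AlgHom.id ℂ A)) = I := by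
  have h : relMap n (AlgHom.id ℂ A) = AlgHom.id ℂ (RelGerm A n) :=
    Algebra.TensorProduct.map_id
  rw [h]
  exact Ideal.map_id I

theorem map_relMap_comp {A B C : ArtAlg} {n : ℕ} (φ : A →ₐ[ℂ] B) (ψ : B →ₐ[ℂ] C)
    (I : Ideal (RelGerm A n)) :
    I.map (relMap n (ψ.comp φ)) = (I.map (relMap n φ)).map (relMap n ψ) := by
  have h : relMap n (ψ.comp φ) = (relMap n ψ).comp (relMap n φ) := by
    apply Algebra.TensorProduct.ext' 
    intro a g
    simp [relMap]
  rw [h]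
  exact (Ideal.map_map (I := I) (relMap n φ : RelGerm A n →+* RelGerm B n)
    (relMap n ψ : RelGerm B n →+* RelGerm C n)).symm

/-- Admissible deformations of `V(f)` over `Spec A`, up to isomorphism. -/
def admissibleSetoid {n : ℕ} (f : HolGerm n) (A : ArtAlg) :
    Setoid {I : Ideal (RelGerm A n) // IsAdmissible f A I} where
  r I J := DefIso I.2 J.2
  iseqv := ⟨fun I => DefIso.refl I.2, DefIso.symm, DefIso.trans⟩

/-- Linearly admissible deformations of `V(f)` over `Spec A`, up to isomorphism. -/
def linearlyAdmissibleSetoid {n : ℕ} (f : HolGerm n) (A : ArtAlg) :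
    Setoid {I : Ideal (RelGerm A n) // IsLinearlyAdmissible f A I} where
  r I J := DefIso I.2.toIsAdmissible J.2.toIsAdmissible
  iseqv := ⟨fun I => DefIso.refl I.2.toIsAdmissible, DefIso.symm, DefIso.trans⟩

/-- The functor `FD_D` for `D = V(f)`: `A ↦` isomorphism classes of admissible deformations of `D`
over `Spec A`, pointed by the class of the trivial deformation. -/
def FD {n : ℕ} (f : HolGerm n) : ArtAlg ⥤ Pointed.{0} where
  obj A := ⟨Quotient (admissibleSetoid f A), Quotient.mk _ ⟨_, trivial_isAdmissible f A⟩⟩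
  map {A B} φ :=
    { toFun := Quotient.map (fun I => ⟨I.1.map (relMap (A := A) (B := B) n φ), I.2.map φ⟩)
        fun _ _ h => DefIso.map h φ
      map_point := congrArg (Quotient.mk _) (Subtype.ext (trivialIdeal_map f φ)) }
  map_id A := by
    apply Pointed.Hom.ext
    funext x
    induction x using Quotient.inductionOn with
    | h I => exact congrArg (Quotient.mk _) (Subtype.ext (map_relMap_id I.1))
  map_comp {A B C} φ ψ := by
    apply Pointed.Hom.ext
    funext x
    induction x using Quotient.inductionOn with
    | h I => exact congrArg (Quotient.mk _) (Subtype.ext (map_relMap_comp φ ψ I.1))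

/-- The functor `LFD_D` for a linear free divisor `D = V(f)`. -/
def LFD {n : ℕ} (f : HolGerm n) (hf : IsLinearDivisor f) : ArtAlg ⥤ Pointed.{0} where
  obj A := ⟨Quotient (linearlyAdmissibleSetoid f A),
    Quotient.mk _ ⟨_, trivial_isLinearlyAdmissible hf A⟩⟩
  map {A B} φ :=
    { toFun := Quotient.map (fun I => ⟨I.1.map (relMap (A := A) (B := B) n φ), I.2.map φ⟩)
        fun _ _ h => DefIso.map h φ
      map_point := congrArg (Quotient.mk _) (Subtype.ext (trivialIdeal_map f φ)) }
  map_id A := by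
    apply Pointed.Hom.ext
    funext x
    induction x using Quotient.inductionOn with
    | h I => exact congrArg (Quotient.mk _) (Subtype.ext (map_relMap_id I.1))
  map_comp {A B C} φ ψ := by
    apply Pointed.Hom.ext
    funext x
    induction x using Quotient.inductionOn with
    | h I => exact congrArg (Quotient.mk _) (Subtype.ext (map_relMap_comp φ ψ I.1))

end

/-! Write P = A' ×_A A''. Tensoring with 𝒪 over ℂ is exact, so 𝒪_P is the fibre product of 𝒪_{A'}
and 𝒪_{A''} over 𝒪_A. A flat deformation of V(f) is cut out by any lift F of f in its ideal
(`eq_span_of_flat`), and every V(F) with F lifting f ≠ 0 is flat (`flat_quot_span`). Deformations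
whose ideals coincide over A can therefore be glued by gluing equations. Logarithmic fields glue as
well, because those of an admissible deformation lift along surjections of the base algebra
(`IsAdmissible.exists_lift_field`).

A point of the right-hand side of (H1) only gives deformations that are isomorphic over A. Such an
isomorphism comes from an automorphism of the ambient space that is the identity on the special
fibre (`DefIso.exists_aut`). It lifts along A'' → A, since the images of the coordinates can be
prescribed freely (`exists_aut`); moving the deformation over A'' by the lift makes the ideals
coincide over A. For injectivity in (H2), the two isomorphisms automatically agree over ℂ, where
both restrict to the identity of 𝒪_D, and so they glue (`DefIso.of_factors`).

The analytic input is that a derivation 𝒪 → 𝒪/(f) killing the coordinates vanishes. Its values are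
represented by germs of arbitrarily high order, and principal ideals are closed, because a formal
quotient of convergent series converges (`IsConvergent.of_mul`).

In the linear case the ambient automorphism must be linear, so that linear bases survive. If Θ
identifies two linearly admissible deformations, so does its linear part Λ
(`IsLinearlyAdmissible.exists_linear_aut`): taking linear parts preserves logarithmic fields, hence
Λ matches the logarithmic fields. These determine the ideal because D is reduced
(`mem_of_forall_smul_mem_relLogDer`).

Statements over A are proved by descent through ideals J of A, each of codimension one in the
previous one. An error in J𝒪_A is then measured by a single germ, its `slice`, and a correction by a
multiple of `s.e` moves it into the next ideal. -/

noncomputable section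

/-! ### Weights with a unique initial monomial -/

/-- The weight of an exponent. -/
def wt {n : ℕ} (w : Fin n → ℕ) (d : Fin n →₀ ℕ) : ℕ := ∑ i, w i * d i

theorem wt_add {n : ℕ} (w : Fin n → ℕ) (d e : Fin n →₀ ℕ) : wt w (d + e) = wt w d + wt w e := by
  simp [wt, mul_add, Finset.sum_add_distrib]

theorem degree_eq_univ_sum {n : ℕ} (d : Fin n →₀ ℕ) : d.degree = ∑ i, d i :=
  Finsupp.degree_eq_sum d

theorem degree_le_wt {n : ℕ} {w : Fin n → ℕ} (hw : ∀ i, 0 < w i) (d : Fin n →₀ ℕ) :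
    d.degree ≤ wt w d := by
  rw [degree_eq_univ_sum]
  exact Finset.sum_le_sum fun i _ => Nat.le_mul_of_pos_left _ (hw i)

theorem wt_le_mul_degree {n : ℕ} (w : Fin n → ℕ) (d : Fin n →₀ ℕ) :
    wt w d ≤ (∑ i, w i) * d.degree := by
  rw [wt, Finset.sum_mul]
  exact Finset.sum_le_sum fun i _ => Nat.mul_le_mul_left _ (Finsupp.le_degree i d)

/-- Uniqueness of digits in base `b`. -/
theorem eq_of_sum_pow_mul_eq {n b : ℕ} (hb : 1 < b) {d e : Fin n →₀ ℕ} (hd : ∀ i, d i < b)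
    (he : ∀ i, e i < b) (h : ∑ i : Fin n, b ^ (i : ℕ) * d i = ∑ i : Fin n, b ^ (i : ℕ) * e i) : d = e := by
  refine Finsupp.ext <| congrFun <| List.ofFn_inj.mp ?_
  apply Nat.ofDigits_inj_of_len_eq hb (by simp)
    (by simpa [List.mem_ofFn] using hd) (by simpa [List.mem_ofFn] using he)
  simpa only [Nat.ofDigits_eq_sum_mapIdx, List.mapIdx_eq_ofFn, List.get_ofFn, List.length_ofFn,
    Fin.val_cast, mul_comm, List.sum_ofFn] using! h

/-- The weight is a large multiple of the degree plus a number with base `b` digits `d i`. The first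
term forces a minimiser to have minimal degree, and the digits separate the exponents of that
degree. -/
theorem exists_weight_unique_min {n : ℕ} {S : Set (Fin n →₀ ℕ)} (hS : S.Nonempty) :
    ∃ w : Fin n → ℕ, (∀ i, 0 < w i) ∧ ∃ α ∈ S, ∀ e ∈ S, e ≠ α → wt w α < wt w e := by
  set d₀ := Function.argminOn (fun d : Fin n →₀ ℕ => d.degree) S hS
  have hd₀ : d₀ ∈ S := Function.argminOn_mem _ S hS
  set k := d₀.degree
  have hk : ∀ d ∈ S, k ≤ d.degree := fun d hd =>
    Function.argminOn_le (fun d : Fin n →₀ ℕ => d.degree) S hd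
  -- Exponents of degree `k` have entries at most `k`, so these are digits in base `b`; `k + 2`
  -- instead of `k + 1` keeps the base above 1 when `k = 0`.
  set b := k + 2
  -- `N` exceeds the digit part of the weight of `d₀`, so a single extra degree already outweighs
  -- it.
  set N := k * b ^ n + 1
  let w : Fin n → ℕ := fun i => N + b ^ (i : ℕ)
  have hwt : ∀ d, wt w d = N * d.degree + ∑ i : Fin n, b ^ (i : ℕ) * d i := fun d => by
    rw [degree_eq_univ_sum]
    simp [wt, w, add_mul, Finset.sum_add_distrib, Finset.mul_sum]
  set α := Function.argminOn (wt w) S hS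
  have hα : α ∈ S := Function.argminOn_mem _ S hS
  have hmin : ∀ d ∈ S, wt w α ≤ wt w d := fun d hd => Function.argminOn_le (wt w) S hd
  have h0 : wt w d₀ < N * (k + 1) := by
    have h1 : ∑ i : Fin n, b ^ (i : ℕ) * d₀ i ≤ k * b ^ n := by
      calc ∑ i : Fin n, b ^ (i : ℕ) * d₀ i ≤ ∑ i : Fin n, b ^ n * d₀ i :=
            Finset.sum_le_sum fun i _ =>
              Nat.mul_le_mul_right _ (Nat.pow_le_pow_right (by omega) i.2.le)
        _ = k * b ^ n := by rw [← Finset.mul_sum, ← degree_eq_univ_sum, mul_comm]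
    rw [hwt, mul_add, mul_one]
    change N * k + _ < _
    omega
  have hdeg : ∀ e ∈ S, wt w e = wt w α → e.degree = k := by
    intro e he hea
    refine le_antisymm ?_ (hk e he)
    by_contra hlt
    have h1 : N * (k + 1) ≤ N * e.degree := Nat.mul_le_mul_left _ (by omega)
    have h2 := hmin _ hd₀
    have h3 := hwt e
    omega
  refine ⟨w, fun i => by positivity, α, hα, fun e he hne => lt_of_le_of_ne (hmin e he) fun h => hne ?_⟩
  have h1 := hdeg e he h.symm
  have h2 := hdeg α hα rfl
  have h3 : ∀ d : Fin n →₀ ℕ, d.degree = k → ∀ i, d i < b := fun d hd i => by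
    have := Finsupp.le_degree i d
    omega
  refine eq_of_sum_pow_mul_eq (by omega) (h3 e h1) (h3 α h2) ?_
  have h4 := hwt e
  have h5 := hwt α
  rw [h1] at h4
  rw [h2] at h5
  omega

/-! ### Convergence of quotients -/

/-- For radii at most 1 the bound degree ≤ weight makes the weighted series the smaller one. -/
theorem IsConvergent.exists_wt {n : ℕ} {p : MvPowerSeries (Fin n) ℂ} (hp : IsConvergent p)
    {w : Fin n → ℕ} (hw : ∀ i, 0 < w i) :
    ∃ r : ℝ, 0 < r ∧ ∀ s, 0 < s → s ≤ r →
      Summable fun d : Fin n →₀ ℕ => ‖MvPowerSeries.coeff d p‖ * s ^ wt w d := by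
  obtain ⟨r, hr, h⟩ := hp
  refine ⟨min r 1, by positivity, fun s hs hsr =>
    (IsConvergent.exists_radius_le hs.le (hsr.trans (min_le_left _ _)) h).of_nonneg_of_le
      (fun d => by positivity) fun d => ?_⟩
  exact mul_le_mul_of_nonneg_left (pow_le_pow_of_le_one hs.le (hsr.trans (min_le_right _ _))
    (degree_le_wt hw d)) (norm_nonneg _)

/-- The weight is at most `∑ i, w i` times the degree, so the radius `s ^ ∑ i, w i` works. -/
theorem IsConvergent.of_wt {n : ℕ} {p : MvPowerSeries (Fin n) ℂ} (w : Fin n → ℕ) {s : ℝ}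
    (hs : 0 < s) (hs1 : s ≤ 1)
    (h : Summable fun d : Fin n →₀ ℕ => ‖MvPowerSeries.coeff d p‖ * s ^ wt w d) :
    IsConvergent p := by
  refine ⟨s ^ ∑ i, w i, by positivity, h.of_nonneg_of_le (fun d => by positivity) fun d => ?_⟩
  rw [← pow_mul]
  exact mul_le_mul_of_nonneg_left (pow_le_pow_of_le_one hs.le hs1 (wt_le_mul_degree w d))
    (norm_nonneg _)

/-- If `f` and `f * q` converge and `f ≠ 0`, then `q` converges. -/
theorem IsConvergent.of_mul {n : ℕ} {f q : MvPowerSeries (Fin n) ℂ} (hf0 : f ≠ 0)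
    (hf : IsConvergent f) (hg : IsConvergent (f * q)) : IsConvergent q := by
  classical
  obtain ⟨w, hw, α, hα, hmin⟩ := exists_weight_unique_min
    (S := {d | MvPowerSeries.coeff d f ≠ 0}) ((MvPowerSeries.ne_zero_iff_exists_coeff_ne_zero f).mp hf0)
  obtain ⟨r₁, hr₁, h₁⟩ := hf.exists_wt hw
  obtain ⟨r₂, hr₂, h₂⟩ := hg.exists_wt hw
  set c := ‖MvPowerSeries.coeff α f‖
  have hc : 0 < c := norm_pos_iff.mpr hα
  set ρ := min r₁ 1
  have hρ : 0 < ρ := by positivity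
  have hS := h₁ ρ hρ (min_le_left _ _)
  set T := ∑' d : Fin n →₀ ℕ, ‖MvPowerSeries.coeff d f‖ * ρ ^ wt w d
  have hT : 0 ≤ T := tsum_nonneg fun d => by positivity
  -- a radius at which the initial monomial dominates
  obtain ⟨s, hs, hsρ, hs₂, hdom⟩ : ∃ s : ℝ, 0 < s ∧ s ≤ ρ ∧ s ≤ r₂ ∧
      s * T ≤ c * ρ ^ (wt w α + 1) / 2 := by
    refine ⟨min (min ρ r₂) (c * ρ ^ (wt w α + 1) / 2 / (T + 1)), by positivity,
      (min_le_left _ _).trans (min_le_left _ _), (min_le_left _ _).trans (min_le_right _ _), ?_⟩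
    have h3 := min_le_right (min ρ r₂) (c * ρ ^ (wt w α + 1) / 2 / (T + 1))
    rw [le_div_iff₀ (by positivity)] at h3
    refine le_trans ?_ h3
    gcongr
    linarith
  have hs1 : s ≤ 1 := hsρ.trans (min_le_right _ _)
  -- `F` records `f` without its initial monomial. All other exponents in the support have weight at
  -- least `wt w α + 1`; passing from radius `ρ` to `s` thus gains `(s / ρ) ^ (wt w α + 1)`, which
  -- makes the sum of `F` at most half the initial term.
  let F : (Fin n →₀ ℕ) → ℝ := fun d => if d = α then 0 else ‖MvPowerSeries.coeff d f‖ * s ^ wt w d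
  have hF0 : ∀ d, 0 ≤ F d := fun d => by
    simp only [F]
    split_ifs <;> positivity
  have hFle : ∀ d, F d ≤ (s / ρ) ^ (wt w α + 1) * (‖MvPowerSeries.coeff d f‖ * ρ ^ wt w d) := by
    intro d
    simp only [F]
    split_ifs with h
    · positivity
    · by_cases hd : MvPowerSeries.coeff d f = 0
      · simp [hd]
      · have h4 : wt w α + 1 ≤ wt w d := hmin d hd h
        have h5 : s ^ wt w d = (s / ρ) ^ wt w d * ρ ^ wt w d := by
          rw [← mul_pow, div_mul_cancel₀ _ hρ.ne']
        have h6 : (s / ρ) ^ wt w d ≤ (s / ρ) ^ (wt w α + 1) :=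
          pow_le_pow_of_le_one (by positivity) ((div_le_one hρ).mpr hsρ) h4
        rw [h5]
        calc ‖MvPowerSeries.coeff d f‖ * ((s / ρ) ^ wt w d * ρ ^ wt w d)
            ≤ ‖MvPowerSeries.coeff d f‖ * ((s / ρ) ^ (wt w α + 1) * ρ ^ wt w d) := by gcongr
          _ = _ := by ring
  have hFs : Summable F := (hS.mul_left _).of_nonneg_of_le hF0 hFle
  have hFsum : ∑' d, F d ≤ c * s ^ wt w α / 2 := by
    have h7 : ∑' d, F d ≤ (s / ρ) ^ (wt w α + 1) * T := by
      rw [← tsum_mul_left]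
      exact hFs.tsum_le_tsum hFle (hS.mul_left _)
    refine h7.trans ?_
    rw [div_pow, div_mul_eq_mul_div, div_le_iff₀ (by positivity), pow_succ s, mul_assoc]
    calc s ^ wt w α * (s * T) ≤ s ^ wt w α * (c * ρ ^ (wt w α + 1) / 2) := by gcongr
      _ = _ := by ring
  let Q : (Fin n →₀ ℕ) → ℝ := fun d => ‖MvPowerSeries.coeff d q‖ * s ^ wt w d
  have hQ0 : ∀ d, 0 ≤ Q d := fun d => by positivity
  have hG := h₂ s hs hs₂
  let G : (Fin n →₀ ℕ) → ℝ := fun d => ‖MvPowerSeries.coeff d (f * q)‖ * s ^ wt w d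
  have hG0 : ∀ d, 0 ≤ G d := fun d => by positivity
  have hGα : Summable fun d => G (d + α) := hG.comp_injective (add_left_injective α)
  -- the recursion for the coefficients
  have hrec : ∀ d, c * s ^ wt w α * Q d ≤ G (d + α) +
      ∑ x ∈ (Finset.HasAntidiagonal.antidiagonal (d + α)).erase (α, d), F x.1 * Q x.2 := by
    intro d
    have hmem : (α, d) ∈ Finset.HasAntidiagonal.antidiagonal (d + α) := by
      rw [Finset.HasAntidiagonal.mem_antidiagonal, add_comm]
    have h8 := MvPowerSeries.coeff_mul (d + α) f q
    rw [← Finset.add_sum_erase _ _ hmem] at h8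
    have h9 : MvPowerSeries.coeff α f * MvPowerSeries.coeff d q =
        MvPowerSeries.coeff (d + α) (f * q) -
          ∑ x ∈ (Finset.HasAntidiagonal.antidiagonal (d + α)).erase (α, d),
            MvPowerSeries.coeff x.1 f * MvPowerSeries.coeff x.2 q := by
      rw [h8]; ring
    have h10 := congrArg norm h9
    rw [norm_mul] at h10
    have h11 : c * ‖MvPowerSeries.coeff d q‖ ≤ ‖MvPowerSeries.coeff (d + α) (f * q)‖ +
        ∑ x ∈ (Finset.HasAntidiagonal.antidiagonal (d + α)).erase (α, d),
            ‖MvPowerSeries.coeff x.1 f‖ * ‖MvPowerSeries.coeff x.2 q‖ := by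
      rw [h10]
      refine (norm_sub_le _ _).trans (add_le_add le_rfl ((norm_sum_le _ _).trans ?_))
      exact Finset.sum_le_sum fun x _ => (norm_mul _ _).le
    have h12 : c * s ^ wt w α * Q d = c * ‖MvPowerSeries.coeff d q‖ * s ^ wt w (d + α) := by
      simp only [Q, wt_add, pow_add]; ring
    rw [h12]
    refine (mul_le_mul_of_nonneg_right h11 (by positivity)).trans ?_
    rw [add_mul, Finset.sum_mul]
    refine add_le_add le_rfl (Finset.sum_le_sum fun x hx => ?_)
    obtain ⟨hx1, hx2⟩ := Finset.mem_erase.mp hx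
    rw [Finset.HasAntidiagonal.mem_antidiagonal] at hx2
    have hne : x.1 ≠ α := by
      intro h
      apply hx1
      rw [← h, add_comm] at hx2
      exact Prod.ext h (add_right_cancel (hx2.trans (by rw [h])) )
    simp only [F, Q, if_neg hne]
    rw [← hx2, wt_add, pow_add]
    exact le_of_eq (by ring)
  have hfin : ∀ W : ℕ, {d : Fin n →₀ ℕ | wt w d < W}.Finite := fun W =>
    (Finsupp.finite_of_degree_le W).subset fun d hd => ((degree_le_wt hw d).trans hd.le)
  -- Summing the recursion over weights below `W` bounds a finite sum by a constant plus half of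
  -- itself. Finiteness allows the half to be absorbed, and the resulting bound does not depend on
  -- `W`.
  have hbound : ∀ W : ℕ, ∑ d ∈ (hfin W).toFinset, Q d ≤
      2 * (∑' d, G (d + α)) / (c * s ^ wt w α) := by
    intro W
    set K := (hfin W).toFinset
    set SW := ∑ d ∈ K, Q d
    have hSW : 0 ≤ SW := Finset.sum_nonneg fun d _ => hQ0 d
    have h13 : ∑ d ∈ K, ∑ x ∈ (Finset.HasAntidiagonal.antidiagonal (d + α)).erase (α, d), F x.1 * Q x.2 ≤
        (∑' d, F d) * SW := by
      -- In a nonzero term `x.1` is heavier than `α`, so `x.2` is lighter than `d` and stays inside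
      -- the truncation.
      have h14 : ∀ d ∈ K, ∀ x ∈ (Finset.HasAntidiagonal.antidiagonal (d + α)).erase (α, d),
          F x.1 * Q x.2 ≠ 0 → x.2 ∈ K := by
        intro d hd x hx hne
        rw [Set.Finite.mem_toFinset] at hd ⊢
        have h15 : F x.1 ≠ 0 := left_ne_zero_of_mul hne
        have h16 : x.1 ≠ α := fun h => h15 (by simp [F, h])
        have h17 : MvPowerSeries.coeff x.1 f ≠ 0 := fun h => h15 (by simp [F, h])
        have h18 := hmin _ h17 h16
        have h19 := congrArg (wt w) (Finset.HasAntidiagonal.mem_antidiagonal.mp (Finset.mem_erase.mp hx).2)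
        rw [wt_add, wt_add] at h19
        change wt w d < W at hd
        change wt w x.2 < W
        omega
      rw [Finset.sum_sigma']
      set Z := K.sigma fun d => (Finset.HasAntidiagonal.antidiagonal (d + α)).erase (α, d)
      calc ∑ z ∈ Z, F z.2.1 * Q z.2.2
          = ∑ z ∈ Z with F z.2.1 * Q z.2.2 ≠ 0, F z.2.1 * Q z.2.2 :=
            (Finset.sum_filter_ne_zero Z).symm
        -- The pair alone determines `d`, as its entries add up to `d + α`; no term is counted
        -- twice.
        _ = ∑ y ∈ (Z.filter fun z => F z.2.1 * Q z.2.2 ≠ 0).image fun z => z.2, F y.1 * Q y.2 := by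
            rw [Finset.sum_image]
            intro z hz z' hz' h
            simp only [Finset.coe_filter, Set.mem_ofPred_eq, Z, Finset.mem_sigma,
              Finset.mem_erase, Finset.HasAntidiagonal.mem_antidiagonal] at hz hz'
            refine Sigma.ext ?_ (heq_of_eq h)
            apply add_right_cancel (b := α)
            rw [← hz.1.2.2, ← hz'.1.2.2]
            exact congrArg (fun p => p.1 + p.2) h
        _ ≤ ∑ y ∈ (Z.image fun z => z.2.1) ×ˢ K, F y.1 * Q y.2 := by
            refine Finset.sum_le_sum_of_subset_of_nonneg ?_ fun y _ _ =>
              mul_nonneg (hF0 _) (hQ0 _)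
            intro y hy
            obtain ⟨z, hz, rfl⟩ := Finset.mem_image.mp hy
            obtain ⟨hz1, hz2⟩ := Finset.mem_filter.mp hz
            obtain ⟨hz3, hz4⟩ := Finset.mem_sigma.mp hz1
            exact Finset.mem_product.mpr
              ⟨Finset.mem_image.mpr ⟨z, hz1, rfl⟩, h14 _ hz3 _ hz4 hz2⟩
        _ = (∑ d ∈ Z.image fun z => z.2.1, F d) * SW := by
            rw [Finset.sum_mul_sum, Finset.sum_product]
        _ ≤ (∑' d, F d) * SW :=
            mul_le_mul_of_nonneg_right (hFs.sum_le_tsum _ fun d _ => hF0 d) hSW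
    have h20 : c * s ^ wt w α * SW ≤ (∑' d, G (d + α)) + c * s ^ wt w α / 2 * SW := by
      calc c * s ^ wt w α * SW = ∑ d ∈ K, c * s ^ wt w α * Q d := by rw [Finset.mul_sum]
        _ ≤ ∑ d ∈ K, (G (d + α) +
              ∑ x ∈ (Finset.HasAntidiagonal.antidiagonal (d + α)).erase (α, d), F x.1 * Q x.2) :=
            Finset.sum_le_sum fun d _ => hrec d
        _ ≤ (∑' d, G (d + α)) + (∑' d, F d) * SW := by
            rw [Finset.sum_add_distrib]
            exact add_le_add (hGα.sum_le_tsum _ fun d _ => hG0 _) h13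
        _ ≤ _ := by gcongr
    rw [le_div_iff₀ (by positivity)]
    linarith
  refine IsConvergent.of_wt w hs hs1 (summable_of_sum_le hQ0 (c := 2 * (∑' d, G (d + α)) / (c * s ^ wt w α)) fun u => ?_)
  obtain ⟨W, hW⟩ : ∃ W, ∀ d ∈ u, wt w d < W :=
    ⟨u.sup (wt w) + 1, fun d hd => Nat.lt_succ_of_le (Finset.le_sup hd)⟩
  refine le_trans ?_ (hbound W)
  exact Finset.sum_le_sum_of_subset_of_nonneg (fun d hd => by simpa using hW d hd) fun d _ _ => hQ0 d

/-! ### Germs -/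

instance (n : ℕ) : IsDomain (HolGerm n) :=
  have : IsDomain (MvPowerSeries (Fin n) ℂ) := NoZeroDivisors.to_isDomain _
  Function.Injective.isDomain (convergentSubalgebra n).val.toRingHom Subtype.val_injective

/-- The Taylor coefficients of a germ. -/
def taylorCoeff {n : ℕ} (d : Fin n →₀ ℕ) : HolGerm n →ₗ[ℂ] ℂ :=
  (MvPowerSeries.coeff (R := ℂ) d).comp (convergentSubalgebra n).val.toLinearMap

theorem HolGerm.ext_taylorCoeff {n : ℕ} {g h : HolGerm n}
    (H : ∀ d, taylorCoeff d g = taylorCoeff d h) : g = h :=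
  Subtype.ext (MvPowerSeries.ext H)

/-- The value of a germ at the origin. -/
def evalZero (n : ℕ) : HolGerm n →ₐ[ℂ] ℂ :=
  AlgHom.comp
    { MvPowerSeries.constantCoeff (σ := Fin n) (R := ℂ) with
      commutes' := fun c => by
        simp [MvPowerSeries.algebraMap_apply] } (convergentSubalgebra n).val

theorem evalZero_eq {n : ℕ} (g : HolGerm n) : evalZero n g = taylorCoeff 0 g := rfl

theorem taylorCoeff_partialD {n : ℕ} (i : Fin n) (d : Fin n →₀ ℕ) (g : HolGerm n) :
    taylorCoeff d (partialD i g) = taylorCoeff (d + Finsupp.single i 1) g * (d i + 1) :=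
  MvPowerSeries.coeff_pderiv ..

theorem partialD_coord {n : ℕ} (i j : Fin n) :
    partialD i (coord j) = if i = j then (1 : HolGerm n) else 0 := by
  apply Subtype.ext
  change MvPowerSeries.pderiv ℂ i (MvPowerSeries.X j) = _
  split_ifs with h
  · subst h
    exact MvPowerSeries.pderiv_X_self
  · exact MvPowerSeries.pderiv_X_of_ne (Ne.symm h)

theorem evalZero_coord {n : ℕ} (i : Fin n) : evalZero n (coord i) = 0 :=
  MvPowerSeries.constantCoeff_X i

/-- Hadamard's lemma. -/
theorem exists_eq_add_sum_coord_mul {n : ℕ} (g : HolGerm n) :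
    ∃ h : Fin n → HolGerm n, g = algebraMap ℂ _ (evalZero n g) + ∑ i, coord i * h i := by
  classical
  -- Each monomial of `g` is shared among the variables in proportion to its exponents: `coord i * H
  -- i` receives the fraction `d i / d.degree`, and these fractions add up to 1. The factors have
  -- norm at most 1, so the radius of convergence is kept.
  let H : Fin n → MvPowerSeries (Fin n) ℂ := fun i d =>
    ((d i + 1 : ℂ) / (d.degree + 1)) * MvPowerSeries.coeff (d + Finsupp.single i 1) g.1
  have hc : ∀ i, IsConvergent (H i) := by
    intro i
    obtain ⟨r, hr, h⟩ := g.2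
    have hinj : Function.Injective fun d : Fin n →₀ ℕ => d + Finsupp.single i 1 :=
      add_left_injective _
    refine ⟨r, hr, ((h.comp_injective hinj).mul_right r⁻¹).of_nonneg_of_le
      (fun d => by positivity) fun d => ?_⟩
    have h1 : ‖((d i + 1 : ℂ) / (d.degree + 1))‖ ≤ 1 := by
      have h2 : ((d i + 1 : ℂ) / (d.degree + 1)) =
          (((d i + 1 : ℝ) / (d.degree + 1) : ℝ) : ℂ) := by push_cast; rfl
      rw [h2, Complex.norm_real, Real.norm_of_nonneg (by positivity), div_le_one (by positivity)]
      have : (d i : ℝ) ≤ d.degree := by exact_mod_cast Finsupp.le_degree i d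
      linarith
    change ‖((d i + 1 : ℂ) / (d.degree + 1)) * MvPowerSeries.coeff (d + Finsupp.single i 1) g.1‖ * _ ≤ _
    rw [norm_mul]
    simp only [Function.comp, map_add, Finsupp.degree_single, pow_succ]
    calc _ ≤ 1 * ‖MvPowerSeries.coeff (d + Finsupp.single i 1) g.1‖ * r ^ d.degree := by gcongr
      _ = _ := by field_simp
  obtain ⟨G, hG⟩ : ∃ G : Fin n → HolGerm n, ∀ i, (G i).1 = H i := ⟨fun i => ⟨H i, hc i⟩, fun _ => rfl⟩
  refine ⟨G, HolGerm.ext_taylorCoeff fun d => ?_⟩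
  have hX : ∀ i, taylorCoeff d (coord i * G i) =
      ((d i : ℂ) / d.degree) * taylorCoeff d g := by
    intro i
    change MvPowerSeries.coeff d (MvPowerSeries.X i * (G i).1) = _
    rw [hG]
    by_cases hi : d i = 0
    · rw [mul_comm, MvPowerSeries.X, MvPowerSeries.coeff_mul_monomial, if_neg]
      · simp [hi]
      · intro h
        have := h i
        simp [hi] at this
    · obtain ⟨e, rfl⟩ : ∃ e, d = e + Finsupp.single i 1 :=
        ⟨d - Finsupp.single i 1, (tsub_add_cancel_of_le (by
          simpa [Finsupp.single_le_iff] using Nat.one_le_iff_ne_zero.mpr hi)).symm⟩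
      rw [mul_comm, MvPowerSeries.X, MvPowerSeries.coeff_add_mul_monomial, mul_one]
      change ((e i + 1 : ℂ) / (e.degree + 1)) * MvPowerSeries.coeff (e + Finsupp.single i 1) g.1 = _
      rw [map_add]
      simp only [Finsupp.degree_single, Finsupp.add_apply, Finsupp.single_eq_same, Nat.cast_add,
        Nat.cast_one]
      rfl
  rw [map_add, map_sum]
  simp only [hX]
  rw [← Finset.sum_mul, ← Finset.sum_div]
  by_cases hd : d = 0
  · subst hd
    have : taylorCoeff 0 (algebraMap ℂ (HolGerm n) (evalZero n g)) = evalZero n g :=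
      (evalZero n).commutes _
    rw [this, evalZero_eq]
    simp
  · have h1 : taylorCoeff d (algebraMap ℂ (HolGerm n) (evalZero n g)) = 0 := by
      change MvPowerSeries.coeff d (algebraMap ℂ (MvPowerSeries (Fin n) ℂ) _) = 0
      rw [MvPowerSeries.algebraMap_apply, MvPowerSeries.coeff_C, if_neg hd]
    have h2 : (∑ i, (d i : ℂ)) = d.degree := by
      rw [degree_eq_univ_sum]; push_cast; rfl
    have h3 : (d.degree : ℂ) ≠ 0 := by
      exact_mod_cast fun h => hd ((Finsupp.degree_eq_zero_iff d).mp h)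
    rw [h1, h2, div_self h3]
    simp

/-- Principal ideals are closed. -/
theorem mem_span_singleton_of_forall {n : ℕ} {f g : HolGerm n}
    (h : ∀ N : ℕ, ∃ q : HolGerm n, ∀ d, d.degree < N → taylorCoeff d (g - q * f) = 0) :
    g ∈ Ideal.span {f} := by
  classical
  by_cases hf : f = 0
  · subst hf
    have : g = 0 := HolGerm.ext_taylorCoeff fun d => by
      obtain ⟨q, hq⟩ := h (d.degree + 1)
      simpa using hq d (Nat.lt_succ_self _)
    rw [this]; exact zero_mem _
  · choose q hq using h
    have hf' : f.1 ≠ 0 := fun h => hf (Subtype.ext h)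
    set k := f.1.order.toNat
    have hk : (k : ℕ∞) = f.1.order := MvPowerSeries.ne_zero_iff_order_finite.mp hf'
    -- `f * (q N - q M)` vanishes to order `min N M` and orders are additive, so `q N` and `q M`
    -- agree in degrees below `min N M - k`. The coefficientwise limit `Q` is a formal quotient of
    -- `g` by `f`.
    have hstab : ∀ (d : Fin n →₀ ℕ) (N M : ℕ), d.degree + k < N → d.degree + k < M →
        taylorCoeff d (q N) = taylorCoeff d (q M) := by
      intro d N M hN hM
      have h1 : ((min N M : ℕ) : ℕ∞) ≤ (f.1 * ((q N).1 - (q M).1)).order := by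
        refine MvPowerSeries.nat_le_order fun e he => ?_
        have h2 := hq N e (he.trans_le (min_le_left _ _))
        have h3 := hq M e (he.trans_le (min_le_right _ _))
        have h4 : taylorCoeff e (f * (q N - q M)) =
            taylorCoeff e (g - q M * f) - taylorCoeff e (g - q N * f) := by
          rw [← map_sub]; congr 1; ring
        exact h4.trans (by rw [h2, h3, sub_zero])
      rw [MvPowerSeries.order_mul, ← hk] at h1
      have h5 : ((d.degree : ℕ) : ℕ∞) < ((q N).1 - (q M).1).order := by
        by_contra h6
        push Not at h6
        have h7 : ((min N M : ℕ) : ℕ∞) ≤ ((k + d.degree : ℕ) : ℕ∞) :=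
          h1.trans (by push_cast; gcongr)
        have h8 : min N M ≤ k + d.degree := by exact_mod_cast h7
        omega
      have h9 := MvPowerSeries.coeff_of_lt_order h5
      rw [map_sub, sub_eq_zero] at h9
      exact h9
    let Q : MvPowerSeries (Fin n) ℂ := fun d => taylorCoeff d (q (d.degree + k + 1))
    have hQ : f.1 * Q = g.1 := by
      apply MvPowerSeries.ext
      intro d
      set N := d.degree + k + 1
      have h1 := hq N d (by omega)
      have h2 : MvPowerSeries.coeff d g.1 = MvPowerSeries.coeff d (f.1 * (q N).1) := by
        have h3 : taylorCoeff d (g - q N * f) = taylorCoeff d g - taylorCoeff d (f * q N) := by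
          rw [map_sub, mul_comm]
        rw [h3, sub_eq_zero] at h1
        exact h1
      rw [h2, MvPowerSeries.coeff_mul, MvPowerSeries.coeff_mul]
      refine Finset.sum_congr rfl fun x hx => ?_
      congr 1
      have h4 : x.2.degree ≤ d.degree := by
        rw [← Finset.HasAntidiagonal.mem_antidiagonal.mp hx, map_add]; omega
      exact hstab x.2 _ _ (by omega) (by omega)
    have hQc : IsConvergent Q := IsConvergent.of_mul hf' f.2 (by rw [hQ]; exact g.2)
    rw [Ideal.mem_span_singleton]
    exact ⟨⟨Q, hQc⟩, Subtype.ext hQ.symm⟩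

/-- A derivation of `ℂ{x}` into `ℂ{x}/(f)` is determined by its values on the coordinates. -/
theorem derivation_quot_eq_zero {n : ℕ} {f : HolGerm n}
    (D : Derivation ℂ (HolGerm n) (HolGerm n ⧸ Ideal.span {f})) (h : ∀ i, D (coord i) = 0) :
    D = 0 := by
  -- As `D` kills constants and coordinates, Hadamard's lemma gives `D g = ∑ xᵢ D uᵢ`; every
  -- iteration raises the order of a representative by one.
  have key : ∀ (N : ℕ) (g : HolGerm n), ∃ r : HolGerm n,
      (∀ d, d.degree < N → taylorCoeff d r = 0) ∧ D g = Ideal.Quotient.mk _ r := by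
    intro N
    induction N with
    | zero =>
      intro g
      obtain ⟨r, hr⟩ := Ideal.Quotient.mk_surjective (D g)
      exact ⟨r, fun d hd => absurd hd (by omega), hr.symm⟩
    | succ N ih =>
      intro g
      obtain ⟨u, hu⟩ := exists_eq_add_sum_coord_mul g
      choose r hr hDr using fun i => ih (u i)
      refine ⟨∑ i, coord i * r i, fun d hd => ?_, ?_⟩
      · rw [map_sum]
        refine Finset.sum_eq_zero fun i _ => ?_
        change MvPowerSeries.coeff d (MvPowerSeries.X i * (r i).1) = 0
        by_cases hi : d i = 0
        · rw [mul_comm, MvPowerSeries.X, MvPowerSeries.coeff_mul_monomial, if_neg]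
          intro h
          have := h i
          simp [hi] at this
        · obtain ⟨e, rfl⟩ : ∃ e, d = e + Finsupp.single i 1 :=
            ⟨d - Finsupp.single i 1, (tsub_add_cancel_of_le (by
              simpa [Finsupp.single_le_iff] using Nat.one_le_iff_ne_zero.mpr hi)).symm⟩
          rw [mul_comm, MvPowerSeries.X, MvPowerSeries.coeff_add_mul_monomial, mul_one]
          rw [map_add, Finsupp.degree_single] at hd
          exact hr i e (by omega)
      · rw [hu, map_add, Derivation.map_algebraMap, zero_add, map_sum, map_sum]
        refine Finset.sum_congr rfl fun i _ => ?_
        rw [Derivation.leibniz, h, smul_zero, add_zero, hDr, map_mul]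
        rfl
  ext g
  obtain ⟨p, hp⟩ := Ideal.Quotient.mk_surjective (D g)
  rw [← hp, Derivation.zero_apply, Ideal.Quotient.eq_zero_iff_mem]
  refine mem_span_singleton_of_forall fun N => ?_
  obtain ⟨r, hr, hDr⟩ := key N g
  rw [← hp, Ideal.Quotient.eq, Ideal.mem_span_singleton] at hDr
  obtain ⟨q, hq⟩ := hDr
  exact ⟨q, fun d hd => by rw [← hr d hd]; congr 1; rw [mul_comm q, ← hq]; ring⟩

/-! ### Functions on `ℂⁿ × S` -/

theorem relMap_surjective {A B : ArtAlg} (n : ℕ) {φ : A →ₐ[ℂ] B} (h : Function.Surjective φ) :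
    Function.Surjective (relMap n φ) :=
  LinearMap.rTensor_surjective (HolGerm n) (g := φ.toLinearMap) h

/-- The sequence A' ×_A A'' → A' × A'' → A, whose second map is the difference, is exact in the
middle and remains so after tensoring with the flat ℂ-module 𝒪. -/
theorem exists_glue {A' A'' A : ArtAlg} {n : ℕ} (φ : A' ⟶ A) (ψ : A'' ⟶ A) (y' : RelGerm A' n)
    (y'' : RelGerm A'' n)
    (h : relMap (A := A') (B := A) n φ y' = relMap (A := A'') (B := A) n ψ y'') :
    ∃ y : RelGerm (ArtAlg.pullback φ ψ) n,
      relMap (A := ArtAlg.pullback φ ψ) (B := A') n (ArtAlg.pullbackFst φ ψ) y = y' ∧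
      relMap (A := ArtAlg.pullback φ ψ) (B := A'') n (ArtAlg.pullbackSnd φ ψ) y = y'' := by
  let φ' : A' →ₗ[ℂ] A := AlgHom.toLinearMap φ
  let ψ' : A'' →ₗ[ℂ] A := AlgHom.toLinearMap ψ
  let p : ArtAlg.pullback φ ψ →ₗ[ℂ] A' := AlgHom.toLinearMap (ArtAlg.pullbackFst φ ψ)
  let q : ArtAlg.pullback φ ψ →ₗ[ℂ] A'' := AlgHom.toLinearMap (ArtAlg.pullbackSnd φ ψ)
  have hex : Function.Exact (p.prod q) (φ'.comp (LinearMap.fst ℂ A' A'') - ψ'.comp (LinearMap.snd ℂ A' A'')) := by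
    rintro ⟨a, b⟩
    simp only [LinearMap.sub_apply, LinearMap.comp_apply, LinearMap.fst_apply, LinearMap.snd_apply,
      sub_eq_zero]
    constructor
    · intro hab
      exact ⟨⟨(a, b), hab⟩, rfl⟩
    · rintro ⟨x, hx⟩
      have ha : x.1.1 = a := congrArg Prod.fst hx
      have hb : x.1.2 = b := congrArg Prod.snd hx
      subst ha hb
      exact x.2
  have hex' := Module.Flat.rTensor_exact (HolGerm n) hex
  let t : (A' × A'') ⊗[ℂ] HolGerm n :=
    (LinearMap.inl ℂ A' A'').rTensor (HolGerm n) y' + (LinearMap.inr ℂ A' A'').rTensor (HolGerm n) y''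
  have ht : (φ'.comp (LinearMap.fst ℂ A' A'') - ψ'.comp (LinearMap.snd ℂ A' A'')).rTensor
      (HolGerm n) t = 0 := by
    simp only [t, map_add, ← LinearMap.comp_apply, ← LinearMap.rTensor_comp]
    have h1 : (φ'.comp (LinearMap.fst ℂ A' A'') - ψ'.comp (LinearMap.snd ℂ A' A'')).comp
        (LinearMap.inl ℂ A' A'') = φ' := by ext; simp
    have h2 : (φ'.comp (LinearMap.fst ℂ A' A'') - ψ'.comp (LinearMap.snd ℂ A' A'')).comp
        (LinearMap.inr ℂ A' A'') = -ψ' := by ext; simp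
    rw [h1, h2, LinearMap.rTensor_neg, LinearMap.neg_apply, add_neg_eq_zero]
    exact h
  obtain ⟨y, hy⟩ := (hex' t).mp ht
  refine ⟨y, ?_, ?_⟩
  · have h1 := congrArg ((LinearMap.fst ℂ A' A'').rTensor (HolGerm n)) hy
    simp only [t, map_add, ← LinearMap.comp_apply, ← LinearMap.rTensor_comp, LinearMap.fst_prod,
      LinearMap.fst_comp_inl, LinearMap.fst_comp_inr, LinearMap.rTensor_zero, LinearMap.rTensor_id,
      LinearMap.zero_apply, add_zero, LinearMap.id_apply] at h1
    exact h1
  · have h1 := congrArg ((LinearMap.snd ℂ A' A'').rTensor (HolGerm n)) hy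
    simp only [t, map_add, ← LinearMap.comp_apply, ← LinearMap.rTensor_comp, LinearMap.snd_prod,
      LinearMap.snd_comp_inl, LinearMap.snd_comp_inr, LinearMap.rTensor_zero, LinearMap.rTensor_id,
      LinearMap.zero_apply, zero_add, LinearMap.id_apply] at h1
    exact h1

/-- The inclusion of the fibre product into A' × A'' stays injective after tensoring with 𝒪. -/
theorem glue_ext {A' A'' A : ArtAlg} {n : ℕ} {φ : A' ⟶ A} {ψ : A'' ⟶ A}
    {y z : RelGerm (ArtAlg.pullback φ ψ) n}
    (h' : relMap (A := ArtAlg.pullback φ ψ) (B := A') n (ArtAlg.pullbackFst φ ψ) y =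
      relMap (A := ArtAlg.pullback φ ψ) (B := A') n (ArtAlg.pullbackFst φ ψ) z)
    (h'' : relMap (A := ArtAlg.pullback φ ψ) (B := A'') n (ArtAlg.pullbackSnd φ ψ) y =
      relMap (A := ArtAlg.pullback φ ψ) (B := A'') n (ArtAlg.pullbackSnd φ ψ) z) : y = z := by
  let p : ArtAlg.pullback φ ψ →ₗ[ℂ] A' := AlgHom.toLinearMap (ArtAlg.pullbackFst φ ψ)
  let q : ArtAlg.pullback φ ψ →ₗ[ℂ] A'' := AlgHom.toLinearMap (ArtAlg.pullbackSnd φ ψ)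
  have hinj : Function.Injective (p.prod q) := fun a b hab =>
    Subtype.ext (Prod.ext (congrArg Prod.fst hab) (congrArg Prod.snd hab))
  apply Module.Flat.rTensor_preserves_injective_linearMap (M := HolGerm n) _ hinj
  have hd : p.prod q = (LinearMap.inl ℂ A' A'').comp p + (LinearMap.inr ℂ A' A'').comp q := by
    ext <;> simp
  rw [hd, LinearMap.rTensor_add, LinearMap.rTensor_comp, LinearMap.rTensor_comp]
  simp only [LinearMap.add_apply, LinearMap.comp_apply]
  exact congrArg₂ (· + ·) (congrArg _ h') (congrArg _ h'')

/-- A nonzero ideal always admits a smaller `s.next`, and in an Artinian ring the descent stops. In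
the applications `P J` says that something holds up to an error in J𝒪_A, so that `P ⊥` is the exact
statement. -/
theorem SmallStep.descent {A : ArtAlg} {P : Ideal A → Prop} {J : Ideal A} (hJ : P J)
    (step : ∀ (J : Ideal A) (s : SmallStep J), P J → P s.next) : P ⊥ := by
  induction J using WellFoundedLT.induction with
  | ind J ih =>
    by_cases h : J = ⊥
    · exact h ▸ hJ
    · obtain ⟨s⟩ := SmallStep.exists h
      exact ih _ s.next_lt (step J s hJ)

theorem mem_map_bot_iff {A : ArtAlg} {n : ℕ} {y : RelGerm A n} :
    y ∈ (⊥ : Ideal A).map (algebraMap A (RelGerm A n)) ↔ y = 0 := by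
  rw [Ideal.map_bot, Ideal.mem_bot]

theorem mem_map_top {A : ArtAlg} {n : ℕ} (y : RelGerm A n) :
    y ∈ (⊤ : Ideal A).map (algebraMap A (RelGerm A n)) := by
  rw [Ideal.map_top]; trivial

theorem SmallStep.mem_next_of_slice_eq_zero {A : ArtAlg} {J : Ideal A} (s : SmallStep J) {n : ℕ}
    {y : RelGerm A n} (hy : y ∈ J.map (algebraMap A (RelGerm A n))) (h : slice s.l y = 0) :
    y ∈ s.next.map (algebraMap A (RelGerm A n)) := by
  simpa using s.sub_mem_next hy 0 (by rw [map_zero, h])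

theorem special_one_tmul (A : ArtAlg) {n : ℕ} (g : HolGerm n) :
    special A n ((1 : A) ⊗ₜ[ℂ] g) = g := by simp [special_tmul]

theorem slice_one_tmul_mul {A : ArtAlg} {n : ℕ} (l : A →ₗ[ℂ] ℂ) (g : HolGerm n) (y : RelGerm A n) :
    slice l ((1 : A) ⊗ₜ[ℂ] g * y) = g * slice l y := by
  induction y using TensorProduct.induction_on with
  | zero => simp
  | add x y hx hy => simp only [mul_add, map_add, hx, hy]
  | tmul a h => simp [slice_tmul]

theorem eq_zero_of_forall_slice {A : ArtAlg} {n : ℕ} {y : RelGerm A n}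
    (h : ∀ l : A →ₗ[ℂ] ℂ, slice l y = 0) : y = 0 :=
  mem_map_bot_iff.mp <| SmallStep.descent (P := fun J => y ∈ J.map (algebraMap A (RelGerm A n)))
    (mem_map_top y) fun _ s hy => s.mem_next_of_slice_eq_zero hy (h _)

/-- At each stage of the descent the slice of `F * z` is the product of `special A n F` with the
slice of `z`, and 𝒪 is a domain. -/
theorem eq_zero_of_mul_eq_zero {A : ArtAlg} {n : ℕ} {F z : RelGerm A n} (hF : special A n F ≠ 0)
    (h : F * z = 0) : z = 0 :=
  mem_map_bot_iff.mp <| SmallStep.descent (P := fun J => z ∈ J.map (algebraMap A (RelGerm A n)))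
    (mem_map_top z) fun _ s hz => by
      refine s.mem_next_of_slice_eq_zero hz ?_
      have h1 := congrArg (slice s.l) h
      rw [s.slice_mul hz, map_zero] at h1
      exact (mul_eq_zero.mp h1).resolve_left hF

/-! ### Flat families of hypersurfaces. -/

theorem exists_mem_special_eq {A : ArtAlg} {n : ℕ} {f : HolGerm n} {I : Ideal (RelGerm A n)}
    (hI : I.map (special A n) = Ideal.span {f}) {g : HolGerm n} (hg : g ∈ Ideal.span {f}) :
    ∃ F ∈ I, special A n F = g :=
  (Ideal.mem_map_iff_of_surjective _ (special_surjective A n)).mp (hI ▸ hg)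

theorem special_mem_of_mem {A : ArtAlg} {n : ℕ} {f : HolGerm n} {I : Ideal (RelGerm A n)}
    (hI : I.map (special A n) = Ideal.span {f}) {y : RelGerm A n} (hy : y ∈ I) :
    special A n y ∈ Ideal.span {f} :=
  hI ▸ Ideal.mem_map_of_mem _ hy

/-- A flat deformation of `V(f)` is cut out by any lift of `f` in its ideal. -/
theorem eq_span_of_flat {A : ArtAlg} {n : ℕ} {f : HolGerm n} {I : Ideal (RelGerm A n)}
    (hflat : Module.Flat A (RelGerm A n ⧸ I)) (hI : I.map (special A n) = Ideal.span {f})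
    {F : RelGerm A n} (hF : F ∈ I) (hFf : special A n F = f) : I = Ideal.span {F} := by
  refine le_antisymm (fun y hy => ?_) ((Ideal.span_singleton_le_iff_mem I).mpr hF)
  have key : ∃ c, y - c * F ∈ (⊥ : Ideal A).map (algebraMap A (RelGerm A n)) := by
    refine SmallStep.descent
      (P := fun J => ∃ c, y - c * F ∈ J.map (algebraMap A (RelGerm A n))) ⟨0, mem_map_top _⟩ ?_
    rintro J s ⟨c, hc⟩
    -- Flatness enters here: the error lies both in `I` and in J𝒪_A, so its slice is a multiple of
    -- `f`, and the multiple `s.e * k` of `F` corrects it.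
    have h1 := s.slice_mem hflat hI hc (I.sub_mem hy (I.mul_mem_left c hF))
    obtain ⟨k, hk⟩ := Ideal.mem_span_singleton.mp h1
    refine ⟨c + algebraMap A _ s.e * 1 ⊗ₜ k, ?_⟩
    have h2 := s.sub_mem_next hc (1 ⊗ₜ k * F) (by
      rw [map_mul, special_one_tmul, hFf, hk, mul_comm])
    convert h2 using 1
    ring
  obtain ⟨c, hc⟩ := key
  rw [mem_map_bot_iff, sub_eq_zero] at hc
  exact Ideal.mem_span_singleton.mpr ⟨c, by rw [hc, mul_comm]⟩

theorem map_special_span {A : ArtAlg} {n : ℕ} (F : RelGerm A n) :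
    (Ideal.span {F}).map (special A n) = Ideal.span {special A n F} := by
  rw [Ideal.map_span, Set.image_singleton]

theorem slice_mem_of_mem_baseChange {A : ArtAlg} {n : ℕ} (W : Submodule ℂ (HolGerm n))
    (l : A →ₗ[ℂ] ℂ) (t : A ⊗[ℂ] W) : slice l (W.subtype.baseChange A t) ∈ W := by
  induction t using TensorProduct.induction_on with
  | zero => simp
  | add x y hx hy => rw [map_add, map_add]; exact W.add_mem hx hy
  | tmul a w =>
    rw [LinearMap.baseChange_tmul, slice_tmul]
    exact W.smul_mem _ w.2

/-- Hypersurfaces `V(F)` whose special fibre is a divisor are flat over the base. -/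
theorem flat_quot_span {A : ArtAlg} {n : ℕ} {F : RelGerm A n} (hF : special A n F ≠ 0) :
    Module.Flat A (RelGerm A n ⧸ Ideal.span {F}) := by
  set f := special A n F
  -- A ℂ-linear complement `W` of `(f)` serves as a space of remainders for division by `F`: the map
  -- A ⊗ W → 𝒪_A/(F) turns out to be bijective, and A ⊗ W is flat over A.
  obtain ⟨W, hW⟩ := Submodule.exists_isCompl ((Ideal.span {f}).restrictScalars ℂ)
  let θ : A ⊗[ℂ] W →ₗ[A] RelGerm A n := W.subtype.baseChange A
  let Θ : A ⊗[ℂ] W →ₗ[A] RelGerm A n ⧸ Ideal.span {F} :=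
    (Ideal.Quotient.mkₐ A (Ideal.span {F})).toLinearMap ∘ₗ θ
  have hθ : Function.Injective θ := by
    have := Module.Flat.lTensor_preserves_injective_linearMap (M := A) W.subtype
      Subtype.val_injective
    exact this
  have hinj : Function.Injective Θ := by
    rw [← LinearMap.ker_eq_bot, LinearMap.ker_eq_bot']
    intro t ht
    have h1 : θ t ∈ Ideal.span {F} := Ideal.Quotient.eq_zero_iff_mem.mp ht
    obtain ⟨z, hz⟩ := Ideal.mem_span_singleton.mp h1
    have h2 : z ∈ (⊥ : Ideal A).map (algebraMap A (RelGerm A n)) := by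
      refine SmallStep.descent (P := fun J => z ∈ J.map (algebraMap A (RelGerm A n)))
        (mem_map_top z) fun J s h => s.mem_next_of_slice_eq_zero h ?_
      have h3 := slice_mem_of_mem_baseChange W s.l t
      change slice s.l (θ t) ∈ W at h3
      rw [hz, s.slice_mul h] at h3
      -- The same germ is a slice of `θ t`, hence lies in `W`, and a slice of `F * z`, hence lies in
      -- `(f)`.
      have h4 : f * slice s.l z = 0 := by
        refine Submodule.disjoint_def.mp hW.disjoint _ ?_ h3
        exact Ideal.mul_mem_right _ _ (Ideal.mem_span_singleton_self f)
      exact (mul_eq_zero.mp h4).resolve_left hF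
    rw [mem_map_bot_iff] at h2
    apply hθ
    rw [hz, h2, mul_zero, map_zero]
  have hsurj : Function.Surjective Θ := by
    intro x
    obtain ⟨y, rfl⟩ := Ideal.Quotient.mk_surjective x
    have key : ∃ t c, y - θ t - c * F ∈ (⊥ : Ideal A).map (algebraMap A (RelGerm A n)) := by
      refine SmallStep.descent
        (P := fun J => ∃ t c, y - θ t - c * F ∈ J.map (algebraMap A (RelGerm A n)))
        ⟨0, 0, mem_map_top _⟩ ?_
      rintro J s ⟨t, c, h⟩
      -- The slice of the error splits into a multiple of `f`, which corrects the quotient `c`, and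
      -- an element of `W`, which corrects the remainder `t`.
      obtain ⟨u, hu, w, hw, huw⟩ := Submodule.mem_sup.mp
        (hW.sup_eq_top.symm ▸ Submodule.mem_top :
          slice s.l (y - θ t - c * F) ∈ (Ideal.span {f}).restrictScalars ℂ ⊔ W)
      obtain ⟨k, rfl⟩ := Ideal.mem_span_singleton.mp (show u ∈ Ideal.span {f} from hu)
      refine ⟨t + s.e ⊗ₜ ⟨w, hw⟩, c + algebraMap A _ s.e * 1 ⊗ₜ k, ?_⟩
      have h2 := s.sub_mem_next h (1 ⊗ₜ k * F + 1 ⊗ₜ w) (by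
        rw [map_add, map_mul, special_one_tmul, special_one_tmul, ← huw, mul_comm])
      convert h2 using 1
      have h3 : θ (s.e ⊗ₜ ⟨w, hw⟩) = algebraMap A (RelGerm A n) s.e * 1 ⊗ₜ w := by
        simp only [θ, LinearMap.baseChange_tmul, Submodule.subtype_apply]
        simp
      rw [map_add, h3]
      ring
    obtain ⟨t, c, h⟩ := key
    rw [mem_map_bot_iff] at h
    refine ⟨t, ?_⟩
    change Ideal.Quotient.mk _ (θ t) = Ideal.Quotient.mk _ y
    rw [eq_comm, Ideal.Quotient.eq, Ideal.mem_span_singleton]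
    exact ⟨c, by linear_combination h⟩
  exact Module.Flat.of_linearEquiv (LinearEquiv.ofBijective Θ ⟨hinj, hsurj⟩).symm

/-- Homomorphisms into `𝒪_X` that lift the restriction map `ℂ{x} → 𝒪_D` are determined by the
images of the coordinates. -/
theorem algHom_quot_ext {A : ArtAlg} {n : ℕ} {f : HolGerm n} {I : Ideal (RelGerm A n)}
    (hflat : Module.Flat A (RelGerm A n ⧸ I)) (hI : I.map (special A n) = Ideal.span {f})
    {u v : HolGerm n →ₐ[ℂ] (RelGerm A n ⧸ I)}
    (hu : ∀ g, specialQuot hI.le (u g) = Ideal.Quotient.mk _ g)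
    (hv : ∀ g, specialQuot hI.le (v g) = Ideal.Quotient.mk _ g)
    (h : ∀ i, u (coord i) = v (coord i)) : u = v := by
  have key : ∀ g, ∃ y ∈ (⊥ : Ideal A).map (algebraMap A (RelGerm A n)),
      Ideal.Quotient.mk I y = u g - v g := by
    refine SmallStep.descent (P := fun J => ∀ g, ∃ y ∈ J.map (algebraMap A (RelGerm A n)),
      Ideal.Quotient.mk I y = u g - v g) (J := ⊤) (fun g => ?_) ?_
    · obtain ⟨y, hy⟩ := Ideal.Quotient.mk_surjective (u g - v g)
      exact ⟨y, mem_map_top _, hy⟩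
    · intro J s hJ
      choose y hyJ hy using hJ
      -- The representative of `u g - v g` in J𝒪_A is unique only up to `I`. By flatness its slice
      -- is well defined modulo `f`, and this makes the next map additive, ℂ-linear and a
      -- derivation.
      have hwd : ∀ z ∈ J.map (algebraMap A (RelGerm A n)), ∀ g, Ideal.Quotient.mk I z = u g - v g →
          Ideal.Quotient.mk (Ideal.span {f}) (slice s.l (y g)) = Ideal.Quotient.mk _ (slice s.l z) := by
        intro z hz g hzg
        rw [Ideal.Quotient.eq, ← map_sub]
        refine s.slice_mem hflat hI (Ideal.sub_mem _ (hyJ g) hz) ?_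
        rw [← Ideal.Quotient.eq, hy, hzg]
      let D : Derivation ℂ (HolGerm n) (HolGerm n ⧸ Ideal.span {f}) :=
        Derivation.mk'
          { toFun := fun g => Ideal.Quotient.mk _ (slice s.l (y g))
            map_add' := fun g g' => by
              rw [← map_add, ← map_add]
              refine hwd _ (Ideal.add_mem _ (hyJ g) (hyJ g')) _ ?_
              rw [map_add, hy, hy, map_add, map_add]
              ring
            map_smul' := fun c g => by
              have h1 : Ideal.Quotient.mk (Ideal.span {f}) (slice s.l (c • y g)) =
                  c • Ideal.Quotient.mk (Ideal.span {f}) (slice s.l (y g)) := by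
                rw [map_smul]; rfl
              refine (hwd (c • y g) ?_ _ ?_).trans h1
              · rw [Algebra.smul_def]; exact Ideal.mul_mem_left _ _ (hyJ g)
              · rw [map_smul u, map_smul v, ← smul_sub, ← hy]; rfl }
          (fun g g' => by
            obtain ⟨U, hU⟩ := Ideal.Quotient.mk_surjective (u g)
            obtain ⟨V, hV⟩ := Ideal.Quotient.mk_surjective (v g')
            -- This is `u g * u g' - v g * v g' = u g * (u g' - v g') + v g' * (u g - v g)`, on
            -- representatives.
            have h1 := hwd (U * y g' + V * y g)
              (Ideal.add_mem _ (Ideal.mul_mem_left _ _ (hyJ g')) (Ideal.mul_mem_left _ _ (hyJ g)))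
              (g * g') (by
                rw [map_add, map_mul, map_mul, hU, hV, hy, hy, map_mul, map_mul]
                ring)
            have h2 : Ideal.Quotient.mk (Ideal.span {f}) (special A n U) = Ideal.Quotient.mk _ g := by
              rw [← hu g, ← hU, specialQuot_mk]
            have h3 : Ideal.Quotient.mk (Ideal.span {f}) (special A n V) = Ideal.Quotient.mk _ g' := by
              rw [← hv g', ← hV, specialQuot_mk]
            rw [map_add, s.slice_mul (hyJ g'), s.slice_mul (hyJ g), map_add, map_mul, map_mul, h2,
              h3] at h1
            exact h1)
      have hD : D = 0 := derivation_quot_eq_zero D fun i =>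
        (hwd 0 (zero_mem _) (coord i) (by rw [map_zero, h, sub_self])).trans (by rw [map_zero, map_zero])
      intro g
      have h1 : Ideal.Quotient.mk (Ideal.span {f}) (slice s.l (y g)) = 0 :=
        congrArg (fun E => E g) hD
      -- Since `D = 0`, the slice lies in `(f)` and lifts to `F ∈ I`. Subtracting `s.e * F` keeps
      -- the class modulo `I` and moves the representative into the next ideal.
      obtain ⟨F, hF, hFs⟩ := exists_mem_special_eq hI (Ideal.Quotient.eq_zero_iff_mem.mp h1)
      refine ⟨_, s.sub_mem_next (hyJ g) F hFs, ?_⟩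
      rw [map_sub, hy, Ideal.Quotient.eq_zero_iff_mem.mpr (I.mul_mem_left _ hF), sub_zero]
  ext g
  obtain ⟨y, hy, hyg⟩ := key g
  rw [mem_map_bot_iff.mp hy, map_zero] at hyg
  exact (sub_eq_zero.mp hyg.symm)

/-! ### Relative vector fields as derivations -/

/-- The derivation `∑ᵢ aᵢ ∂/∂xᵢ`. -/
def fieldDer {A : ArtAlg} {n : ℕ} (a : Fin n → RelGerm A n) :
    Derivation A (RelGerm A n) (RelGerm A n) :=
  Derivation.mk'
    { toFun := fun y => ∑ i, a i * relPartialD A i y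
      map_add' := fun x y => by simp [mul_add, Finset.sum_add_distrib]
      map_smul' := fun c x => by simp [Finset.smul_sum] }
    (fun x y => by
      change ∑ i, a i * relPartialD A i (x * y) =
        x * (∑ i, a i * relPartialD A i y) + y * ∑ i, a i * relPartialD A i x
      rw [Finset.mul_sum, Finset.mul_sum, ← Finset.sum_add_distrib]
      exact Finset.sum_congr rfl fun i _ => by rw [relPartialD_mul]; ring)

theorem fieldDer_apply {A : ArtAlg} {n : ℕ} (a : Fin n → RelGerm A n) (y : RelGerm A n) :
    fieldDer a y = ∑ i, a i * relPartialD A i y := rfl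

theorem mem_relLogDer {A : ArtAlg} {n : ℕ} {I : Ideal (RelGerm A n)} {a : Fin n → RelGerm A n} :
    a ∈ relLogDer I ↔ ∀ g ∈ I, fieldDer a g ∈ I := Iff.rfl

/-- The coordinate `xₖ` on `ℂⁿ × S`. -/
def relCoord (A : ArtAlg) {n : ℕ} (k : Fin n) : RelGerm A n := (1 : A) ⊗ₜ[ℂ] coord k

theorem relPartialD_relCoord (A : ArtAlg) {n : ℕ} (i k : Fin n) :
    relPartialD A i (relCoord A k) = if i = k then 1 else 0 := by
  have h : relPartialD A i (relCoord A k) = 1 ⊗ₜ partialD i (coord k) := by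
    simp [relPartialD, relCoord]
  rw [h, partialD_coord]
  split_ifs
  · rfl
  · rw [TensorProduct.tmul_zero]

theorem fieldDer_relCoord {A : ArtAlg} {n : ℕ} (a : Fin n → RelGerm A n) (k : Fin n) :
    fieldDer a (relCoord A k) = a k := by
  simp [fieldDer_apply, relPartialD_relCoord]

theorem special_relCoord (A : ArtAlg) {n : ℕ} (k : Fin n) :
    special A n (relCoord A k) = coord k := special_one_tmul A _

theorem relMap_relCoord {A B : ArtAlg} {n : ℕ} (φ : A →ₐ[ℂ] B) (k : Fin n) :
    relMap n φ (relCoord A k) = relCoord B k := by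
  simp [relMap, relCoord]

/-- The case `f = 0` of `derivation_quot_eq_zero`. -/
theorem derivation_holGerm_eq_zero {n : ℕ} (D : Derivation ℂ (HolGerm n) (HolGerm n))
    (h : ∀ i, D (coord i) = 0) : D = 0 := by
  let q := Ideal.Quotient.mkₐ (HolGerm n) (Ideal.span {(0 : HolGerm n)})
  have h1 : q.toLinearMap.compDer D = 0 :=
    derivation_quot_eq_zero _ fun i => by
      change q (D (coord i)) = 0
      rw [h, map_zero]
  ext g
  have h2 : q (D g) = 0 := congrArg (fun E => E g) h1
  have h3 := Ideal.Quotient.eq_zero_iff_mem.mp h2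
  rw [Ideal.mem_span_singleton, zero_dvd_iff] at h3
  exact h3

/-- Every linear functional on `A` turns the restriction of `D` to 𝒪 into a ℂ-derivation of 𝒪, and
together the functionals detect zero. -/
theorem derivation_eq_zero {A : ArtAlg} {n : ℕ} (D : Derivation A (RelGerm A n) (RelGerm A n))
    (h : ∀ i, D (relCoord A i) = 0) : D = 0 := by
  have h1 : ∀ g : HolGerm n, D (1 ⊗ₜ g) = 0 := fun g => eq_zero_of_forall_slice fun l => by
    let E : Derivation ℂ (HolGerm n) (HolGerm n) :=
      Derivation.mk'
        { toFun := fun g => slice l (D (1 ⊗ₜ g))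
          map_add' := fun x y => by rw [TensorProduct.tmul_add, map_add, map_add]
          map_smul' := fun c x => by
            have h1 : (1 ⊗ₜ (c • x) : RelGerm A n) = algebraMap ℂ A c • (1 ⊗ₜ x) := by
              rw [TensorProduct.tmul_smul, algebraMap_smul]
            rw [h1, D.map_smul, algebraMap_smul, map_smul]
            rfl }
        (fun x y => by
          have h1 : (1 ⊗ₜ (x * y) : RelGerm A n) = 1 ⊗ₜ x * 1 ⊗ₜ y := by simp
          change slice l (D (1 ⊗ₜ (x * y))) = x * slice l (D (1 ⊗ₜ y)) + y * slice l (D (1 ⊗ₜ x))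
          rw [h1, Derivation.leibniz, smul_eq_mul, smul_eq_mul, map_add, slice_one_tmul_mul,
            slice_one_tmul_mul])
    have hE : E = 0 := derivation_holGerm_eq_zero E fun i => by
      change slice l (D (relCoord A i)) = 0
      rw [h, map_zero]
    exact congrArg (fun E => E g) hE
  ext y
  rw [Derivation.zero_apply]
  induction y using TensorProduct.induction_on with
  | zero => simp
  | add x y hx hy => rw [map_add, hx, hy, add_zero]
  | tmul a g =>
    have h2 : (a ⊗ₜ g : RelGerm A n) = a • (1 ⊗ₜ g) := by simp [TensorProduct.smul_tmul']
    rw [h2, D.map_smul, h1, smul_zero]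

theorem derivation_eq_fieldDer {A : ArtAlg} {n : ℕ}
    (D : Derivation A (RelGerm A n) (RelGerm A n)) :
    D = fieldDer fun i => D (relCoord A i) := by
  rw [← sub_eq_zero]
  exact derivation_eq_zero _ fun i => by
    rw [Derivation.sub_apply, fieldDer_relCoord, sub_self]

/-! ### Infinitesimal automorphisms -/

/-- The Leibniz rule makes the exponential of a nilpotent derivation multiplicative, with inverse
`exp (-D)`. The explicit sum is kept because `exists_aut` needs the expansion to first order. -/
theorem exists_algEquiv_exp {R B : Type*} [CommRing R] [CommRing B] [Algebra R B] [Algebra ℚ B]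
    (D : Derivation R B B) {k : ℕ} (hk : (D : B →ₗ[R] B) ^ k = 0) :
    ∃ Φ : B ≃ₐ[R] B, ∀ y, Φ y =
      ∑ i ∈ Finset.range k, (i.factorial : ℚ)⁻¹ • (((D : B →ₗ[R] B) ^ i) y) := by
  have hn : IsNilpotent (D : B →ₗ[R] B) := ⟨k, hk⟩
  have hmul := Module.End.exp_mul_of_derivation R B (D : B →ₗ[R] B)
    (fun x y => by simp [mul_comm]) hn
  have hsum : ∀ y, IsNilpotent.exp (D : B →ₗ[R] B) y =
      ∑ i ∈ Finset.range k, (i.factorial : ℚ)⁻¹ • (((D : B →ₗ[R] B) ^ i) y) := fun y => by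
    rw [IsNilpotent.exp_eq_sum hk, LinearMap.sum_apply]; rfl
  have hl : ∀ x, IsNilpotent.exp (-(D : B →ₗ[R] B)) (IsNilpotent.exp (D : B →ₗ[R] B) x) = x :=
    fun x => by
      rw [← LinearMap.comp_apply, ← Module.End.mul_eq_comp, hn.exp_neg_mul_exp_self]; rfl
  have hr : ∀ x, IsNilpotent.exp (D : B →ₗ[R] B) (IsNilpotent.exp (-(D : B →ₗ[R] B)) x) = x :=
    fun x => by
      rw [← LinearMap.comp_apply, ← Module.End.mul_eq_comp, hn.exp_mul_exp_neg_self]; rfl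
  let e : B ≃ₗ[R] B :=
    LinearEquiv.ofLinearMap (IsNilpotent.exp (D : B →ₗ[R] B)) (IsNilpotent.exp (-(D : B →ₗ[R] B)))
      (LinearMap.ext hr) (LinearMap.ext hl)
  have h1 : e 1 = 1 := by
    have h2 := hmul (e.symm 1) 1
    have h3 : e (e.symm 1 * 1) = e (e.symm 1) * e 1 := h2
    rw [mul_one, e.apply_symm_apply, one_mul] at h3
    exact h3.symm
  exact ⟨AlgEquiv.ofLinearEquiv e h1 hmul, hsum⟩

theorem aut_mem_map {A : ArtAlg} {n : ℕ} (Φ : RelGerm A n ≃ₐ[A] RelGerm A n) {J : Ideal A}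
    {y : RelGerm A n} (hy : y ∈ J.map (algebraMap A (RelGerm A n))) :
    Φ y ∈ J.map (algebraMap A (RelGerm A n)) := by
  have h : J.map (algebraMap A (RelGerm A n)) ≤
      (J.map (algebraMap A (RelGerm A n))).comap Φ := by
    rw [Ideal.map_le_iff_le_comap]
    intro j hj
    rw [Ideal.mem_comap, Ideal.mem_comap, AlgEquiv.commutes]
    exact Ideal.mem_map_of_mem _ hj
  exact h hy

/-- Coordinates can be changed by arbitrary infinitesimal amounts. -/
theorem exists_aut {A : ArtAlg} {n : ℕ} (y : Fin n → RelGerm A n)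
    (hy : ∀ i, special A n (y i) = coord i) :
    ∃ Φ : RelGerm A n ≃ₐ[A] RelGerm A n,
      (∀ z, special A n (Φ z) = special A n z) ∧ ∀ i, Φ (relCoord A i) = y i := by
  suffices h : (⊥ : Ideal A) ≤ IsLocalRing.maximalIdeal A ∧
      ∃ Φ : RelGerm A n ≃ₐ[A] RelGerm A n, (∀ z, special A n (Φ z) = special A n z) ∧
        ∀ i, y i - Φ (relCoord A i) ∈ (⊥ : Ideal A).map (algebraMap A (RelGerm A n)) by
    obtain ⟨-, Φ, h1, h2⟩ := h
    exact ⟨Φ, h1, fun i => (sub_eq_zero.mp (mem_map_bot_iff.mp (h2 i))).symm⟩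
  -- The descent starts with the identity and the maximal ideal. Staying below the maximal ideal
  -- makes `s.e` nilpotent and puts its square in `s.next`.
  refine SmallStep.descent (P := fun J => J ≤ IsLocalRing.maximalIdeal A ∧
      ∃ Φ : RelGerm A n ≃ₐ[A] RelGerm A n, (∀ z, special A n (Φ z) = special A n z) ∧
        ∀ i, y i - Φ (relCoord A i) ∈ J.map (algebraMap A (RelGerm A n)))
    ⟨le_rfl, AlgEquiv.refl, fun _ => rfl, fun i => mem_baseMaximal_of_special ?_⟩ ?_
  · rw [AlgEquiv.coe_refl, id, map_sub, hy, special_relCoord, sub_self]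
  · rintro J s ⟨hJ, Φ, hΦ, hJy⟩
    refine ⟨s.next_lt.le.trans hJ, ?_⟩
    -- The vector field whose coefficients are the leading errors of `Φ` on the coordinates. To
    -- first order `exp (s.e • D₀)` adds exactly `s.e` times these errors.
    let D₀ : Derivation A (RelGerm A n) (RelGerm A n) :=
      fieldDer fun i => 1 ⊗ₜ slice s.l (y i - Φ (relCoord A i))
    obtain ⟨k, hk⟩ : IsNilpotent s.e := by
      have h1 := (IsArtinianRing.isNilpotent_jacobson_bot (R := A))
      obtain ⟨k, hk⟩ := h1
      refine ⟨k, ?_⟩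
      rw [IsLocalRing.jacobson_eq_maximalIdeal _ bot_ne_top] at hk
      have h2 := Ideal.pow_mem_pow (hJ s.e_mem) k
      rw [hk] at h2
      exact h2
    have hpow : ∀ i, ((s.e • D₀ : Derivation A (RelGerm A n) (RelGerm A n)) :
        RelGerm A n →ₗ[A] RelGerm A n) ^ i = s.e ^ i • (D₀ : RelGerm A n →ₗ[A] RelGerm A n) ^ i := by
      intro i
      rw [Derivation.coe_smul_linearMap, smul_pow]
    let _ : Algebra ℚ (RelGerm A n) :=
      ((algebraMap ℂ (RelGerm A n)).comp (algebraMap ℚ ℂ)).toAlgebra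
    -- `k` would already suffice for nilpotency; the two additional terms let the constant and
    -- linear parts be split off even for small `k`.
    obtain ⟨Ψ, hΨ⟩ := exists_algEquiv_exp (s.e • D₀) (k := k + 2)
      (by rw [hpow, pow_add, hk, zero_mul, zero_smul])
    have hee : s.e ^ 2 ∈ s.next := by
      refine ⟨J.pow_mem_of_mem s.e_mem 2 two_pos, ?_⟩
      rw [pow_two, s.l_mul _ _ s.e_mem, (A.aug_eq_zero_iff _).mpr (hJ s.e_mem), zero_mul]
    have hΨ2 : ∀ z, Ψ z - (z + algebraMap A (RelGerm A n) s.e * D₀ z) ∈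
        s.next.map (algebraMap A (RelGerm A n)) := by
      intro z
      rw [hΨ, Finset.sum_range_succ', Finset.sum_range_succ']
      have h1 : ∀ a b c : RelGerm A n, a + b + c - (c + b) = a := fun a b c => by ring
      have h2 : (((0 + 1).factorial : ℚ)⁻¹ • (((s.e • D₀ : Derivation A (RelGerm A n) (RelGerm A n)) :
        RelGerm A n →ₗ[A] RelGerm A n) ^ (0 + 1)) z) = algebraMap A (RelGerm A n) s.e * D₀ z := by
        rw [hpow]
        simp [Algebra.smul_def s.e]
      have h3 : (((0).factorial : ℚ)⁻¹ • (((s.e • D₀ : Derivation A (RelGerm A n) (RelGerm A n)) :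
        RelGerm A n →ₗ[A] RelGerm A n) ^ 0) z) = z := by simp
      rw [h2, h3, h1]
      refine Ideal.sum_mem _ fun i _ => ?_
      rw [Algebra.smul_def, hpow, LinearMap.smul_apply, Algebra.smul_def (s.e ^ _), add_assoc, pow_add,
        map_mul]
      exact Ideal.mul_mem_left _ _ (Ideal.mul_mem_right _ _ (Ideal.mul_mem_left _ _
        (Ideal.mem_map_of_mem _ hee)))
    -- The new automorphism is `Φ ∘ Ψ`. Applying `Φ` to the correction is harmless: `Φ` fixes `s.e`
    -- and does not change the special fibre of the coefficients.
    refine ⟨Ψ.trans Φ, fun z => ?_, fun i => ?_⟩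
    · rw [AlgEquiv.trans_apply, hΦ]
      have h1 : Ψ z - (z + algebraMap A (RelGerm A n) s.e * D₀ z) ∈ baseMaximal A n :=
        Ideal.map_mono (s.next_lt.le.trans hJ) (hΨ2 z)
      have h2 := special_eq_zero_of_mem h1
      have h3 : special A n (algebraMap A (RelGerm A n) s.e) = 0 :=
        special_eq_zero_of_mem (Ideal.mem_map_of_mem _ (hJ s.e_mem))
      rw [map_sub, map_add, map_mul, h3, zero_mul, add_zero, sub_eq_zero] at h2
      exact h2
    · have h1 := aut_mem_map Φ (hΨ2 (relCoord A i))
      rw [fieldDer_relCoord, map_sub, map_add, map_mul, AlgEquiv.commutes] at h1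
      have h2 := s.sub_mem_next (hJy i) (Φ (1 ⊗ₜ slice s.l (y i - Φ (relCoord A i))))
        (by rw [hΦ, special_one_tmul])
      have h3 := Ideal.sub_mem _ h2 h1
      rw [AlgEquiv.trans_apply]
      convert h3 using 1
      ring

/-- Automorphisms of `ℂⁿ × S` over `S` that restrict to the identity on the special fibre. -/
def IsInfinitesimal {A : ArtAlg} {n : ℕ} (Θ : RelGerm A n ≃ₐ[A] RelGerm A n) : Prop :=
  ∀ z, special A n (Θ z) = special A n z

/-! ### Transport of fields and deformations by ambient automorphisms. -/

theorem IsInfinitesimal.symm {A : ArtAlg} {n : ℕ} {Θ : RelGerm A n ≃ₐ[A] RelGerm A n}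
    (h : IsInfinitesimal Θ) : IsInfinitesimal Θ.symm := fun z => by
  rw [← h, AlgEquiv.apply_symm_apply]

/-- The image of a vector field under the inverse of the automorphism `Θ`. -/
def pullField {A : ArtAlg} {n : ℕ} (Θ : RelGerm A n ≃ₐ[A] RelGerm A n) (a : Fin n → RelGerm A n) :
    Fin n → RelGerm A n := fun j => Θ.symm (fieldDer a (Θ (relCoord A j)))

/-- The conjugate of a derivation by `Θ` is again a derivation, and an `A`-derivation is determined
by its values on the coordinates. -/
theorem fieldDer_pullField {A : ArtAlg} {n : ℕ} (Θ : RelGerm A n ≃ₐ[A] RelGerm A n)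
    (a : Fin n → RelGerm A n) (y : RelGerm A n) :
    fieldDer (pullField Θ a) y = Θ.symm (fieldDer a (Θ y)) := by
  let D : Derivation A (RelGerm A n) (RelGerm A n) :=
    Derivation.mk' (Θ.symm.toLinearMap ∘ₗ (fieldDer a).toLinearMap ∘ₗ Θ.toLinearMap) fun x y => by
      change Θ.symm (fieldDer a (Θ (x * y))) =
        x * Θ.symm (fieldDer a (Θ y)) + y * Θ.symm (fieldDer a (Θ x))
      rw [map_mul, Derivation.leibniz, map_add, smul_eq_mul, smul_eq_mul, map_mul, map_mul,
        AlgEquiv.symm_apply_apply, AlgEquiv.symm_apply_apply]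
  exact (congrArg (fun E => E y) (derivation_eq_fieldDer D)).symm

theorem pullField_mem {A : ArtAlg} {n : ℕ} (Θ : RelGerm A n ≃ₐ[A] RelGerm A n)
    {I : Ideal (RelGerm A n)} {a : Fin n → RelGerm A n} (ha : a ∈ relLogDer I) :
    pullField Θ a ∈ relLogDer (I.comap Θ) := by
  rw [mem_relLogDer]
  intro g hg
  rw [fieldDer_pullField, Ideal.mem_comap, AlgEquiv.apply_symm_apply]
  exact mem_relLogDer.mp ha _ hg

theorem special_fieldDer {A : ArtAlg} {n : ℕ} (a : Fin n → RelGerm A n) (y : RelGerm A n) :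
    special A n (fieldDer a y) = ∑ i, special A n (a i) * partialD i (special A n y) := by
  rw [fieldDer_apply, map_sum]
  simp only [map_mul, special_relPartialD]

theorem specialField_pullField {A : ArtAlg} {n : ℕ} {Θ : RelGerm A n ≃ₐ[A] RelGerm A n}
    (h : IsInfinitesimal Θ) (a : Fin n → RelGerm A n) :
    specialField A (pullField Θ a) = specialField A a := by
  funext j
  rw [specialField, specialField, pullField, h.symm, special_fieldDer, h, special_relCoord]
  simp [partialD_coord]

theorem comap_algEquiv_map {A : ArtAlg} {n : ℕ} (Θ : RelGerm A n ≃ₐ[A] RelGerm A n)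
    (I : Ideal (RelGerm A n)) : I = (I.comap Θ).map Θ.toRingEquiv := by
  symm
  exact Ideal.map_comap_of_surjective (Θ : RelGerm A n →+* RelGerm A n) Θ.surjective I

/-- The isomorphism of `V(Θ⁻¹ I)` with `V(I)` induced by `Θ`. -/
def comapQuotEquiv {A : ArtAlg} {n : ℕ} (Θ : RelGerm A n ≃ₐ[A] RelGerm A n)
    (I : Ideal (RelGerm A n)) : (RelGerm A n ⧸ I.comap Θ) ≃ₐ[A] (RelGerm A n ⧸ I) :=
  Ideal.quotientEquivAlg (I.comap Θ) I Θ (comap_algEquiv_map Θ I)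

theorem comapQuotEquiv_mk {A : ArtAlg} {n : ℕ} (Θ : RelGerm A n ≃ₐ[A] RelGerm A n)
    (I : Ideal (RelGerm A n)) (y : RelGerm A n) :
    comapQuotEquiv Θ I (Ideal.Quotient.mk _ y) = Ideal.Quotient.mk _ (Θ y) := rfl

theorem comap_fibre {A : ArtAlg} {n : ℕ} {f : HolGerm n} {I : Ideal (RelGerm A n)}
    (hI : I.map (special A n) = Ideal.span {f}) {Θ : RelGerm A n ≃ₐ[A] RelGerm A n}
    (hΘ : IsInfinitesimal Θ) : (I.comap Θ).map (special A n) = Ideal.span {f} := by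
  apply le_antisymm
  · rw [Ideal.map_le_iff_le_comap]
    intro y hy
    rw [Ideal.mem_comap, ← hΘ]
    exact special_mem_of_mem hI hy
  · rw [Ideal.span_singleton_le_iff_mem]
    obtain ⟨F, hF, hFf⟩ := exists_mem_special_eq hI (Ideal.mem_span_singleton_self f)
    rw [← hFf, ← hΘ.symm]
    refine Ideal.mem_map_of_mem _ ?_
    rw [Ideal.mem_comap, AlgEquiv.apply_symm_apply]
    exact hF

theorem IsAdmissible.comap {A : ArtAlg} {n : ℕ} {f : HolGerm n} {I : Ideal (RelGerm A n)}
    (hI : IsAdmissible f A I) {Θ : RelGerm A n ≃ₐ[A] RelGerm A n} (hΘ : IsInfinitesimal Θ) :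
    IsAdmissible f A (I.comap Θ) := by
  have := hI.flat
  refine IsAdmissible.of_lift (Module.Flat.of_linearEquiv (comapQuotEquiv Θ I).toLinearEquiv)
    (comap_fibre hI.fibre hΘ) fun d hd => ?_
  obtain ⟨a, ha, rfl⟩ := hI.image.symm ▸ (show d ∈ (logDer f : Set (Fin n → HolGerm n)) from hd)
  exact ⟨_, pullField_mem Θ ha, specialField_pullField hΘ a⟩

theorem IsAdmissible.comap_defIso {A : ArtAlg} {n : ℕ} {f : HolGerm n} {I : Ideal (RelGerm A n)}
    (hI : IsAdmissible f A I) {Θ : RelGerm A n ≃ₐ[A] RelGerm A n} (hΘ : IsInfinitesimal Θ) :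
    DefIso (hI.comap hΘ) hI := by
  refine ⟨comapQuotEquiv Θ I, fun x => ?_⟩
  obtain ⟨y, rfl⟩ := Ideal.Quotient.mk_surjective x
  rw [comapQuotEquiv_mk, specialQuot_mk, specialQuot_mk, hΘ]

/-- Isomorphisms of deformations are induced by automorphisms of the ambient space. -/
theorem DefIso.exists_aut {A : ArtAlg} {n : ℕ} {f : HolGerm n} {I J : Ideal (RelGerm A n)}
    {hI : IsAdmissible f A I} {hJ : IsAdmissible f A J} (h : DefIso hI hJ) :
    ∃ Θ : RelGerm A n ≃ₐ[A] RelGerm A n, IsInfinitesimal Θ ∧ I = J.comap Θ := by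
  obtain ⟨e, he⟩ := h
  -- A lift of the image of `xᵢ` under `e` restricts to `xᵢ` only modulo `f`; subtracting an element
  -- of `J` makes the restriction exact, as `exists_aut` requires.
  have hy : ∀ i : Fin n, ∃ y, special A n y = coord i ∧
      Ideal.Quotient.mk J y = e (Ideal.Quotient.mk I (relCoord A i)) := by
    intro i
    obtain ⟨y₀, hy₀⟩ := Ideal.Quotient.mk_surjective (e (Ideal.Quotient.mk I (relCoord A i)))
    have h1 := he (Ideal.Quotient.mk I (relCoord A i))
    rw [← hy₀, specialQuot_mk, specialQuot_mk, special_relCoord, Ideal.Quotient.eq] at h1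
    obtain ⟨F, hF, hFs⟩ := exists_mem_special_eq hJ.fibre h1
    refine ⟨y₀ - F, by rw [map_sub, hFs, sub_sub_cancel], ?_⟩
    rw [map_sub, hy₀, Ideal.Quotient.eq_zero_iff_mem.mpr hF, sub_zero]
  choose y hys hye using hy
  obtain ⟨Θ, hΘ, hΘx⟩ := _root_.exists_aut y hys
  let u : HolGerm n →ₐ[ℂ] (RelGerm A n ⧸ J) :=
    (((Ideal.Quotient.mkₐ A J).comp Θ.toAlgHom).restrictScalars ℂ).comp
      Algebra.TensorProduct.includeRight
  let v : HolGerm n →ₐ[ℂ] (RelGerm A n ⧸ J) :=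
    ((e.toAlgHom.comp (Ideal.Quotient.mkₐ A I)).restrictScalars ℂ).comp
      Algebra.TensorProduct.includeRight
  -- `Θ` followed by the projection and the projection followed by `e` agree on coordinates, hence
  -- on 𝒪 and by `A`-linearity on 𝒪_A. Comparing kernels then gives `I = J.comap Θ`.
  have huv : u = v := algHom_quot_ext hJ.flat hJ.fibre
    (fun g => by
      change specialQuot hJ.fibre.le (Ideal.Quotient.mk J (Θ (1 ⊗ₜ g))) = _
      rw [specialQuot_mk, hΘ, special_one_tmul])
    (fun g => by
      change specialQuot hJ.fibre.le (e (Ideal.Quotient.mk I (1 ⊗ₜ g))) = _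
      rw [he, specialQuot_mk, special_one_tmul])
    (fun i => by
      change Ideal.Quotient.mk J (Θ (relCoord A i)) = e (Ideal.Quotient.mk I (relCoord A i))
      rw [hΘx, hye])
  have hall : ∀ z, Ideal.Quotient.mk J (Θ z) = e (Ideal.Quotient.mk I z) := by
    have : (Ideal.Quotient.mkₐ A J).comp Θ.toAlgHom = e.toAlgHom.comp (Ideal.Quotient.mkₐ A I) :=
      Algebra.TensorProduct.ext (by ext) huv
    exact fun z => congrArg (fun E => E z) this
  refine ⟨Θ, hΘ, Ideal.ext fun z => ?_⟩
  rw [Ideal.mem_comap, ← Ideal.Quotient.eq_zero_iff_mem, ← Ideal.Quotient.eq_zero_iff_mem, hall]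
  exact (map_eq_zero_iff e e.injective).symm

/-- The case `f = 0`, `I = ⊥` of `algHom_quot_ext`. -/
theorem algHom_relGerm_ext {A : ArtAlg} {n : ℕ} {u v : HolGerm n →ₐ[ℂ] RelGerm A n}
    (hu : ∀ g, special A n (u g) = g) (hv : ∀ g, special A n (v g) = g)
    (h : ∀ i, u (coord i) = v (coord i)) : u = v := by
  have h0 : (⊥ : Ideal (RelGerm A n)).map (special A n) = Ideal.span {(0 : HolGerm n)} := by
    rw [Ideal.map_bot, Ideal.span_singleton_eq_bot.mpr rfl]
  let q := AlgEquiv.quotientBot A (RelGerm A n)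
  have hflat : Module.Flat A (RelGerm A n ⧸ (⊥ : Ideal (RelGerm A n))) :=
    Module.Flat.of_linearEquiv q.toLinearEquiv
  let m := Ideal.Quotient.mkₐ ℂ (⊥ : Ideal (RelGerm A n))
  have huv : m.comp u = m.comp v := algHom_quot_ext hflat h0
    (fun g => by
      change specialQuot h0.le (Ideal.Quotient.mk _ (u g)) = _
      rw [specialQuot_mk, hu])
    (fun g => by
      change specialQuot h0.le (Ideal.Quotient.mk _ (v g)) = _
      rw [specialQuot_mk, hv])
    (fun i => by rw [AlgHom.comp_apply, AlgHom.comp_apply, h])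
  ext g
  have h1 : Ideal.Quotient.mk (⊥ : Ideal (RelGerm A n)) (u g) = Ideal.Quotient.mk _ (v g) :=
    congrArg (fun E => E g) huv
  rwa [Ideal.Quotient.eq, Ideal.mem_bot, sub_eq_zero] at h1

/-! ### Ambient automorphisms and base change. -/

theorem relMap_algebraMap {A B : ArtAlg} {n : ℕ} (φ : A →ₐ[ℂ] B) (a : A) :
    relMap n φ (algebraMap A (RelGerm A n) a) = algebraMap B (RelGerm B n) (φ a) := by
  simp [relMap, Algebra.TensorProduct.algebraMap_apply]

/-- Infinitesimal automorphisms lift, with prescribed lifts of the images of the coordinates. -/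
theorem IsInfinitesimal.exists_lift {A B : ArtAlg} {n : ℕ} (ψ : B →ₐ[ℂ] A)
    {Θ : RelGerm A n ≃ₐ[A] RelGerm A n} (hΘ : IsInfinitesimal Θ) (y : Fin n → RelGerm B n)
    (hy : ∀ i, relMap n ψ (y i) = Θ (relCoord A i)) :
    ∃ Θ' : RelGerm B n ≃ₐ[B] RelGerm B n, IsInfinitesimal Θ' ∧ (∀ i, Θ' (relCoord B i) = y i) ∧
      ∀ z, relMap n ψ (Θ' z) = Θ (relMap n ψ z) := by
  obtain ⟨Θ', hΘ', hx⟩ := exists_aut y fun i => by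
    rw [← special_relMap ψ, hy, hΘ, special_relCoord]
  refine ⟨Θ', hΘ', hx, fun z => ?_⟩
  have h1 : ((relMap n ψ).comp (Θ'.toAlgHom.restrictScalars ℂ)).comp
      (Algebra.TensorProduct.includeRight : HolGerm n →ₐ[ℂ] RelGerm B n) =
      ((Θ.toAlgHom.restrictScalars ℂ).comp (relMap n ψ)).comp
      (Algebra.TensorProduct.includeRight : HolGerm n →ₐ[ℂ] RelGerm B n) :=
    algHom_relGerm_ext
      (fun g => by
        change special A n (relMap n ψ (Θ' (1 ⊗ₜ g))) = g
        rw [special_relMap, hΘ', special_one_tmul])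
      (fun g => by
        change special A n (Θ (relMap n ψ (1 ⊗ₜ g))) = g
        rw [hΘ, special_relMap, special_one_tmul])
      (fun i => by
        change relMap n ψ (Θ' (relCoord B i)) = Θ (relMap n ψ (relCoord B i))
        rw [hx, hy, relMap_relCoord])
  induction z using TensorProduct.induction_on with
  | zero => simp
  | add x y hx hy => simp only [map_add, hx, hy]
  | tmul b g =>
    have h2 : (b ⊗ₜ g : RelGerm B n) = algebraMap B (RelGerm B n) b * 1 ⊗ₜ g := by
      simp [Algebra.TensorProduct.algebraMap_apply]
    have h3 : relMap n ψ (Θ' (1 ⊗ₜ g)) = Θ (relMap n ψ (1 ⊗ₜ g)) := congrArg (fun E => E g) h1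
    rw [h2, map_mul, map_mul, map_mul, map_mul, AlgEquiv.commutes, relMap_algebraMap,
      AlgEquiv.commutes, h3]

theorem mem_map_relMap {A B : ArtAlg} {n : ℕ} {ψ : B →ₐ[ℂ] A} (hψ : Function.Surjective ψ)
    {I : Ideal (RelGerm B n)} {y : RelGerm A n} :
    y ∈ I.map (relMap n ψ) ↔ ∃ x ∈ I, relMap n ψ x = y :=
  Ideal.mem_map_iff_of_surjective _ (relMap_surjective n hψ)

theorem map_relMap_comap {A B : ArtAlg} {n : ℕ} {ψ : B →ₐ[ℂ] A} (hψ : Function.Surjective ψ)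
    {Θ : RelGerm A n ≃ₐ[A] RelGerm A n} {Θ' : RelGerm B n ≃ₐ[B] RelGerm B n}
    (h : ∀ z, relMap n ψ (Θ' z) = Θ (relMap n ψ z)) (I : Ideal (RelGerm B n)) :
    (I.comap Θ').map (relMap n ψ) = (I.map (relMap n ψ)).comap Θ := by
  ext y
  rw [mem_map_relMap hψ, Ideal.mem_comap, mem_map_relMap hψ]
  constructor
  · rintro ⟨x, hx, rfl⟩
    exact ⟨Θ' x, hx, h x⟩
  · rintro ⟨x, hx, hxy⟩
    refine ⟨Θ'.symm x, by rwa [Ideal.mem_comap, AlgEquiv.apply_symm_apply], Θ.injective ?_⟩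
    rw [← h, AlgEquiv.apply_symm_apply, hxy]

/-! ### Gluing deformations -/

/-- Restriction of relative vector fields along a morphism of bases. -/
def mapField {A B : ArtAlg} {n : ℕ} (φ : A →ₐ[ℂ] B) (a : Fin n → RelGerm A n) :
    Fin n → RelGerm B n := fun i => relMap n φ (a i)

theorem relMap_fieldDer {A B : ArtAlg} {n : ℕ} (φ : A →ₐ[ℂ] B) (a : Fin n → RelGerm A n)
    (y : RelGerm A n) : relMap n φ (fieldDer a y) = fieldDer (mapField φ a) (relMap n φ y) := by
  simp only [fieldDer_apply, map_sum, map_mul, relMap_relPartialD, mapField]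

/-- Logarithmic fields of an admissible deformation lift along surjections of the base algebra. -/
theorem IsAdmissible.exists_lift_field {A B : ArtAlg} {n : ℕ} {f : HolGerm n}
    {I : Ideal (RelGerm B n)} (h : IsAdmissible f B I) {ψ : B →ₐ[ℂ] A}
    (hψ : Function.Surjective ψ) {a : Fin n → RelGerm A n}
    (ha : a ∈ relLogDer (I.map (relMap n ψ))) : ∃ b ∈ relLogDer I, mapField ψ b = a := by
  -- `N` consists of the fields that lift. It already restricts onto Der(-log D), so the
  -- Nakayama-type lemma `mem_smul_of_lift`, applied with `J = ⊤`, shows that it contains every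
  -- logarithmic field.
  let N : Submodule (RelGerm A n) (Fin n → RelGerm A n) :=
    { carrier := {a | ∃ b ∈ relLogDer I, mapField ψ b = a}
      zero_mem' := ⟨0, zero_mem _, funext fun i => map_zero _⟩
      add_mem' := by
        rintro _ _ ⟨b, hb, rfl⟩ ⟨c, hc, rfl⟩
        exact ⟨b + c, add_mem hb hc, funext fun i => map_add ..⟩
      smul_mem' := by
        rintro r _ ⟨b, hb, rfl⟩
        obtain ⟨r, rfl⟩ := relMap_surjective n hψ r
        exact ⟨r • b, Submodule.smul_mem _ r hb, funext fun i => map_mul ..⟩ }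
  have hN : N ≤ relLogDer (I.map (relMap n ψ)) := by
    rintro _ ⟨b, hb, rfl⟩
    exact relMap_mem_relLogDer ψ hb
  have h' := h.map ψ
  have h1 := mem_smul_of_lift h'.flat h'.fibre hN (fun d hd => by
    obtain ⟨b, hb, rfl⟩ := h.image.symm ▸ (show d ∈ (logDer f : Set (Fin n → HolGerm n)) from hd)
    exact ⟨_, ⟨b, hb, rfl⟩, specialField_relMap ψ b⟩) ⊤ a ha fun i => mem_map_top _
  exact Submodule.smul_le_right h1

/-- `𝒪_{ℂⁿ×S} → 𝒪_{ℂⁿ×S'}` for the first projection of a fibre product. -/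
abbrev relFst {A' A'' A : ArtAlg} (n : ℕ) (φ : A' ⟶ A) (ψ : A'' ⟶ A) :
    RelGerm (ArtAlg.pullback φ ψ) n →ₐ[ℂ] RelGerm A' n :=
  relMap (A := ArtAlg.pullback φ ψ) (B := A') n (ArtAlg.pullbackFst φ ψ)

/-- `𝒪_{ℂⁿ×S} → 𝒪_{ℂⁿ×S''}` for the second projection of a fibre product. -/
abbrev relSnd {A' A'' A : ArtAlg} (n : ℕ) (φ : A' ⟶ A) (ψ : A'' ⟶ A) :
    RelGerm (ArtAlg.pullback φ ψ) n →ₐ[ℂ] RelGerm A'' n :=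
  relMap (A := ArtAlg.pullback φ ψ) (B := A'') n (ArtAlg.pullbackSnd φ ψ)

theorem relMap_relFst {A' A'' A : ArtAlg} {n : ℕ} (φ : A' ⟶ A) (ψ : A'' ⟶ A)
    (y : RelGerm (ArtAlg.pullback φ ψ) n) :
    relMap (A := A') (B := A) n φ (relFst n φ ψ y) =
      relMap (A := A'') (B := A) n ψ (relSnd n φ ψ y) := by
  induction y using TensorProduct.induction_on with
  | zero => simp only [map_zero]
  | add x y hx hy => simp only [map_add, hx, hy]
  | tmul a g =>
    simp only [relFst, relSnd, relMap, Algebra.TensorProduct.map_tmul]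
    congr 1
    exact a.2

/-- Membership in the ideal of a flat deformation over a fibre product can be checked on the
factors. -/
theorem mem_of_relFst_mem_of_relSnd_mem {A' A'' A : ArtAlg} {n : ℕ} {f : HolGerm n} (hf : f ≠ 0)
    {φ : A' ⟶ A} {ψ : A'' ⟶ A} {I : Ideal (RelGerm (ArtAlg.pullback φ ψ) n)}
    (hflat : Module.Flat (ArtAlg.pullback φ ψ) (RelGerm (ArtAlg.pullback φ ψ) n ⧸ I))
    (hI : I.map (special _ n) = Ideal.span {f}) {y : RelGerm (ArtAlg.pullback φ ψ) n}
    (h' : relFst n φ ψ y ∈ I.map (relFst n φ ψ)) (h'' : relSnd n φ ψ y ∈ I.map (relSnd n φ ψ)) :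
    y ∈ I := by
  obtain ⟨F, hF, hFf⟩ := exists_mem_special_eq hI (Ideal.mem_span_singleton_self f)
  rw [eq_span_of_flat hflat hI hF hFf] at h' h'' ⊢
  rw [Ideal.map_span, Set.image_singleton, Ideal.mem_span_singleton] at h' h''
  obtain ⟨c', hc'⟩ := h'
  obtain ⟨c'', hc''⟩ := h''
  have h1 := relMap_relFst φ ψ y
  rw [hc', hc'', map_mul, map_mul, ← relMap_relFst φ ψ F, ← sub_eq_zero, ← mul_sub] at h1
  -- The restriction of `F` to `A` is a nonzerodivisor because its special fibre is `f ≠ 0`, so the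
  -- two cofactors agree over `A` and glue.
  have h2 := eq_zero_of_mul_eq_zero
    (by rw [special_relMap, special_relMap, hFf]; exact hf) h1
  obtain ⟨c, hcf, hcs⟩ := exists_glue φ ψ c' c'' (sub_eq_zero.mp h2)
  rw [Ideal.mem_span_singleton]
  refine ⟨c, glue_ext ?_ ?_⟩
  · rw [map_mul, hcf]; exact hc'
  · rw [map_mul, hcs]; exact hc''

/-- Vector fields over a fibre product can be glued. -/
theorem exists_glue_field {A' A'' A : ArtAlg} {n : ℕ} (φ : A' ⟶ A) (ψ : A'' ⟶ A)
    {a' : Fin n → RelGerm A' n} {a'' : Fin n → RelGerm A'' n}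
    (h : mapField (A := A') (B := A) φ a' = mapField (A := A'') (B := A) ψ a'') :
    ∃ a : Fin n → RelGerm (ArtAlg.pullback φ ψ) n,
      (∀ i, relFst n φ ψ (a i) = a' i) ∧ ∀ i, relSnd n φ ψ (a i) = a'' i := by
  choose a h1 h2 using fun i => exists_glue φ ψ (a' i) (a'' i) (congrFun h i)
  exact ⟨a, h1, h2⟩

theorem mem_relLogDer_of_factors {A' A'' A : ArtAlg} {n : ℕ} {f : HolGerm n} (hf : f ≠ 0)
    {φ : A' ⟶ A} {ψ : A'' ⟶ A} {I : Ideal (RelGerm (ArtAlg.pullback φ ψ) n)}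
    (hflat : Module.Flat (ArtAlg.pullback φ ψ) (RelGerm (ArtAlg.pullback φ ψ) n ⧸ I))
    (hI : I.map (special _ n) = Ideal.span {f}) {a : Fin n → RelGerm (ArtAlg.pullback φ ψ) n}
    (h' : (fun i => relFst n φ ψ (a i)) ∈ relLogDer (I.map (relFst n φ ψ)))
    (h'' : (fun i => relSnd n φ ψ (a i)) ∈ relLogDer (I.map (relSnd n φ ψ))) :
    a ∈ relLogDer I := by
  rw [mem_relLogDer]
  intro g hg
  refine mem_of_relFst_mem_of_relSnd_mem hf hflat hI ?_ ?_
  · rw [relFst, relMap_fieldDer]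
    exact mem_relLogDer.mp h' _ (Ideal.mem_map_of_mem _ hg)
  · rw [relSnd, relMap_fieldDer]
    exact mem_relLogDer.mp h'' _ (Ideal.mem_map_of_mem _ hg)

/-- Admissible deformations that agree over `A` can be glued. -/
theorem IsAdmissible.exists_glue {A' A'' A : ArtAlg} {n : ℕ} {f : HolGerm n} (hf : f ≠ 0)
    {φ : A' ⟶ A} {ψ : A'' ⟶ A} (hψ : Function.Surjective (show A'' →ₐ[ℂ] A from ψ))
    {I' : Ideal (RelGerm A' n)} {I'' : Ideal (RelGerm A'' n)} (hI' : IsAdmissible f A' I')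
    (hI'' : IsAdmissible f A'' I'')
    (h : I'.map (relMap (A := A') (B := A) n φ) = I''.map (relMap (A := A'') (B := A) n ψ)) :
    ∃ I : Ideal (RelGerm (ArtAlg.pullback φ ψ) n), IsAdmissible f (ArtAlg.pullback φ ψ) I ∧
      I.map (relFst n φ ψ) = I' ∧ I.map (relSnd n φ ψ) = I'' := by
  obtain ⟨F', hF', hFf'⟩ := exists_mem_special_eq hI'.fibre (Ideal.mem_span_singleton_self f)
  -- The restriction of the equation `F'` to `A` lies in the restriction of `I''`, so it lifts to
  -- some `F'' ∈ I''`. Its special fibre is again `f`, hence it generates `I''`.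
  have h1 := Ideal.mem_map_of_mem (relMap (A := A') (B := A) n φ) hF'
  rw [h, mem_map_relMap hψ] at h1
  obtain ⟨F'', hF'', hFF⟩ := h1
  have hFf'' : special A'' n F'' = f := by
    rw [← special_relMap (A := A'') (B := A) ψ, hFF, special_relMap, hFf']
  obtain ⟨F, h1, h2⟩ := _root_.exists_glue φ ψ F' F'' hFF.symm
  have hFf : special _ n F = f := by rw [← hFf', ← h1, special_relMap]
  have hflat := flat_quot_span (F := F) (hFf.symm ▸ hf)
  have hfib : (Ideal.span {F}).map (special _ n) = Ideal.span {f} := by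
    rw [map_special_span, hFf]
  have h3 : (Ideal.span {F}).map (relFst n φ ψ) = I' := by
    rw [Ideal.map_span, Set.image_singleton, relFst, h1,
      eq_span_of_flat hI'.flat hI'.fibre hF' hFf']
  have h4 : (Ideal.span {F}).map (relSnd n φ ψ) = I'' := by
    rw [Ideal.map_span, Set.image_singleton, relSnd, h2,
      eq_span_of_flat hI''.flat hI''.fibre hF'' hFf'']
  refine ⟨Ideal.span {F}, IsAdmissible.of_lift hflat hfib fun d hd => ?_, h3, h4⟩
  obtain ⟨a', ha', rfl⟩ :=
    hI'.image.symm ▸ (show d ∈ (logDer f : Set (Fin n → HolGerm n)) from hd)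
  -- To lift `d`, its lift `a'` over `A'` is restricted to `A` and lifted again to a logarithmic
  -- field over `A''`; the two then glue.
  obtain ⟨a'', ha'', haa⟩ := hI''.exists_lift_field (A := A) (ψ := ψ) hψ
    (a := mapField (A := A') (B := A) φ a') (h ▸ relMap_mem_relLogDer (A := A') (B := A) φ ha')
  obtain ⟨a, h5, h6⟩ := exists_glue_field φ ψ haa.symm
  refine ⟨a, mem_relLogDer_of_factors hf hflat hfib ?_ ?_, ?_⟩
  · rw [h3, funext h5]; exact ha'
  · rw [h4, funext h6]; exact ha''
  · rw [← funext h5]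
    exact (specialField_relMap (A := ArtAlg.pullback φ ψ) (B := A') (ArtAlg.pullbackFst φ ψ) a).symm

/-- Restriction of functions on a deformation along a morphism of bases. -/
def quotRelMap {A B : ArtAlg} {n : ℕ} (φ : A →ₐ[ℂ] B) (I : Ideal (RelGerm A n)) :
    (RelGerm A n ⧸ I) →+* (RelGerm B n ⧸ I.map (relMap n φ)) :=
  Ideal.quotientMap _ (relMap n φ : RelGerm A n →+* RelGerm B n) Ideal.le_comap_map

theorem quotRelMap_mk {A B : ArtAlg} {n : ℕ} (φ : A →ₐ[ℂ] B) (I : Ideal (RelGerm A n))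
    (y : RelGerm A n) :
    quotRelMap φ I (Ideal.Quotient.mk I y) = Ideal.Quotient.mk _ (relMap n φ y) := rfl

theorem specialQuot_quotRelMap {A B : ArtAlg} {n : ℕ} {f : HolGerm n} {φ : A →ₐ[ℂ] B}
    {I : Ideal (RelGerm A n)} (hI : I.map (special A n) ≤ Ideal.span {f})
    (hI' : (I.map (relMap n φ)).map (special B n) ≤ Ideal.span {f}) (x : RelGerm A n ⧸ I) :
    specialQuot hI' (quotRelMap φ I x) = specialQuot hI x := by
  obtain ⟨y, rfl⟩ := Ideal.Quotient.mk_surjective x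
  rw [quotRelMap_mk, specialQuot_mk, specialQuot_mk, special_relMap]

/-- The maximal ideal of ℂ is zero, so restriction to the special fibre loses nothing. -/
theorem relGerm_base_ext {n : ℕ} {y z : RelGerm ArtAlg.base n}
    (h : special ArtAlg.base n y = special ArtAlg.base n z) : y = z := by
  have h1 := sub_special_mem ArtAlg.base (y - z)
  have h2 : IsLocalRing.maximalIdeal ArtAlg.base = ⊥ := IsLocalRing.maximalIdeal_eq_bot (R := ℂ)
  rw [map_sub, h, sub_self, TensorProduct.tmul_zero, sub_zero, baseMaximal, h2,
    mem_map_bot_iff] at h1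
  exact sub_eq_zero.mp h1

/-- Deformations over `A' ×_ℂ A''` that are isomorphic over `A'` and `A''` are isomorphic. -/
theorem DefIso.of_factors {A' A'' : ArtAlg} {n : ℕ} {f : HolGerm n} (hf : f ≠ 0)
    {φ : A' ⟶ ArtAlg.base} {ψ : A'' ⟶ ArtAlg.base}
    {I K : Ideal (RelGerm (ArtAlg.pullback φ ψ) n)}
    (hI : IsAdmissible f (ArtAlg.pullback φ ψ) I) (hK : IsAdmissible f (ArtAlg.pullback φ ψ) K)
    (h' : DefIso (hI.map (B := A') (ArtAlg.pullbackFst φ ψ))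
      (hK.map (B := A') (ArtAlg.pullbackFst φ ψ)))
    (h'' : DefIso (hI.map (B := A'') (ArtAlg.pullbackSnd φ ψ))
      (hK.map (B := A'') (ArtAlg.pullbackSnd φ ψ))) : DefIso hI hK := by
  let qf := fun L => quotRelMap (A := ArtAlg.pullback φ ψ) (B := A') (n := n)
    (ArtAlg.pullbackFst φ ψ) L
  let qs := fun L => quotRelMap (A := ArtAlg.pullback φ ψ) (B := A'') (n := n)
    (ArtAlg.pullbackSnd φ ψ) L
  -- Functions on a flat deformation over the fibre product are determined by their two
  -- restrictions. This makes the elementwise gluing below unique, hence automatically a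
  -- homomorphism.
  have hinj : ∀ {L} (_ : IsAdmissible f (ArtAlg.pullback φ ψ) L) {x y}, qf L x = qf L y →
      qs L x = qs L y → x = y := by
    intro L hL x y h1 h2
    obtain ⟨x, rfl⟩ := Ideal.Quotient.mk_surjective x
    obtain ⟨y, rfl⟩ := Ideal.Quotient.mk_surjective y
    rw [Ideal.Quotient.eq]
    refine mem_of_relFst_mem_of_relSnd_mem hf hL.flat hL.fibre ?_ ?_
    · rw [map_sub]; exact Ideal.Quotient.eq.mp h1
    · rw [map_sub]; exact Ideal.Quotient.eq.mp h2
  have hex : ∀ {L M} (hL : IsAdmissible f (ArtAlg.pullback φ ψ) L)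
      (hM : IsAdmissible f (ArtAlg.pullback φ ψ) M)
      (e' : (RelGerm A' n ⧸ L.map (relFst n φ ψ)) ≃ₐ[A'] (RelGerm A' n ⧸ M.map (relFst n φ ψ)))
      (e'' : (RelGerm A'' n ⧸ L.map (relSnd n φ ψ)) ≃ₐ[A''] (RelGerm A'' n ⧸ M.map (relSnd n φ ψ)))
      (_ : ∀ x, specialQuot (hM.map (B := A') (ArtAlg.pullbackFst φ ψ)).fibre.le (e' x) =
        specialQuot (hL.map (B := A') (ArtAlg.pullbackFst φ ψ)).fibre.le x)
      (_ : ∀ x, specialQuot (hM.map (B := A'') (ArtAlg.pullbackSnd φ ψ)).fibre.le (e'' x) =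
        specialQuot (hL.map (B := A'') (ArtAlg.pullbackSnd φ ψ)).fibre.le x)
      (x : RelGerm (ArtAlg.pullback φ ψ) n ⧸ L),
      ∃ y, qf M y = e' (qf L x) ∧ qs M y = e'' (qs L x) := by
    intro L M hL hM e' e'' he' he'' x
    obtain ⟨y', hy'⟩ := Ideal.Quotient.mk_surjective (e' (qf L x))
    obtain ⟨y'', hy''⟩ := Ideal.Quotient.mk_surjective (e'' (qs L x))
    have h1 := he' (qf L x)
    have h2 := he'' (qs L x)
    rw [← hy', specialQuot_mk,
      specialQuot_quotRelMap hL.fibre.le (hL.map (B := A') (ArtAlg.pullbackFst φ ψ)).fibre.le] at h1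
    rw [← hy'', specialQuot_mk,
      specialQuot_quotRelMap hL.fibre.le (hL.map (B := A'') (ArtAlg.pullbackSnd φ ψ)).fibre.le] at h2
    rw [← h1, Ideal.Quotient.eq] at h2
    -- Both isomorphisms are the identity on 𝒪_D, so the representatives `y'` and `y''` have special
    -- fibres that agree modulo `f`; an element of the ideal of `M` over `A''` removes the
    -- difference. Over the base ℂ equal special fibres suffice for gluing.
    obtain ⟨F, hF, hFs⟩ := exists_mem_special_eq
      (hM.map (B := A'') (ArtAlg.pullbackSnd φ ψ)).fibre h2
    obtain ⟨y, h3, h4⟩ := exists_glue φ ψ y' (y'' - F) (relGerm_base_ext (by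
      rw [special_relMap, special_relMap, map_sub, hFs, sub_sub_cancel]))
    refine ⟨Ideal.Quotient.mk _ y, ?_, ?_⟩
    · rw [← hy', ← h3]; rfl
    · have h5 : qs M (Ideal.Quotient.mk _ y) = Ideal.Quotient.mk _ (y'' - F) := by rw [← h4]; rfl
      rw [h5, map_sub, Ideal.Quotient.eq_zero_iff_mem.mpr hF, sub_zero, hy'']
  obtain ⟨e', he'⟩ := h'
  obtain ⟨e'', he''⟩ := h''
  choose E hE' hE'' using hex hI hK e' e'' he' he''
  have hqf : ∀ L a, qf L (algebraMap _ _ a) = algebraMap A' _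
      ((show ArtAlg.pullback φ ψ →ₐ[ℂ] A' from ArtAlg.pullbackFst φ ψ) a) := by
    intro L a
    exact congrArg (Ideal.Quotient.mk _) (relMap_algebraMap (B := A') (ArtAlg.pullbackFst φ ψ) a)
  have hqs : ∀ L a, qs L (algebraMap _ _ a) = algebraMap A'' _
      ((show ArtAlg.pullback φ ψ →ₐ[ℂ] A'' from ArtAlg.pullbackSnd φ ψ) a) := by
    intro L a
    exact congrArg (Ideal.Quotient.mk _) (relMap_algebraMap (B := A'') (ArtAlg.pullbackSnd φ ψ) a)
  let Eh : (RelGerm (ArtAlg.pullback φ ψ) n ⧸ I) →ₐ[ArtAlg.pullback φ ψ]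
      (RelGerm (ArtAlg.pullback φ ψ) n ⧸ K) :=
    { toFun := E
      map_one' := hinj hK (by rw [hE', map_one, map_one, map_one]) (by rw [hE'', map_one, map_one, map_one])
      map_mul' := fun x y => hinj hK (by rw [hE', map_mul, map_mul, map_mul, hE', hE'])
        (by rw [hE'', map_mul, map_mul, map_mul, hE'', hE''])
      map_zero' := hinj hK (by rw [hE', map_zero, map_zero, map_zero]) (by rw [hE'', map_zero, map_zero, map_zero])
      map_add' := fun x y => hinj hK (by rw [hE', map_add, map_add, map_add, hE', hE'])
        (by rw [hE'', map_add, map_add, map_add, hE'', hE''])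
      commutes' := fun a => hinj hK (by rw [hE', hqf, hqf]; exact e'.commutes _)
        (by rw [hE'', hqs, hqs]; exact e''.commutes _) }
  have hbij : Function.Bijective Eh := by
    constructor
    · intro x y hxy
      refine hinj hI (e'.injective ?_) (e''.injective ?_)
      · rw [← hE', ← hE']; exact congrArg _ hxy
      · rw [← hE'', ← hE'']; exact congrArg _ hxy
    · intro y
      -- A preimage is obtained by gluing the inverse isomorphisms in the same way.
      obtain ⟨x, hx', hx''⟩ := hex hK hI e'.symm e''.symm
        (fun x => by rw [← he', AlgEquiv.apply_symm_apply])
        (fun x => by rw [← he'', AlgEquiv.apply_symm_apply]) y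
      refine ⟨x, hinj hK ?_ ?_⟩
      · exact (hE' x).trans (by rw [hx', AlgEquiv.apply_symm_apply])
      · exact (hE'' x).trans (by rw [hx'', AlgEquiv.apply_symm_apply])
  refine ⟨AlgEquiv.ofBijective Eh hbij, fun x => ?_⟩
  have h1 := he' (qf I x)
  rw [← hE', specialQuot_quotRelMap hK.fibre.le (hK.map (B := A') (ArtAlg.pullbackFst φ ψ)).fibre.le,
    specialQuot_quotRelMap hI.fibre.le (hI.map (B := A') (ArtAlg.pullbackFst φ ψ)).fibre.le] at h1
  exact h1

/-! ### Schlessinger's conditions for admissible deformations -/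

/-- The isomorphism over `A` is realised by an ambient automorphism and lifted to `A''`. Moving
`I''` by the lift does not change its class and makes the restrictions to `A` equal. Only
surjectivity of `ψ` matters, not the size of its kernel. -/
theorem FD_fibreMap_surjective {n : ℕ} {f : HolGerm n} (hf : f ≠ 0) {A' A'' A : ArtAlg}
    (φ : A' ⟶ A) (ψ : A'' ⟶ A) (hψ : Function.Surjective (show A'' →ₐ[ℂ] A from ψ)) :
    Function.Surjective (fibreMap (FD f) φ ψ) := by
  rintro ⟨⟨x', x''⟩, hx⟩
  induction x' using Quotient.inductionOn with | h I' => ?_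
  induction x'' using Quotient.inductionOn with | h I'' => ?_
  obtain ⟨Θ, hΘ, hcomap⟩ := DefIso.exists_aut (Quotient.exact hx)
  choose y hy using fun i => relMap_surjective n hψ (Θ (relCoord A i))
  obtain ⟨Θ', hΘ', -, hcomm⟩ := hΘ.exists_lift (B := A'') ψ y hy
  obtain ⟨I, hI, h1, h2⟩ := I'.2.exists_glue hf hψ (I''.2.comap hΘ')
    (hcomap.trans (map_relMap_comap hψ hcomm I''.1).symm)
  refine ⟨Quotient.mk _ ⟨I, hI⟩, Subtype.ext (Prod.ext ?_ ?_)⟩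
  · exact congrArg (Quotient.mk _) (Subtype.ext h1)
  · have h3 : (⟨I.map (relSnd n φ ψ), hI.map (B := A'') (ArtAlg.pullbackSnd φ ψ)⟩ :
        {I : Ideal (RelGerm A'' n) // IsAdmissible f A'' I}) =
        ⟨I''.1.comap Θ', I''.2.comap hΘ'⟩ := Subtype.ext h2
    have h4 : Quotient.mk (admissibleSetoid f A'') ⟨I''.1.comap Θ', I''.2.comap hΘ'⟩ =
        Quotient.mk _ I'' := Quotient.sound (I''.2.comap_defIso hΘ')
    exact (congrArg (Quotient.mk _) h3).trans h4

theorem FD_fibreMap_injective {n : ℕ} {f : HolGerm n} (hf : f ≠ 0) {A' A'' : ArtAlg}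
    (φ : A' ⟶ ArtAlg.base) (ψ : A'' ⟶ ArtAlg.base) :
    Function.Injective (fibreMap (FD f) φ ψ) := by
  intro x y hxy
  induction x using Quotient.inductionOn with | h I => ?_
  induction y using Quotient.inductionOn with | h K => ?_
  have h1 := congrArg Subtype.val hxy
  exact Quotient.sound (DefIso.of_factors hf I.2 K.2 (Quotient.exact (congrArg Prod.fst h1))
    (Quotient.exact (congrArg Prod.snd h1)))

theorem surjective_of_base {A : ArtAlg} (ψ : A ⟶ ArtAlg.base) :
    Function.Surjective (show A →ₐ[ℂ] ArtAlg.base from ψ) := fun c =>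
  ⟨algebraMap ℂ A c, AlgHom.commutes (show A →ₐ[ℂ] ArtAlg.base from ψ) c⟩

theorem FD_H1 {n : ℕ} {f : HolGerm n} (hf : f ≠ 0) : SchlessingerH1 (FD f) :=
  fun _ _ _ φ ψ h => FD_fibreMap_surjective hf φ ψ h.1

theorem FD_H2 {n : ℕ} {f : HolGerm n} (hf : f ≠ 0) : SchlessingerH2 (FD f) :=
  fun _ φ ψ => ⟨FD_fibreMap_injective hf φ ψ, FD_fibreMap_surjective hf φ ψ (surjective_of_base ψ)⟩

/-! ### Logarithmic fields determine the divisor -/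

/-- The formal inverse is the quotient of 1 by `g`, so `IsConvergent.of_mul` makes it converge. -/
theorem isUnit_of_evalZero_ne_zero {n : ℕ} {g : HolGerm n} (h : evalZero n g ≠ 0) : IsUnit g := by
  have h1 : g.1 * g.1⁻¹ = 1 := MvPowerSeries.mul_inv_cancel _ h
  have h0 : g.1 ≠ 0 := fun h0 => h (by rw [Subtype.ext h0 (a2 := (0 : HolGerm n)), map_zero])
  have h2 : IsConvergent (g.1 * g.1⁻¹) := by
    rw [h1]; exact (1 : HolGerm n).2
  exact IsUnit.of_mul_eq_one ⟨g.1⁻¹, IsConvergent.of_mul h0 g.2 h2⟩ (Subtype.ext h1)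

/-- Proper ideals of `ℂ{x}` that are stable under all partial derivatives vanish. -/
theorem eq_zero_of_mem_of_partialD_stable {n : ℕ} {P : Ideal (HolGerm n)} (hP : P ≠ ⊤)
    (hstab : ∀ i, ∀ g ∈ P, partialD i g ∈ P) {g : HolGerm n} (hg : g ∈ P) : g = 0 := by
  -- Up to nonzero integer factors, Taylor coefficients are values at the origin of iterated
  -- derivatives. These stay in `P`, which contains no unit, so the values vanish.
  have key : ∀ (N : ℕ) (d : Fin n →₀ ℕ), d.degree = N → ∀ g ∈ P, taylorCoeff d g = 0 := by
    intro N
    induction N with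
    | zero =>
      intro d hd g hg
      obtain rfl := (Finsupp.degree_eq_zero_iff d).mp hd
      by_contra h
      exact hP (Ideal.eq_top_of_isUnit_mem _ hg (isUnit_of_evalZero_ne_zero h))
    | succ N ih =>
      intro d hd g hg
      obtain ⟨i, hi⟩ : ∃ i, d i ≠ 0 := by
        by_contra! h
        rw [show d = 0 from Finsupp.ext h, map_zero] at hd
        omega
      obtain ⟨e, rfl⟩ : ∃ e, d = e + Finsupp.single i 1 :=
        ⟨d - Finsupp.single i 1, (tsub_add_cancel_of_le (by
          simpa [Finsupp.single_le_iff] using Nat.one_le_iff_ne_zero.mpr hi)).symm⟩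
      rw [map_add, Finsupp.degree_single] at hd
      have h1 := ih e (by omega) _ (hstab i g hg)
      rw [taylorCoeff_partialD] at h1
      exact (mul_eq_zero.mp h1).resolve_right (by exact_mod_cast Nat.succ_ne_zero (e i))
  exact HolGerm.ext_taylorCoeff fun d => by rw [key _ d rfl g hg, map_zero]

/-- Localised at a minimal prime, a radical ideal becomes that prime. If no product of some `s ∉ P`
with a power of `h` lay in `I`, there would be a prime over `I`, contained in `P` and missing `h`,
against minimality; radicality then lowers the power to the first. -/
theorem exists_notMem_mul_mem_of_mem_minimalPrimes {R : Type*} [CommRing R] {I P : Ideal R}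
    (hI : I.IsRadical) (hP : P ∈ I.minimalPrimes) {h : R} (hh : h ∈ P) : ∃ s ∉ P, s * h ∈ I := by
  have hprime : P.IsPrime := hP.1.1
  let M : Submonoid R := P.primeCompl ⊔ Submonoid.powers h
  by_cases hd : Disjoint (I : Set R) M
  · obtain ⟨Q, hQ, hIQ, hQM⟩ := Ideal.exists_le_prime_disjoint I M hd
    have hQP : Q ≤ P := fun x hx => by
      by_contra hxP
      exact Set.disjoint_left.mp hQM hx ((le_sup_left : P.primeCompl ≤ M) hxP)
    have hPQ := hP.2 ⟨hQ, hIQ⟩ hQP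
    exact absurd ((le_sup_right : Submonoid.powers h ≤ M) (Submonoid.mem_powers h))
      (Set.disjoint_left.mp hQM (hPQ hh))
  · obtain ⟨x, hxI, hxM⟩ := Set.not_disjoint_iff.mp hd
    obtain ⟨s, hs, _, ⟨k, rfl⟩, rfl⟩ := Submonoid.mem_sup.mp hxM
    refine ⟨s, hs, hI ⟨k + 1, ?_⟩⟩
    have : (s * h) ^ (k + 1) = (s ^ k * h) * (s * h ^ k) := by ring
    rw [this]
    exact I.mul_mem_left _ hxI

/-- A reduced hypersurface is generically smooth. If `g` missed a minimal prime `P` of `(f)`, all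
partial derivatives of `f` would lie in `P`; then `P` would be stable under differentiation, forcing
`f = 0`. -/
theorem mem_span_of_forall_mul_partialD_mem {n : ℕ} {f g : HolGerm n} (hf : f ≠ 0)
    (hred : IsReduced (HolGerm n ⧸ Ideal.span {f}))
    (h : ∀ i, g * partialD i f ∈ Ideal.span {f}) : g ∈ Ideal.span {f} := by
  have hrad : (Ideal.span {f}).IsRadical := (Ideal.isRadical_iff_quotient_reduced _).mpr hred
  rw [← hrad.radical, ← Ideal.sInf_minimalPrimes, Ideal.mem_sInf]
  intro P hP
  by_contra hg
  have hprime : P.IsPrime := hP.1.1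
  have hfP : f ∈ P := hP.1.2 (Ideal.mem_span_singleton_self f)
  have h1 : ∀ i, partialD i f ∈ P := fun i =>
    (hprime.mem_or_mem (hP.1.2 (h i))).resolve_left hg
  refine hf (eq_zero_of_mem_of_partialD_stable hprime.ne_top (fun i y hy => ?_) hfP)
  obtain ⟨s, hs, hsy⟩ := exists_notMem_mul_mem_of_mem_minimalPrimes hrad hP hy
  obtain ⟨k, hk⟩ := Ideal.mem_span_singleton.mp hsy
  -- Differentiating `s * y = f * k` expresses `s * ∂ᵢy` through `f`, `∂ᵢf` and `y`, all of which
  -- lie in `P`, while `s` does not.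
  have h2 := congrArg (partialD i) hk
  rw [Derivation.leibniz, Derivation.leibniz] at h2
  simp only [smul_eq_mul] at h2
  refine (hprime.mem_or_mem (x := s) ?_).resolve_left hs
  rw [← eq_sub_iff_add_eq] at h2
  rw [h2]
  exact P.sub_mem (P.add_mem (P.mul_mem_right _ hfP) (P.mul_mem_left _ (h1 i)))
    (P.mul_mem_right _ hy)

theorem smul_mem_relLogDer {A : ArtAlg} {n : ℕ} {I : Ideal (RelGerm A n)} {g : RelGerm A n}
    (hg : g ∈ I) (v : Fin n → RelGerm A n) : g • v ∈ relLogDer I := by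
  intro y _
  exact I.sum_mem fun i _ => I.mul_mem_right _ (I.mul_mem_right _ hg)

/-- The ideal of an admissible deformation consists of the functions that multiply all vector
fields into the logarithmic ones. -/
theorem mem_of_forall_smul_mem_relLogDer {A : ArtAlg} {n : ℕ} {f : HolGerm n}
    (hf : IsFreeDivisor f) {I : Ideal (RelGerm A n)} (hI : IsAdmissible f A I) {g : RelGerm A n}
    (h : ∀ v : Fin n → RelGerm A n, g • v ∈ relLogDer I) : g ∈ I := by
  classical
  obtain ⟨w, hw, hgw⟩ : ∃ w ∈ I, g - w ∈ (⊥ : Ideal A).map (algebraMap A (RelGerm A n)) := by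
    refine SmallStep.descent (P := fun J => ∃ w ∈ I, g - w ∈ J.map (algebraMap A (RelGerm A n)))
      ⟨0, zero_mem _, mem_map_top _⟩ ?_
    rintro J s ⟨w, hw, hgw⟩
    have h1 : slice s.l (g - w) ∈ Ideal.span {f} := by
      refine mem_span_of_forall_mul_partialD_mem hf.ne_zero hf.reduced fun i => ?_
      -- Testing on the constant field `∂/∂xᵢ` shows that the slice of the error multiplies `∂f/∂xᵢ`
      -- into `(f)`.
      have h2 : (g - w) • (Pi.single i 1 : Fin n → RelGerm A n) ∈ relLogDer I := by
        rw [sub_smul]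
        exact sub_mem (h _) (smul_mem_relLogDer hw _)
      have h3 : ∑ j, slice s.l (((g - w) • (Pi.single i 1 : Fin n → RelGerm A n)) j) *
          partialD j f ∈ Ideal.span {f} := sum_slice_mem s hI.flat hI.fibre h2 fun j => by
        rw [Pi.smul_apply, smul_eq_mul]
        exact Ideal.mul_mem_right _ _ hgw
      rw [Finset.sum_eq_single i (fun j _ hj => by simp [hj]) (by simp)] at h3
      simpa using h3
    obtain ⟨F, hF, hFs⟩ := exists_mem_special_eq hI.fibre h1
    refine ⟨w + algebraMap A _ s.e * F, I.add_mem hw (I.mul_mem_left _ hF), ?_⟩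
    rw [← sub_sub]
    exact s.sub_mem_next hgw F hFs
  rw [mem_map_bot_iff, sub_eq_zero] at hgw
  rwa [hgw]

/-! ### Linear parts -/

/-- Restriction of functions to the zero section. -/
def relEval (A : ArtAlg) (n : ℕ) : RelGerm A n →ₐ[A] A :=
  Algebra.TensorProduct.lift (AlgHom.id A A) ((Algebra.ofId ℂ A).comp (evalZero n))
    fun _ _ => Commute.all _ _

theorem relEval_tmul (A : ArtAlg) {n : ℕ} (a : A) (g : HolGerm n) :
    relEval A n (a ⊗ₜ g) = a * algebraMap ℂ A (evalZero n g) := by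
  simp [relEval, Algebra.ofId_apply]

theorem relEval_relCoord (A : ArtAlg) {n : ℕ} (k : Fin n) : relEval A n (relCoord A k) = 0 := by
  rw [relCoord, relEval_tmul, evalZero_coord, map_zero, mul_zero]

theorem relEval_relMap {A B : ArtAlg} {n : ℕ} (φ : A →ₐ[ℂ] B) (y : RelGerm A n) :
    relEval B n (relMap n φ y) = φ (relEval A n y) := by
  induction y using TensorProduct.induction_on with
  | zero => simp
  | add x y hx hy => simp only [map_add, hx, hy]
  | tmul a g => simp [relMap, relEval_tmul]

theorem aug_relEval (A : ArtAlg) {n : ℕ} (y : RelGerm A n) :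
    A.aug (relEval A n y) = evalZero n (special A n y) := by
  induction y using TensorProduct.induction_on with
  | zero => simp
  | add x y hx hy => simp only [map_add, hx, hy]
  | tmul a g => simp [special_tmul, relEval_tmul]

/-- The linear part at the zero section. -/
def linPart (A : ArtAlg) (n : ℕ) : RelGerm A n →ₗ[A] RelGerm A n :=
  ∑ k, ((relEval A n).toLinearMap ∘ₗ relPartialD A k).smulRight (relCoord A k)

theorem linPart_apply {A : ArtAlg} {n : ℕ} (y : RelGerm A n) :
    linPart A n y = ∑ k, relEval A n (relPartialD A k y) • relCoord A k := by
  simp [linPart]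

theorem linPart_relCoord (A : ArtAlg) {n : ℕ} (k : Fin n) :
    linPart A n (relCoord A k) = relCoord A k := by
  simp [linPart_apply, relPartialD_relCoord, apply_ite (relEval A n)]

theorem linPart_mul {A : ArtAlg} {n : ℕ} (y z : RelGerm A n) :
    linPart A n (y * z) = relEval A n y • linPart A n z + relEval A n z • linPart A n y := by
  simp only [linPart_apply, relPartialD_mul, map_add, map_mul, add_smul, Finset.sum_add_distrib,
    Finset.smul_sum, smul_smul]

theorem relMap_smul {A B : ArtAlg} {n : ℕ} (φ : A →ₐ[ℂ] B) (a : A) (y : RelGerm A n) :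
    relMap n φ (a • y) = φ a • relMap n φ y := by
  rw [Algebra.smul_def, map_mul, relMap_algebraMap, Algebra.smul_def]

theorem relMap_linPart {A B : ArtAlg} {n : ℕ} (φ : A →ₐ[ℂ] B) (y : RelGerm A n) :
    relMap n φ (linPart A n y) = linPart B n (relMap n φ y) := by
  simp only [linPart_apply, map_sum, relMap_smul, relMap_relCoord, ← relEval_relMap,
    relMap_relPartialD]

/-- Linear forms in the coordinates with coefficients in `A`. -/
abbrev linForms (A : ArtAlg) (n : ℕ) : Submodule A (RelGerm A n) :=
  Submodule.span A (Set.range fun k : Fin n => (1 : A) ⊗ₜ[ℂ] coord k)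

theorem relCoord_mem_linForms (A : ArtAlg) {n : ℕ} (k : Fin n) : relCoord A k ∈ linForms A n :=
  Submodule.subset_span ⟨k, rfl⟩

theorem linPart_mem_linForms {A : ArtAlg} {n : ℕ} (y : RelGerm A n) :
    linPart A n y ∈ linForms A n := by
  rw [linPart_apply]
  exact Submodule.sum_mem _ fun k _ => Submodule.smul_mem _ _ (relCoord_mem_linForms A k)

/-- `linPart` is a projection onto the linear forms. In this form linearity becomes an equation
compatible with restriction of the base, which can be checked on the factors of a fibre product. -/
theorem mem_linForms_iff {A : ArtAlg} {n : ℕ} {y : RelGerm A n} :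
    y ∈ linForms A n ↔ linPart A n y = y := by
  refine ⟨fun hy => ?_, fun hy => hy ▸ linPart_mem_linForms y⟩
  induction hy using Submodule.span_induction with
  | mem x hx =>
    obtain ⟨k, rfl⟩ := hx
    exact linPart_relCoord A k
  | zero => exact map_zero _
  | add x y _ _ hx hy => rw [map_add, hx, hy]
  | smul c x _ hx => rw [map_smul, hx]

theorem relEval_eq_zero_of_mem_linForms {A : ArtAlg} {n : ℕ} {y : RelGerm A n}
    (hy : y ∈ linForms A n) : relEval A n y = 0 := by
  rw [← mem_linForms_iff.mp hy, linPart_apply, map_sum]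
  exact Finset.sum_eq_zero fun k _ => by rw [map_smul, relEval_relCoord, smul_zero]

theorem derivation_mem_of_mem_linForms {A : ArtAlg} {n : ℕ} {a : Fin n → RelGerm A n}
    (ha : ∀ i, a i ∈ linForms A n) {y : RelGerm A n} (hy : y ∈ linForms A n) :
    fieldDer a y ∈ linForms A n := by
  rw [← mem_linForms_iff.mp hy, linPart_apply, map_sum]
  refine Submodule.sum_mem _ fun k _ => ?_
  rw [(fieldDer a).map_smul, fieldDer_relCoord]
  exact Submodule.smul_mem _ _ (ha k)

/-- The Euler vector field. -/
def euler (A : ArtAlg) (n : ℕ) : Fin n → RelGerm A n := fun k => relCoord A k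

theorem fieldDer_euler_of_mem_linForms {A : ArtAlg} {n : ℕ} {y : RelGerm A n}
    (hy : y ∈ linForms A n) : fieldDer (euler A n) y = y := by
  conv_lhs => rw [← mem_linForms_iff.mp hy]
  conv_rhs => rw [← mem_linForms_iff.mp hy]
  rw [linPart_apply, map_sum]
  exact Finset.sum_congr rfl fun k _ => by rw [(fieldDer _).map_smul, fieldDer_relCoord]; rfl

section LinearBasis

variable {A : ArtAlg} {n : ℕ} {I : Ideal (RelGerm A n)}
  {b : Module.Basis (Fin n) (RelGerm A n) (relLogDer I)}

theorem eq_sum_repr {a : Fin n → RelGerm A n} (ha : a ∈ relLogDer I) (i : Fin n) :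
    a i = ∑ k, b.repr ⟨a, ha⟩ k * (b k : Fin n → RelGerm A n) i := by
  have h1 := congrArg (relLogDer I).subtype (b.sum_repr ⟨a, ha⟩)
  simp only [map_sum, map_smul, Submodule.subtype_apply] at h1
  have h2 := congrFun h1 i
  rw [Finset.sum_apply] at h2
  exact h2.symm

/-- A basis of linear fields vanishes along the zero section, and so do all its combinations. -/
theorem relEval_eq_zero_of_mem_relLogDer
    (hb : ∀ j i, (b j : Fin n → RelGerm A n) i ∈ linForms A n)
    {a : Fin n → RelGerm A n} (ha : a ∈ relLogDer I)
    (i : Fin n) : relEval A n (a i) = 0 := by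
  rw [eq_sum_repr (b := b) ha i, map_sum]
  exact Finset.sum_eq_zero fun k _ => by
    rw [map_mul, relEval_eq_zero_of_mem_linForms (hb k i), mul_zero]

/-- Since the basis fields are linear, the linear part of `∑ cₖ bₖ` is `∑ cₖ(0) bₖ`, again a
combination of the basis. -/
theorem linPart_mem_relLogDer
    (hb : ∀ j i, (b j : Fin n → RelGerm A n) i ∈ linForms A n)
    {a : Fin n → RelGerm A n} (ha : a ∈ relLogDer I) :
    (fun i => linPart A n (a i)) ∈ relLogDer I := by
  have h : (fun i => linPart A n (a i)) =
      ∑ k, algebraMap A (RelGerm A n) (relEval A n (b.repr ⟨a, ha⟩ k)) •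
        (b k : Fin n → RelGerm A n) := by
    funext i
    rw [eq_sum_repr (b := b) ha i, map_sum, Finset.sum_apply]
    refine Finset.sum_congr rfl fun k _ => ?_
    rw [linPart_mul, relEval_eq_zero_of_mem_linForms (hb k i), zero_smul, add_zero,
      mem_linForms_iff.mp (hb k i), Algebra.smul_def]
    rfl
  rw [h]
  exact Submodule.sum_mem _ fun k _ => Submodule.smul_mem _ _ (b k).2

/-- Applying the Euler field E to the coefficients of `∑ cₖ bₖ` gives `∑ (cₖ + E cₖ) bₖ`, so
logarithmic fields are preserved. For `g ∈ I` and any `v` this applies to `g v`; as `E(g v) = g E(v)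
+ E(g) v`, the field `E(g) v` is logarithmic for every `v`, hence `E(g) ∈ I`. -/
theorem euler_mem_relLogDer
    (hb : ∀ j i, (b j : Fin n → RelGerm A n) i ∈ linForms A n)
    {f : HolGerm n} (hf : IsFreeDivisor f) (hI : IsAdmissible f A I) :
    euler A n ∈ relLogDer I := by
  have hE : ∀ a ∈ relLogDer I, (fun i => fieldDer (euler A n) (a i)) ∈ relLogDer I := by
    intro a ha
    have h : (fun i => fieldDer (euler A n) (a i)) =
        a + ∑ k, fieldDer (euler A n) (b.repr ⟨a, ha⟩ k) • (b k : Fin n → RelGerm A n) := by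
      funext i
      rw [Pi.add_apply, Finset.sum_apply]
      conv_lhs => rw [eq_sum_repr (b := b) ha i, map_sum]
      conv_rhs => rw [eq_sum_repr (b := b) ha i, ← Finset.sum_add_distrib]
      refine Finset.sum_congr rfl fun k _ => ?_
      rw [Derivation.leibniz, fieldDer_euler_of_mem_linForms (hb k i)]
      simp only [smul_eq_mul, Pi.smul_apply]
      ring
    rw [h]
    exact add_mem ha (Submodule.sum_mem _ fun k _ => Submodule.smul_mem _ _ (b k).2)
  rw [mem_relLogDer]
  intro g hg
  refine mem_of_forall_smul_mem_relLogDer hf hI fun v => ?_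
  have h1 := hE _ (smul_mem_relLogDer hg v)
  have h2 : (fun i => fieldDer (euler A n) ((g • v) i)) =
      g • (fun i => fieldDer (euler A n) (v i)) + fieldDer (euler A n) g • v := by
    funext i
    simp only [Pi.smul_apply, smul_eq_mul, Pi.add_apply, Derivation.leibniz]
    ring
  rw [h2] at h1
  exact (Submodule.add_mem_iff_right _ (smul_mem_relLogDer hg _)).mp h1

end LinearBasis

/-! ### Linear coordinate changes -/

theorem IsInfinitesimal.aug_relEval_relPartialD {A : ArtAlg} {n : ℕ}
    {Θ : RelGerm A n ≃ₐ[A] RelGerm A n} (hΘ : IsInfinitesimal Θ) (i k : Fin n) :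
    A.aug (relEval A n (relPartialD A k (Θ (relCoord A i)))) = if k = i then 1 else 0 := by
  rw [aug_relEval, special_relPartialD, hΘ, special_relCoord, partialD_coord]
  split_ifs <;> simp

theorem IsInfinitesimal.special_linPart {A : ArtAlg} {n : ℕ}
    {Θ : RelGerm A n ≃ₐ[A] RelGerm A n} (hΘ : IsInfinitesimal Θ) (i : Fin n) :
    special A n (linPart A n (Θ (relCoord A i))) = coord i := by
  have h : ∀ (a : A) (y : RelGerm A n), special A n (a • y) = A.aug a • special A n y := by
    intro a y
    rw [Algebra.smul_def, map_mul, Algebra.TensorProduct.algebraMap_apply, special_tmul,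
      Algebra.algebraMap_self, RingHom.id_apply, smul_mul_assoc, one_mul]
  rw [linPart_apply, map_sum]
  simp only [h, hΘ.aug_relEval_relPartialD, special_relCoord]
  simp

/-- The inverse of a linear coordinate change is linear. -/
theorem IsInfinitesimal.symm_mem_linForms {A : ArtAlg} {n : ℕ}
    {Λ : RelGerm A n ≃ₐ[A] RelGerm A n} (hΛ : IsInfinitesimal Λ)
    (hlin : ∀ i, Λ (relCoord A i) ∈ linForms A n) {y : RelGerm A n} (hy : y ∈ linForms A n) :
    Λ.symm y ∈ linForms A n := by
  classical
  -- The Jacobian matrix at the zero section. It reduces to the identity modulo the maximal ideal,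
  -- so its determinant is a unit, and its inverse gives `Λ.symm` on the coordinates.
  let L : Matrix (Fin n) (Fin n) A := fun i k => relEval A n (relPartialD A k (Λ (relCoord A i)))
  have hL : A.aug.toRingHom.mapMatrix L = 1 := by
    ext i k
    rw [RingHom.mapMatrix_apply, Matrix.map_apply, Matrix.one_apply]
    exact (hΛ.aug_relEval_relPartialD i k).trans (by simp only [eq_comm])
  have hdet : IsUnit L.det := by
    by_contra h
    have h1 := (A.aug_eq_zero_iff L.det).mpr ((IsLocalRing.mem_maximalIdeal _).mpr h)
    have h2 := RingHom.map_det A.aug.toRingHom L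
    rw [hL, Matrix.det_one] at h2
    exact one_ne_zero (h2.symm.trans h1)
  have hinv : L⁻¹ * L = 1 := Matrix.nonsing_inv_mul L hdet
  have hx : ∀ j, Λ.symm (relCoord A j) = ∑ i, L⁻¹ j i • relCoord A i := by
    intro j
    rw [AlgEquiv.symm_apply_eq, map_sum]
    have h1 : ∀ i, Λ (L⁻¹ j i • relCoord A i) = ∑ k, (L⁻¹ j i * L i k) • relCoord A k := by
      intro i
      rw [map_smul, ← mem_linForms_iff.mp (hlin i), linPart_apply, Finset.smul_sum]
      simp only [smul_smul]
      rfl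
    simp only [h1]
    rw [Finset.sum_comm]
    simp only [← Finset.sum_smul]
    have h2 : ∀ k, ∑ i, L⁻¹ j i * L i k = (1 : Matrix (Fin n) (Fin n) A) j k := fun k => by
      rw [← hinv, Matrix.mul_apply]
    simp only [h2, Matrix.one_apply]
    simp
  rw [← mem_linForms_iff.mp hy, linPart_apply, map_sum]
  refine Submodule.sum_mem _ fun k _ => ?_
  rw [map_smul, hx]
  exact Submodule.smul_mem _ _ (Submodule.sum_mem _ fun i _ =>
    Submodule.smul_mem _ _ (relCoord_mem_linForms A i))

/-- Linear coordinate changes preserve linear admissibility. -/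
theorem IsLinearlyAdmissible.comap {A : ArtAlg} {n : ℕ} {f : HolGerm n} {I : Ideal (RelGerm A n)}
    (hI : IsLinearlyAdmissible f A I) {Λ : RelGerm A n ≃ₐ[A] RelGerm A n}
    (hΛ : IsInfinitesimal Λ) (hlin : ∀ i, Λ (relCoord A i) ∈ linForms A n) :
    IsLinearlyAdmissible f A (I.comap Λ) := by
  have h' := hI.toIsAdmissible.comap hΛ
  obtain ⟨b, hb⟩ := hI.linear
  obtain ⟨b₀, hb₀⟩ := hI.toIsAdmissible.exists_special_basis b
  obtain ⟨b', hb'⟩ := exists_basis_of_lift h'.flat h'.fibre b₀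
    (fun j => ⟨_, pullField_mem Λ (b j).2⟩)
    (fun j => (specialField_pullField hΛ _).trans (hb₀ j))
  refine { h' with linear := ⟨b', fun j i => ?_⟩ }
  rw [hb' j]
  exact hΛ.symm_mem_linForms hlin (derivation_mem_of_mem_linForms (hb j) (hlin i))

/-- A lift of `f` chosen in the smaller ideal generates both. -/
theorem eq_of_le_of_flat {A : ArtAlg} {n : ℕ} {f : HolGerm n} {I J : Ideal (RelGerm A n)}
    (hI : IsAdmissible f A I) (hJ : IsAdmissible f A J) (h : I ≤ J) : I = J := by
  obtain ⟨F, hF, hFf⟩ := exists_mem_special_eq hI.fibre (Ideal.mem_span_singleton_self f)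
  rw [eq_span_of_flat hI.flat hI.fibre hF hFf, eq_span_of_flat hJ.flat hJ.fibre (h hF) hFf]

/-- For `g ∈ I` every `g v` is logarithmic for `I`, hence for `J`, and `J` is recovered from its
logarithmic fields. -/
theorem le_of_relLogDer_le {A : ArtAlg} {n : ℕ} {f : HolGerm n} (hf : IsFreeDivisor f)
    {I J : Ideal (RelGerm A n)} (hJ : IsAdmissible f A J) (h : relLogDer I ≤ relLogDer J) :
    I ≤ J := fun _ hg =>
  mem_of_forall_smul_mem_relLogDer hf hJ fun v => h (smul_mem_relLogDer hg v)

/-- Isomorphic linearly admissible deformations are related by a linear coordinate change. -/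
theorem IsLinearlyAdmissible.exists_linear_aut {A : ArtAlg} {n : ℕ} {f : HolGerm n}
    (hf : IsFreeDivisor f) {I J : Ideal (RelGerm A n)} (hI : IsLinearlyAdmissible f A I)
    (hJ : IsLinearlyAdmissible f A J) (h : DefIso hI.toIsAdmissible hJ.toIsAdmissible) :
    ∃ Λ : RelGerm A n ≃ₐ[A] RelGerm A n, IsInfinitesimal Λ ∧
      (∀ i, Λ (relCoord A i) ∈ linForms A n) ∧ I = J.comap Λ := by
  obtain ⟨Θ, hΘ, hIJ⟩ := h.exists_aut
  obtain ⟨b, hb⟩ := hI.linear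
  obtain ⟨c, hc⟩ := hJ.linear
  have hJI : J = I.comap Θ.symm := by
    ext y
    rw [hIJ, Ideal.mem_comap, Ideal.mem_comap, AlgEquiv.apply_symm_apply]
  have hpush : ∀ a ∈ relLogDer I, pullField Θ.symm a ∈ relLogDer J := fun a ha => by
    have h1 := pullField_mem Θ.symm ha
    rwa [← hJI] at h1
  have hpush_apply : ∀ (a : Fin n → RelGerm A n) y,
      fieldDer (pullField Θ.symm a) (Θ y) = Θ (fieldDer a y) := fun a y => by
    rw [fieldDer_pullField, AlgEquiv.symm_apply_apply, AlgEquiv.symm_symm]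
  -- `Θ` preserves the zero section: `Θ xᵢ` equals its derivative along the transported Euler field,
  -- which is logarithmic for `J` and vanishes there. The comparison of linear parts below rests on
  -- the vanishing of logarithmic fields alone.
  have hzero : ∀ i, relEval A n (Θ (relCoord A i)) = 0 := by
    intro i
    have h1 := hpush_apply (euler A n) (relCoord A i)
    rw [fieldDer_relCoord] at h1
    change _ = Θ (relCoord A i) at h1
    rw [← h1, fieldDer_apply, map_sum]
    exact Finset.sum_eq_zero fun j _ => by
      rw [map_mul, relEval_eq_zero_of_mem_relLogDer hc
        (hpush _ (euler_mem_relLogDer hb hf hI.toIsAdmissible)), zero_mul]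
  -- `Λ` is the linear part of `Θ`. It suffices to show that each linear basis field of `I` is
  -- logarithmic for `J.comap Λ`; the inclusion of ideals and then their equality follow.
  obtain ⟨Λ, hΛ, hΛx⟩ := exists_aut (fun i => linPart A n (Θ (relCoord A i))) hΘ.special_linPart
  refine ⟨Λ, hΛ, fun i => hΛx i ▸ linPart_mem_linForms _,
    eq_of_le_of_flat hI.toIsAdmissible (hJ.toIsAdmissible.comap hΛ)
      (le_of_relLogDer_le hf (hJ.toIsAdmissible.comap hΛ) ?_)⟩
  have hΛΘ : ∀ y ∈ linForms A n, linPart A n (Θ y) = Λ y := by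
    intro y hy
    rw [← mem_linForms_iff.mp hy, linPart_apply y, map_sum, map_sum, map_sum]
    exact Finset.sum_congr rfl fun k _ => by rw [map_smul, map_smul, map_smul, hΛx]
  have hbasis : ∀ k, (b k : Fin n → RelGerm A n) ∈ relLogDer (J.comap Λ) := by
    intro k
    set a : Fin n → RelGerm A n := (b k).1
    set d := pullField Θ.symm a
    have hd : d ∈ relLogDer J := hpush _ (b k).2
    have h1 := linPart_mem_relLogDer hc hd
    -- Take linear parts in `Θ(aᵢ) = ∑ⱼ dⱼ ∂ⱼ(Θ xᵢ)`. As `aᵢ` is linear, the left side becomes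
    -- `Λ(aᵢ)`. As `dⱼ` vanishes along the zero section, the right side becomes the linear part of
    -- `d` applied to `Λ xᵢ`.
    have h2 : pullField Λ (fun i => linPart A n (d i)) = a := by
      funext i
      rw [pullField, AlgEquiv.symm_apply_eq, ← hΛΘ _ (hb k i)]
      change _ = linPart A n (Θ (a i))
      have h3 := hpush_apply a (relCoord A i)
      rw [fieldDer_relCoord] at h3
      rw [← h3, fieldDer_apply, fieldDer_apply, map_sum]
      refine Finset.sum_congr rfl fun j _ => ?_
      have h4 : relPartialD A j (Λ (relCoord A i)) = algebraMap A (RelGerm A n)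
          (relEval A n (relPartialD A j (Θ (relCoord A i)))) := by
        rw [hΛx, linPart_apply, map_sum]
        simp only [map_smul, relPartialD_relCoord]
        simp [Algebra.smul_def]
      rw [h4, linPart_mul, relEval_eq_zero_of_mem_relLogDer hc hd, zero_smul, zero_add,
        Algebra.smul_def, mul_comm]
    rw [← h2]
    exact pullField_mem Λ h1
  intro a ha
  have h1 : a = ∑ k, b.repr ⟨a, ha⟩ k • (b k : Fin n → RelGerm A n) := by
    funext i
    rw [eq_sum_repr (b := b) ha i, Finset.sum_apply]
    rfl
  rw [h1]
  exact Submodule.sum_mem _ fun k _ => Submodule.smul_mem _ _ (hbasis k)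

/-! ### Schlessinger's conditions for linearly admissible deformations -/

/-- Linearly admissible deformations that agree over `A` can be glued. -/
theorem IsLinearlyAdmissible.exists_glue {A' A'' A : ArtAlg} {n : ℕ} {f : HolGerm n} (hf : f ≠ 0)
    {φ : A' ⟶ A} {ψ : A'' ⟶ A} (hψ : Function.Surjective (show A'' →ₐ[ℂ] A from ψ))
    {I' : Ideal (RelGerm A' n)} {I'' : Ideal (RelGerm A'' n)} (hI' : IsLinearlyAdmissible f A' I')
    (hI'' : IsLinearlyAdmissible f A'' I'')
    (h : I'.map (relMap (A := A') (B := A) n φ) = I''.map (relMap (A := A'') (B := A) n ψ)) :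
    ∃ I : Ideal (RelGerm (ArtAlg.pullback φ ψ) n), IsLinearlyAdmissible f (ArtAlg.pullback φ ψ) I ∧
      I.map (relFst n φ ψ) = I' ∧ I.map (relSnd n φ ψ) = I'' := by
  obtain ⟨I, hI, h1, h2⟩ := hI'.toIsAdmissible.exists_glue hf hψ hI''.toIsAdmissible h
  obtain ⟨b', hb'⟩ := hI'.linear
  obtain ⟨b'', hb''⟩ := hI''.linear
  have hlift : ∀ j, ∃ a ∈ relLogDer I, (∀ i, a i ∈ linForms (ArtAlg.pullback φ ψ) n) ∧
      ∀ i, relFst n φ ψ (a i) = (b' j : Fin n → RelGerm A' n) i := by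
    intro j
    -- The restriction to `A` of a linear basis field lifts to a logarithmic field `a₀` over `A''`
    -- that need not be linear. Its linear part is still logarithmic and has the same restriction to
    -- `A`, which was linear already, so it glues with the basis field.
    obtain ⟨a₀, ha₀, haa⟩ := hI''.toIsAdmissible.exists_lift_field (A := A) (ψ := ψ) hψ
      (a := mapField (A := A') (B := A) φ (b' j))
      (h ▸ relMap_mem_relLogDer (A := A') (B := A) φ (b' j).2)
    obtain ⟨a, h5, h6⟩ := exists_glue_field φ ψ
      (a' := (b' j : Fin n → RelGerm A' n)) (a'' := fun i => linPart A'' n (a₀ i)) (by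
        funext i
        have h7 := congrFun haa i
        change relMap (A := A') (B := A) n φ _ = relMap (A := A'') (B := A) n ψ (linPart A'' n (a₀ i))
        change relMap (A := A'') (B := A) n ψ (a₀ i) = relMap (A := A') (B := A) n φ _ at h7
        rw [relMap_linPart, h7, ← relMap_linPart, mem_linForms_iff.mp (hb' j i)])
    refine ⟨a, mem_relLogDer_of_factors hf hI.flat hI.fibre ?_ ?_, fun i => ?_, h5⟩
    · rw [h1, funext h5]; exact (b' j).2
    · rw [h2, funext h6]; exact linPart_mem_relLogDer hb'' ha₀
    · rw [mem_linForms_iff]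
      refine glue_ext ?_ ?_
      · rw [relMap_linPart]
        change linPart A' n (relFst n φ ψ (a i)) = relFst n φ ψ (a i)
        rw [h5, mem_linForms_iff.mp (hb' j i)]
      · rw [relMap_linPart]
        change linPart A'' n (relSnd n φ ψ (a i)) = relSnd n φ ψ (a i)
        rw [h6, mem_linForms_iff.mp (linPart_mem_linForms _)]
  choose a ha halin haf using hlift
  obtain ⟨b₀, hb₀⟩ := hI'.toIsAdmissible.exists_special_basis b'
  -- The glued linear fields restrict on the special fibre to a basis of Der(-log D), hence form a
  -- basis themselves.
  obtain ⟨b, hb⟩ := exists_basis_of_lift hI.flat hI.fibre b₀ (fun j => ⟨a j, ha j⟩) (fun j => by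
    rw [← hb₀, ← funext (haf j)]
    exact (specialField_relMap (A := ArtAlg.pullback φ ψ) (B := A')
      (ArtAlg.pullbackFst φ ψ) (a j)).symm)
  exact ⟨I, { hI with linear := ⟨b, fun j i => by rw [hb]; exact halin j i⟩ }, h1, h2⟩

/-- The argument for `FD` with linear automorphisms: the isomorphism over `A` is replaced by a
linear one with a linear lift, so moving `I''` by it preserves linear admissibility. -/
theorem LFD_fibreMap_surjective {n : ℕ} {f : HolGerm n} (hf : IsFreeDivisor f)
    (hlin : IsLinearDivisor f) {A' A'' A : ArtAlg} (φ : A' ⟶ A) (ψ : A'' ⟶ A)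
    (hψ : Function.Surjective (show A'' →ₐ[ℂ] A from ψ)) :
    Function.Surjective (fibreMap (LFD f hlin) φ ψ) := by
  rintro ⟨⟨x', x''⟩, hx⟩
  induction x' using Quotient.inductionOn with | h I' => ?_
  induction x'' using Quotient.inductionOn with | h I'' => ?_
  obtain ⟨Λ, hΛ, hΛlin, hcomap⟩ := (I'.2.map (B := A) φ).exists_linear_aut hf
    (I''.2.map (B := A) ψ) (Quotient.exact hx)
  choose y₀ hy₀ using fun i => relMap_surjective n hψ (Λ (relCoord A i))
  -- Arbitrary lifts of the linear forms `Λ xᵢ` may be replaced by their linear parts, since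
  -- restriction commutes with `linPart`.
  have hy : ∀ i, relMap (A := A'') (B := A) n ψ (linPart A'' n (y₀ i)) = Λ (relCoord A i) :=
    fun i => by
      rw [relMap_linPart, ← mem_linForms_iff.mp (hΛlin i)]
      exact congrArg _ (hy₀ i)
  obtain ⟨Λ', hΛ', hΛx, hcomm⟩ := hΛ.exists_lift (B := A'') ψ _ hy
  have hΛlin' : ∀ i, Λ' (relCoord A'' i) ∈ linForms A'' n := fun i => by
    rw [hΛx]; exact linPart_mem_linForms _
  obtain ⟨I, hI, h1, h2⟩ := I'.2.exists_glue hf.ne_zero hψ (I''.2.comap hΛ' hΛlin')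
    (hcomap.trans (map_relMap_comap hψ hcomm I''.1).symm)
  refine ⟨Quotient.mk _ ⟨I, hI⟩, Subtype.ext (Prod.ext ?_ ?_)⟩
  · exact congrArg (Quotient.mk _) (Subtype.ext h1)
  · have h3 : (⟨I.map (relSnd n φ ψ), hI.map (B := A'') (ArtAlg.pullbackSnd φ ψ)⟩ :
        {I : Ideal (RelGerm A'' n) // IsLinearlyAdmissible f A'' I}) =
        ⟨I''.1.comap Λ', I''.2.comap hΛ' hΛlin'⟩ := Subtype.ext h2
    have h4 : Quotient.mk (linearlyAdmissibleSetoid f A'')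
        ⟨I''.1.comap Λ', I''.2.comap hΛ' hΛlin'⟩ = Quotient.mk _ I'' :=
      Quotient.sound (I''.2.toIsAdmissible.comap_defIso hΛ')
    exact (congrArg (Quotient.mk _) h3).trans h4

/-- Isomorphism of linearly admissible deformations means isomorphism of the underlying
deformations, so the gluing over ℂ used for `FD` applies unchanged. -/
theorem LFD_fibreMap_injective {n : ℕ} {f : HolGerm n} (hf : f ≠ 0) (hlin : IsLinearDivisor f)
    {A' A'' : ArtAlg} (φ : A' ⟶ ArtAlg.base) (ψ : A'' ⟶ ArtAlg.base) :
    Function.Injective (fibreMap (LFD f hlin) φ ψ) := by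
  intro x y hxy
  induction x using Quotient.inductionOn with | h I => ?_
  induction y using Quotient.inductionOn with | h K => ?_
  have h1 := congrArg Subtype.val hxy
  exact Quotient.sound (DefIso.of_factors hf I.2.toIsAdmissible K.2.toIsAdmissible
    (Quotient.exact (congrArg Prod.fst h1)) (Quotient.exact (congrArg Prod.snd h1)))

theorem LFD_H1 {n : ℕ} {f : HolGerm n} (hf : IsFreeDivisor f) (hlin : IsLinearDivisor f) :
    SchlessingerH1 (LFD f hlin) :=
  fun _ _ _ φ ψ h => LFD_fibreMap_surjective hf hlin φ ψ h.1

theorem LFD_H2 {n : ℕ} {f : HolGerm n} (hf : IsFreeDivisor f) (hlin : IsLinearDivisor f) :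
    SchlessingerH2 (LFD f hlin) :=
  fun _ φ ψ => ⟨LFD_fibreMap_injective hf.ne_zero hlin φ ψ,
    LFD_fibreMap_surjective hf hlin φ ψ (surjective_of_base ψ)⟩

end

theorem mainTheorem7 (n : ℕ) (f : HolGerm n) (hf : IsFreeDivisor f) :
    (SchlessingerH1 (FD f) ∧ SchlessingerH2 (FD f)) ∧
      ∀ hlin : IsLinearDivisor f, SchlessingerH1 (LFD f hlin) ∧ SchlessingerH2 (LFD f hlin) :=
  ⟨⟨FD_H1 hf.ne_zero, FD_H2 hf.ne_zero⟩, fun hlin => ⟨LFD_H1 hf hlin, LFD_H2 hf hlin⟩⟩
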